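/- Consider the plant $x_{t+1}=Ax_t+B_uu_t+B_ww_t$ ($x_t\in\mathbb R^{n_x}$, $u_t\in\mathbb R^{n_u}$, $w_t\in\mathbb R^{n_w}$) with $A$ nonsingular, $(A,B_u)$ stabilizable, $Q\succeq 0$, $R\succ 0$ and $(A,Q)$ detectable. Let $P\succeq 0$ be the (existing and unique) stabilizing solution of the discrete algebraic Riccati equation $$0=P-A^\top PA-Q+A^\top PB_uH^{-1}B_u^\top PA,\qquad H:=R+B_u^\top PB_u\succ 0,$$ i.e. the solution for which $\hat A:=A-B_uK_x$ has spectral radius less than $1$, where $K_x:=H^{-1}B_u^\top PA$, $K_w:=H^{-1}B_u^\top PB_w$, $K_v:=H^{-1}B_u^\top$. Let $w=(w_0,w_1,\ldots)$ be an IID sequence of random vectors with $\mathbb E[w_i]=0$ and $\mathbb E[w_iw_j^\top]=\delta_{ij}I$, and let the (possibly deterministic) initial state $x_0$ be square integrable and independent of $w$. The per-step cost of a trajectory is $J_\infty:=\lim_{T\to\infty}\frac1T\sum_{t=0}^{T-1}(x_t^\top Qx_t+u_t^\top Ru_t)$ (read as an upper limit with values in $[0,\infty]$ if the limit does not exist).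 For $p\ge 0$, a policy with $p$ steps of preview is a sequence of (possibly randomized) rules that draw $u_t$ from a law depending on $i_t=(x_0,\dots,x_t,w_0,\dots,w_{t+p})$ only; it is stabilizing if the state is uniformly bounded in mean and in second moment. Let $J^*_{\infty,p}$ be the minimum of $\mathbb E[J_\infty\mid i_0]$ over the stabilizing policies with $p$ steps of preview. The noncausal controller is $u_t=-K_xx_t-K_ww_t-K_vv^{nc}_{t+1}$ with $v^{nc}_{t+1}=\sum_{j=t+1}^\infty(\hat A^\top)^{j-t}PB_ww_j$ (a series that almost surely converges for all $t$), and $J^*_{\infty,nc}:=\mathbb E[J_\infty\mid x_0]$ is its expected per-step cost. Then: 1. The Lyapunov equation $\hat A^\top X\hat A-X+PB_wB_w^\top P=0$ has a unique solution $X$. Under the noncausal controller the limit $J_\infty$ exists almost surely and is integrable, and its conditional expectation does not depend on $x_0$ and equals $$J^*_{\infty,nc}=\operatorname{trace}[PB_wB_w^\top]-\operatorname{trace}[HK_vXK_v^\top].$$ 2. For each $p\ge 0$ the minimum $J^*_{\infty,p}$ exists, is achieved by the controller $u_t=-K_xx_t-K_ww_t-K_v\sum_{j=t+1}^{t+p}(\hat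 A^\top)^{j-t}PB_ww_j$ (which is stabilizing and for which the limit $J_\infty$ exists almost surely and is integrable), does not depend on $i_0$, and equals $$J^*_{\infty,p}=\operatorname{trace}[PB_wB_w^\top]-\operatorname{trace}\Big[\sum_{j=0}^{p}HK_v(\hat A^\top)^jPB_wB_w^\top P\hat A^jK_v^\top\Big].$$ 3. $J^*_{\infty,p}\to J^*_{\infty,nc}$ as $p\to\infty$. -/

import Mathlib

open MeasureTheory ProbabilityTheory Filter Topology Matrix
open scoped ENNReal

namespace PreviewLQR

/-- Matrices of the plant `x (t+1) = A x t + Bu u t + Bw w t` and of the per-step cost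
`xᵀ Q x + uᵀ R u`. -/
structure Plant (nx nu nw : ℕ) where
  A : Matrix (Fin nx) (Fin nx) ℝ
  Bu : Matrix (Fin nx) (Fin nu) ℝ
  Bw : Matrix (Fin nx) (Fin nw) ℝ
  Q : Matrix (Fin nx) (Fin nx) ℝ
  R : Matrix (Fin nu) (Fin nu) ℝ

/-- A real square matrix is Schur if its (complex) spectral radius is `< 1`. -/
def IsSchur {n : ℕ} (M : Matrix (Fin n) (Fin n) ℝ) : Prop :=
  spectralRadius ℂ (M.map (algebraMap ℝ ℂ)) < 1

/-- `(A, B)` is stabilizable. -/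
def IsStabilizable {n m : ℕ} (A : Matrix (Fin n) (Fin n) ℝ) (B : Matrix (Fin n) (Fin m) ℝ) :
    Prop :=
  ∃ F : Matrix (Fin m) (Fin n) ℝ, IsSchur (A + B * F)

/-- `(A, C)` is detectable. -/
def IsDetectable {n m : ℕ} (A : Matrix (Fin n) (Fin n) ℝ) (C : Matrix (Fin m) (Fin n) ℝ) :
    Prop :=
  ∃ L : Matrix (Fin n) (Fin m) ℝ, IsSchur (A + L * C)

namespace Plant

variable {nx nu nw : ℕ}

/-- Standing assumptions of the infinite-horizon problem. -/
structure Standing (S : Plant nx nu nw) : Prop where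
  nonsingular : IsUnit S.A.det
  stabilizable : IsStabilizable S.A S.Bu
  cost_state : S.Q.PosSemidef
  cost_input : S.R.PosDef
  detectable : IsDetectable S.A S.Q

/-- `H = R + Buᵀ P Bu`. -/
def H (S : Plant nx nu nw) (P : Matrix (Fin nx) (Fin nx) ℝ) : Matrix (Fin nu) (Fin nu) ℝ :=
  S.R + S.Buᵀ * P * S.Bu

/-- `Kx = H⁻¹ Buᵀ P A`. -/
noncomputable def Kx (S : Plant nx nu nw) (P : Matrix (Fin nx) (Fin nx) ℝ) :
    Matrix (Fin nu) (Fin nx) ℝ :=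
  (S.H P)⁻¹ * S.Buᵀ * P * S.A

/-- `Kw = H⁻¹ Buᵀ P Bw`. -/
noncomputable def Kw (S : Plant nx nu nw) (P : Matrix (Fin nx) (Fin nx) ℝ) :
    Matrix (Fin nu) (Fin nw) ℝ :=
  (S.H P)⁻¹ * S.Buᵀ * P * S.Bw

/-- `Kv = H⁻¹ Buᵀ`. -/
noncomputable def Kv (S : Plant nx nu nw) (P : Matrix (Fin nx) (Fin nx) ℝ) :
    Matrix (Fin nu) (Fin nx) ℝ :=
  (S.H P)⁻¹ * S.Buᵀ

/-- The closed-loop matrix `Â = A - Bu Kx`. -/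
noncomputable def Ahat (S : Plant nx nu nw) (P : Matrix (Fin nx) (Fin nx) ℝ) :
    Matrix (Fin nx) (Fin nx) ℝ :=
  S.A - S.Bu * S.Kx P

/-- `P ⪰ 0` is a stabilizing solution of the discrete algebraic Riccati equation. -/
structure IsStabilizingDARESolution (S : Plant nx nu nw) (P : Matrix (Fin nx) (Fin nx) ℝ) :
    Prop where
  posSemidef : P.PosSemidef
  posDef : (S.H P).PosDef
  dare : 0 = P - S.Aᵀ * P * S.A - S.Q + S.Aᵀ * P * S.Bu * (S.H P)⁻¹ * S.Buᵀ * P * S.A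
  schur : IsSchur (S.Ahat P)

/-- The Lyapunov equation `Âᵀ X Â - X + P Bw Bwᵀ P = 0`. -/
def IsLyapunovSolution (S : Plant nx nu nw) (P X : Matrix (Fin nx) (Fin nx) ℝ) : Prop :=
  (S.Ahat P)ᵀ * X * S.Ahat P - X + P * S.Bw * S.Bwᵀ * P = 0

/-- `trace[P Bw Bwᵀ] - trace[∑_{j=0}^p H Kv (Âᵀ)^j P Bw Bwᵀ P Â^j Kvᵀ]`. -/
noncomputable def previewCostFormula (S : Plant nx nu nw) (P : Matrix (Fin nx) (Fin nx) ℝ)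
    (p : ℕ) : ℝ :=
  (P * S.Bw * S.Bwᵀ).trace -
    (∑ j ∈ Finset.range (p + 1),
      S.H P * S.Kv P * (S.Ahat P)ᵀ ^ j * P * S.Bw * S.Bwᵀ * P * S.Ahat P ^ j * (S.Kv P)ᵀ).trace

/-- The preview signal at time `t + 1`: `v (t+1) = ∑_{j=t+1}^{t+p} (Âᵀ)^(j-t) P Bw w j`. -/
noncomputable def vPreview (S : Plant nx nu nw) (P : Matrix (Fin nx) (Fin nx) ℝ) (p : ℕ)
    (w : ℕ → Fin nw → ℝ) (t : ℕ) : Fin nx → ℝ :=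
  ∑ j ∈ Finset.Icc (t + 1) (t + p), ((S.Ahat P)ᵀ ^ (j - t) * P * S.Bw) *ᵥ w j

/-- The `l`-th term, `(Âᵀ)^(l+1) P Bw w (t+1+l)`, of the anticausal series at time `t + 1`. -/
noncomputable def vNoncausalTerm (S : Plant nx nu nw) (P : Matrix (Fin nx) (Fin nx) ℝ)
    (w : ℕ → Fin nw → ℝ) (t l : ℕ) : Fin nx → ℝ :=
  ((S.Ahat P)ᵀ ^ (l + 1) * P * S.Bw) *ᵥ w (t + 1 + l)

/-- The noncausal signal at time `t + 1`: `v (t+1) = ∑_{j=t+1}^∞ (Âᵀ)^(j-t) P Bw w j`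
(indexed here by `l = j - t - 1`). -/
noncomputable def vNoncausal (S : Plant nx nu nw) (P : Matrix (Fin nx) (Fin nx) ℝ)
    (w : ℕ → Fin nw → ℝ) (t : ℕ) : Fin nx → ℝ :=
  ∑' l : ℕ, S.vNoncausalTerm P w t l

end Plant

variable {nx nu nw : ℕ} {Ω : Type*} [MeasurableSpace Ω]

/-- IID noise with `E[w i] = 0` and `E[w i (w j)ᵀ] = δ_ij I`. -/
structure IsWhiteNoise (μ : Measure Ω) (w : ℕ → Ω → Fin nw → ℝ) : Prop where
  meas : ∀ t, Measurable (w t)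
  indep : iIndepFun w μ
  ident : ∀ t, IdentDistrib (w t) (w 0) μ μ
  memLp : ∀ t, MemLp (w t) 2 μ
  mean : ∀ t a, ∫ ω, w t ω a ∂μ = 0
  cov : ∀ i j a b, ∫ ω, w i ω a * w j ω b ∂μ = if i = j ∧ a = b then 1 else 0

/-- A square-integrable initial state, independent of the noise (a deterministic initial state is
the special case of a constant function). -/
structure IsInitialState (μ : Measure Ω) (w : ℕ → Ω → Fin nw → ℝ) (x₀ : Ω → Fin nx → ℝ) :
    Prop where
  meas : Measurable x₀
  memLp : MemLp x₀ 2 μ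
  indep : IndepFun x₀ (fun ω t => w t ω) μ

/-- State and input sequences that start at `x₀` and obey the plant dynamics. -/
structure IsTrajectory (S : Plant nx nu nw) (w : ℕ → Ω → Fin nw → ℝ) (x₀ : Ω → Fin nx → ℝ)
    (x : ℕ → Ω → Fin nx → ℝ) (u : ℕ → Ω → Fin nu → ℝ) : Prop where
  init : ∀ ω, x 0 ω = x₀ ω
  step : ∀ t ω, x (t + 1) ω = S.A *ᵥ x t ω + S.Bu *ᵥ u t ω + S.Bw *ᵥ w t ω

/-- Values of the information `i_t = (x 0, …, x t, w 0, …, w (t + p))`. -/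
abbrev Info (nx nw p t : ℕ) : Type :=
  (Fin (t + 1) → Fin nx → ℝ) × (Fin (t + p + 1) → Fin nw → ℝ)

/-- The information `i_t` along a trajectory. -/
def info (p : ℕ) (w : ℕ → Ω → Fin nw → ℝ) (x : ℕ → Ω → Fin nx → ℝ) (t : ℕ) (ω : Ω) :
    Info nx nw p t :=
  (fun s => x s ω, fun s => w s ω)

/-- A (possibly randomized) policy with `p` steps of preview: the law of `u t` given `i_t`. -/
structure Policy (nx nu nw p : ℕ) where
  kernel : ∀ t, Kernel (Info nx nw p t) (Fin nu → ℝ)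
  markov : ∀ t, IsMarkovKernel (kernel t)

/-- The σ-algebra of everything that precedes the draw of `u t`: the initial state, the whole
noise sequence and the earlier inputs. -/
@[reducible] def sigmaBefore (w : ℕ → Ω → Fin nw → ℝ) (x₀ : Ω → Fin nx → ℝ) (u : ℕ → Ω → Fin nu → ℝ) (t : ℕ) :
    MeasurableSpace Ω :=
  MeasurableSpace.comap x₀ inferInstance ⊔
    (⨆ s, MeasurableSpace.comap (w s) inferInstance) ⊔
    (⨆ s, ⨆ _ : s < t, MeasurableSpace.comap (u s) inferInstance)

/-- `(x, u)` is a closed loop of the plant with the policy `K`: at each `t` the input is drawn from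
`K t (· | i_t)`, whatever the initial state, the noise (future noise included) and the earlier
draws are. -/
structure IsClosedLoop (S : Plant nx nu nw) (μ : Measure Ω) (w : ℕ → Ω → Fin nw → ℝ)
    (x₀ : Ω → Fin nx → ℝ) {p : ℕ} (K : Policy nx nu nw p)
    (x : ℕ → Ω → Fin nx → ℝ) (u : ℕ → Ω → Fin nu → ℝ) : Prop
    extends IsTrajectory S w x₀ x u where
  meas_input : ∀ t, Measurable (u t)
  law_input : ∀ t (E : Set (Fin nu → ℝ)), MeasurableSet E →
    μ⟦u t ⁻¹' E | sigmaBefore w x₀ u t⟧ =ᵐ[μ] fun ω => (K.kernel t (info p w x t ω)).real E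

/-- The state is uniformly bounded in mean and in second moment. -/
def IsStabilized (μ : Measure Ω) (x : ℕ → Ω → Fin nx → ℝ) : Prop :=
  ∃ C : ℝ, ∀ t, MemLp (x t) 2 μ ∧ (∀ a, |∫ ω, x t ω a ∂μ| ≤ C) ∧ ∫ ω, x t ω ⬝ᵥ x t ω ∂μ ≤ C

/-- `(1/T) ∑_{t<T} (x_tᵀ Q x_t + u_tᵀ R u_t)`. -/
noncomputable def averageCost (S : Plant nx nu nw) (x : ℕ → Ω → Fin nx → ℝ)
    (u : ℕ → Ω → Fin nu → ℝ) (T : ℕ) (ω : Ω) : ℝ :=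
  (1 / (T : ℝ)) * ∑ t ∈ Finset.range T,
    (x t ω ⬝ᵥ (S.Q *ᵥ x t ω) + u t ω ⬝ᵥ (S.R *ᵥ u t ω))

/-- The limit `J_∞ = lim_T averageCost T` exists almost surely and is integrable, and
`E[J_∞ | m] = c` almost surely. -/
def HasExpectedPerStepCost (S : Plant nx nu nw) (μ : Measure Ω) (m : MeasurableSpace Ω)
    (x : ℕ → Ω → Fin nx → ℝ) (u : ℕ → Ω → Fin nu → ℝ) (c : ℝ) : Prop :=
  ∃ J : Ω → ℝ, (∀ᵐ ω ∂μ, Tendsto (fun T => averageCost S x u T ω) atTop (𝓝 (J ω))) ∧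
    Integrable J μ ∧ μ[J | m] =ᵐ[μ] fun _ => c

/-- The per-step cost of an arbitrary trajectory, in `[0, ∞]`; the upper limit is the limit
wherever the latter exists. -/
noncomputable def perStepCost (S : Plant nx nu nw) (x : ℕ → Ω → Fin nx → ℝ)
    (u : ℕ → Ω → Fin nu → ℝ) (ω : Ω) : ℝ≥0∞ :=
  limsup (fun T => ENNReal.ofReal (averageCost S x u T ω)) atTop

/-- The σ-algebra of the initial information `i_0 = (x 0, w 0, …, w p)`. -/
@[reducible] def sigmaInitial (p : ℕ) (w : ℕ → Ω → Fin nw → ℝ) (x₀ : Ω → Fin nx → ℝ) : MeasurableSpace Ω :=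
  MeasurableSpace.comap x₀ inferInstance ⊔
    (⨆ s, ⨆ _ : s ≤ p, MeasurableSpace.comap (w s) inferInstance)

/-- `c` is the minimum of `E[J_∞ | i_0]` over the stabilizing policies with `p` steps of preview. -/
def IsOptimalPreviewCost (S : Plant nx nu nw) (μ : Measure Ω) (w : ℕ → Ω → Fin nw → ℝ)
    (x₀ : Ω → Fin nx → ℝ) (p : ℕ) (c : ℝ) : Prop :=
  (∃ (K : Policy nx nu nw p) (x : ℕ → Ω → Fin nx → ℝ) (u : ℕ → Ω → Fin nu → ℝ),
    IsClosedLoop S μ w x₀ K x u ∧ IsStabilized μ x ∧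
      HasExpectedPerStepCost S μ (sigmaInitial p w x₀) x u c) ∧
  ∀ (K : Policy nx nu nw p) (x : ℕ → Ω → Fin nx → ℝ) (u : ℕ → Ω → Fin nu → ℝ),
    IsClosedLoop S μ w x₀ K x u → IsStabilized μ x →
      ∀ᵐ ω ∂μ, ENNReal.ofReal c ≤ (μ⁻[perStepCost S x u | sigmaInitial p w x₀]) ω

/-- The input of the controller `u t = -Kx x t - Kw w t - Kv v (t+1)` with the `p`-step preview
signal `v`. -/
def IsPreviewInput (S : Plant nx nu nw) (P : Matrix (Fin nx) (Fin nx) ℝ) (p : ℕ)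
    (w : ℕ → Ω → Fin nw → ℝ) (x : ℕ → Ω → Fin nx → ℝ) (u : ℕ → Ω → Fin nu → ℝ) : Prop :=
  ∀ t ω, u t ω = -(S.Kx P *ᵥ x t ω) - S.Kw P *ᵥ w t ω -
    S.Kv P *ᵥ S.vPreview P p (fun s => w s ω) t

/-- The input of the noncausal controller `u t = -Kx x t - Kw w t - Kv v (t+1)` with the noncausal
signal `v`. -/
def IsNoncausalInput (S : Plant nx nu nw) (P : Matrix (Fin nx) (Fin nx) ℝ)
    (w : ℕ → Ω → Fin nw → ℝ) (x : ℕ → Ω → Fin nx → ℝ) (u : ℕ → Ω → Fin nu → ℝ) : Prop :=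
  ∀ t ω, u t ω = -(S.Kx P *ᵥ x t ω) - S.Kw P *ᵥ w t ω -
    S.Kv P *ᵥ S.vNoncausal P (fun s => w s ω) t

end PreviewLQR

namespace PreviewLQR

/-! ### Schur matrices: decay of powers, contraction norms, response of stable filters -/

section Schur

attribute [local instance] Matrix.linftyOpNormedAddCommGroup Matrix.linftyOpNormedRing
  Matrix.linftyOpNormedAlgebra

/-! The proof is a pathwise completion of the square followed by laws of large numbers. Suppose a
signal satisfies the backward recursion `v t = Âᵀ (P Bw w t + v (t+1))`, and let `d t` be the
deviation of `u t` from `-Kx x t - Kw w t - Kv v (t+1)`. The Riccati equation writes the stage cost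
as a decrement of `xᵀPx + 2 xᵀv`, plus `dᵀ H d`, plus terms in the noise and in `v`. The latter
contain a quadratic form in `Kv (P Bw w + v)`. Adding `vᵀYv` to the storage function, where `Y = Â Y
Âᵀ + Kvᵀ H Kv`, makes this form telescope too (`Plant.cost_step`). What is left is a quadratic form
in `w t`, whose average tends to a trace, and products of `w t` with `v (t+1)`. Since `v (t+1)`
depends on later noise only, these products average to zero.

For the noncausal signal the recursion is exact. With `p` steps of preview the truncated signal has
the defect `E w (t+p)`, where `E = (Âᵀ)^(p+1) P Bw`. This adds `trace (Eᵀ Y E)` to the limit,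
together with cross terms of `x t` and `v t` against `w (t+p)`. In closed loop, everything
determined before `w (t+p)` is revealed is independent of it (`IsClosedLoop.indep_sigmaPast`). The
cross terms are therefore orthogonal sequences, and they average to zero
(`ae_hasAverage_zero_of_orthogonal`).

Hence the average cost up to `T` is the trace formula, plus the average of `dᵀ H d ≥ 0`, minus
`storage / T`, up to a vanishing term. The preview controller has `d = 0` and a state that is
`o(√t)`, so it attains the formula. For any other stabilizing policy the bounded second moments make
`storage / T` vanish almost surely along `T = n²`, which is enough to bound an upper limit from
below (`IsClosedLoop.ae_le_perStepCost`). All limits are almost surely constant, so conditioning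
changes nothing.

The equation of `Y` also turns the trace sums of the statement into telescoping sums
(`Plant.trace_Kv_eq`), and `X` is the sum of the series whose partial sums occur in the preview
formula. The matrix `P` is obtained by value iteration from zero, bounded through stabilizability;
detectability makes its closed loop Schur. -/

lemma norm_map_algebraMap {n : ℕ} (M : Matrix (Fin n) (Fin n) ℝ) :
    ‖M.map (algebraMap ℝ ℂ)‖ = ‖M‖ := by
  simp [Matrix.linfty_opNorm_def]

lemma map_pow_algebraMap {n : ℕ} (M : Matrix (Fin n) (Fin n) ℝ) (k : ℕ) :
    (M ^ k).map (algebraMap ℝ ℂ) = (M.map (algebraMap ℝ ℂ)) ^ k := by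
  have := map_pow (algebraMap ℝ ℂ).mapMatrix M k
  simpa using this

/-- The powers of a Schur matrix decay geometrically. -/
lemma IsSchur.exists_norm_pow_mulVec_le {n : ℕ} {M : Matrix (Fin n) (Fin n) ℝ} (hM : IsSchur M) :
    ∃ C r : ℝ, 0 < C ∧ 0 < r ∧ r < 1 ∧ ∀ (k : ℕ) (x : Fin n → ℝ), ‖M ^ k *ᵥ x‖ ≤ C * r ^ k * ‖x‖ := by
  obtain ⟨r, hr, hr1⟩ := ENNReal.lt_iff_exists_nnreal_btwn.1 hM
  have hr1' : (r : ℝ) < 1 := by exact_mod_cast hr1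
  have hr0 : 0 < r := by
    rw [← ENNReal.coe_pos]; exact lt_of_le_of_lt zero_le hr
  -- Gelfand's formula: the `k`-th root of the norm of the `k`-th power is eventually below `r`.
  have h := (spectrum.pow_nnnorm_pow_one_div_tendsto_nhds_spectralRadius
    (M.map (algebraMap ℝ ℂ))).eventually_lt_const hr
  obtain ⟨k₀, hk₀⟩ := eventually_atTop.1 h
  have hbig : ∀ k, k₀ + 1 ≤ k → ‖M ^ k‖ ≤ (r : ℝ) ^ k := by
    intro k hk
    have h1 := hk₀ k (by omega)
    have hk' : (k : ℝ) ≠ 0 := by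
      have : k ≠ 0 := by omega
      exact_mod_cast this
    have h2 := ENNReal.rpow_le_rpow h1.le (z := (k : ℝ)) (by positivity)
    rw [← ENNReal.rpow_mul, one_div, inv_mul_cancel₀ hk', ENNReal.rpow_one,
      ENNReal.rpow_natCast] at h2
    have h3 : ‖(M.map (algebraMap ℝ ℂ)) ^ k‖₊ ≤ r ^ k := by exact_mod_cast h2
    have h4 : ‖(M.map (algebraMap ℝ ℂ)) ^ k‖ ≤ (r : ℝ) ^ k := by exact_mod_cast h3
    rwa [← map_pow_algebraMap, norm_map_algebraMap] at h4
  have hr0' : (0 : ℝ) < r := by exact_mod_cast hr0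
  -- The `1` serves the large powers, the sum the finitely many small ones.
  refine ⟨1 + ∑ k ∈ Finset.range (k₀ + 1), ‖M ^ k‖ / (r : ℝ) ^ k, r, ?_, hr0', hr1', ?_⟩
  · positivity
  intro k x
  refine (Matrix.linfty_opNorm_mulVec _ _).trans ?_
  gcongr
  by_cases hk : k₀ + 1 ≤ k
  · refine (hbig k hk).trans (le_mul_of_one_le_left (by positivity) ?_)
    have : 0 ≤ ∑ k ∈ Finset.range (k₀ + 1), ‖M ^ k‖ / (r : ℝ) ^ k := by positivity
    linarith
  · have : ‖M ^ k‖ / (r : ℝ) ^ k ≤ ∑ k ∈ Finset.range (k₀ + 1), ‖M ^ k‖ / (r : ℝ) ^ k :=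
      Finset.single_le_sum (f := fun k => ‖M ^ k‖ / (r : ℝ) ^ k) (fun i _ => by positivity)
        (Finset.mem_range.2 (by omega))
    rw [← div_le_iff₀ (by positivity)]
    linarith

/-- A matrix whose powers tend to zero pointwise is Schur. -/
lemma isSchur_of_tendsto_pow_mulVec {n : ℕ} {M : Matrix (Fin n) (Fin n) ℝ}
    (h : ∀ x : Fin n → ℝ, Tendsto (fun k : ℕ => M ^ k *ᵥ x) atTop (𝓝 0)) : IsSchur M := by
  have h1 : Tendsto (fun k : ℕ => M ^ k) atTop (𝓝 0) := by
    refine tendsto_pi_nhds.2 fun i => tendsto_pi_nhds.2 fun j => ?_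
    have := (tendsto_pi_nhds.1 (h (Pi.single j 1))) i
    simpa using this
  have h2 : Tendsto (fun k : ℕ => ‖M ^ k‖) atTop (𝓝 0) := by simpa using h1.norm
  obtain ⟨k, hk⟩ := ((h2.comp (tendsto_add_atTop_nat 1)).eventually_lt_const zero_lt_one).exists
  -- The bound by a single power contains the norm of the identity, which is `1` only in positive
  -- dimension.
  rcases isEmpty_or_nonempty (Fin n) with hn | hn
  · have : Subsingleton (Matrix (Fin n) (Fin n) ℂ) := inferInstance
    unfold IsSchur
    rw [spectrum.SpectralRadius.of_subsingleton]
    exact zero_lt_one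
  unfold IsSchur
  refine (spectrum.spectralRadius_le_pow_nnnorm_pow_one_div ℂ (M.map (algebraMap ℝ ℂ)) k).trans_lt ?_
  rw [nnnorm_one, ENNReal.coe_one, ENNReal.one_rpow, mul_one]
  refine ENNReal.rpow_lt_one ?_ (by positivity)
  rw [← map_pow_algebraMap]
  have : ‖(M ^ (k + 1)).map (algebraMap ℝ ℂ)‖ < 1 := by rw [norm_map_algebraMap]; exact hk
  exact_mod_cast this

lemma norm_mulVec_le {m n : ℕ} (M : Matrix (Fin m) (Fin n) ℝ) :
    ∃ C : ℝ, 0 ≤ C ∧ ∀ x, ‖M *ᵥ x‖ ≤ C * ‖x‖ :=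
  ⟨‖M‖, norm_nonneg _, Matrix.linfty_opNorm_mulVec M⟩

end Schur

lemma IsSchur.exists_abs_pow_apply_le {n : ℕ} {M : Matrix (Fin n) (Fin n) ℝ} (hM : IsSchur M) :
    ∃ C r : ℝ, 0 < C ∧ 0 < r ∧ r < 1 ∧ ∀ (k : ℕ) (i j : Fin n), |(M ^ k) i j| ≤ C * r ^ k := by
  obtain ⟨C, r, hC, hr, hr1, h⟩ := hM.exists_norm_pow_mulVec_le
  refine ⟨C, r, hC, hr, hr1, fun k i j => ?_⟩
  have h1 := (norm_le_pi_norm (M ^ k *ᵥ Pi.single j 1) i).trans (h k (Pi.single j 1))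
  simpa [Pi.norm_single] using h1

lemma IsSchur.tendsto_pow {n : ℕ} {M : Matrix (Fin n) (Fin n) ℝ} (hM : IsSchur M) :
    Tendsto (fun k : ℕ => M ^ k) atTop (𝓝 0) := by
  obtain ⟨C, r, hC, hr, hr1, h⟩ := hM.exists_abs_pow_apply_le
  refine tendsto_pi_nhds.2 fun i => tendsto_pi_nhds.2 fun j => ?_
  refine squeeze_zero_norm (fun k => h k i j) ?_
  simpa using (tendsto_pow_atTop_nhds_zero_of_lt_one hr.le hr1).const_mul C

lemma IsSchur.transpose {n : ℕ} {M : Matrix (Fin n) (Fin n) ℝ} (hM : IsSchur M) :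
    IsSchur Mᵀ := by
  refine isSchur_of_tendsto_pow_mulVec fun x => ?_
  have h1 : Tendsto (fun k : ℕ => (M ^ k)ᵀ *ᵥ x) atTop (𝓝 ((0 : Matrix (Fin n) (Fin n) ℝ)ᵀ *ᵥ x)) :=
    ((by fun_prop : Continuous fun N : Matrix (Fin n) (Fin n) ℝ => Nᵀ *ᵥ x).tendsto 0).comp
      hM.tendsto_pow
  simpa [Matrix.transpose_pow] using h1

/-- A norm in which a Schur matrix is a contraction. -/
lemma IsSchur.exists_contraction {n : ℕ} {M : Matrix (Fin n) (Fin n) ℝ} (hM : IsSchur M) :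
    ∃ (N : (Fin n → ℝ) → ℝ) (C r : ℝ), 0 < C ∧ 0 < r ∧ r < 1 ∧ (∀ x, ‖x‖ ≤ N x) ∧
      (∀ x, N x ≤ C * ‖x‖) ∧ (∀ x y, N (x + y) ≤ N x + N y) ∧ ∀ x, N (M *ᵥ x) ≤ r * N x := by
  obtain ⟨C, r, hC, hr, hr1, h⟩ := hM.exists_norm_pow_mulVec_le
  have hb : ∀ x k, ‖M ^ k *ᵥ x‖ / r ^ k ≤ C * ‖x‖ := fun x k => by
    rw [div_le_iff₀ (by positivity)]
    linarith [h k x]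
  have hbdd : ∀ x, BddAbove (Set.range fun k => ‖M ^ k *ᵥ x‖ / r ^ k) := fun x =>
    ⟨C * ‖x‖, by rintro _ ⟨k, rfl⟩; exact hb x k⟩
  -- In this weighted supremum over the orbit, applying `M` shifts the index and costs one factor
  -- `r`.
  refine ⟨fun x => ⨆ k : ℕ, ‖M ^ k *ᵥ x‖ / r ^ k, C, r, hC, hr, hr1, fun x => ?_,
    fun x => ciSup_le (hb x), fun x y => ciSup_le fun k => ?_, fun x => ciSup_le fun k => ?_⟩
  · simpa using le_ciSup (hbdd x) 0
  · calc ‖M ^ k *ᵥ (x + y)‖ / r ^ k ≤ ‖M ^ k *ᵥ x‖ / r ^ k + ‖M ^ k *ᵥ y‖ / r ^ k := by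
          rw [← add_div, Matrix.mulVec_add]; gcongr; exact norm_add_le _ _
      _ ≤ _ := add_le_add (le_ciSup (hbdd x) k) (le_ciSup (hbdd y) k)
  · have h1 := le_ciSup (hbdd x) (k + 1)
    rw [Matrix.mulVec_mulVec, ← pow_succ]
    calc ‖M ^ (k + 1) *ᵥ x‖ / r ^ k = r * (‖M ^ (k + 1) *ᵥ x‖ / r ^ (k + 1)) := by
          rw [pow_succ r]; field_simp
      _ ≤ _ := by gcongr

/-- The recursion forgets its initial value geometrically, and an input that stays below `δ`
contributes at most the fixed point `δ / (1 - r)`. -/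
lemma tendsto_zero_of_le_mul_add {y ε : ℕ → ℝ} {r : ℝ} (hr : 0 ≤ r) (hr1 : r < 1)
    (hy : ∀ t, 0 ≤ y t) (h : ∀ t, y (t + 1) ≤ r * y t + ε t) (hε : Tendsto ε atTop (𝓝 0)) :
    Tendsto y atTop (𝓝 0) := by
  have hunroll : ∀ δ : ℝ, ∀ t₀, (∀ t ≥ t₀, ε t ≤ δ) → ∀ k, y (t₀ + k) ≤ r ^ k * y t₀ + δ / (1 - r) := by
    intro δ t₀ hδ k
    have hδ' : ∀ t ≥ t₀, ε t ≤ |δ| := fun t ht => (hδ t ht).trans (le_abs_self _)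
    have h1r : 0 < 1 - r := by linarith
    induction k with
    | zero =>
      by_cases hd : 0 ≤ δ
      · have : 0 ≤ δ / (1 - r) := by positivity
        simpa using this
      · exfalso
        push Not at hd
        have hle : (0 : ℝ) ≤ δ := le_of_tendsto hε (eventually_atTop.2 ⟨t₀, hδ⟩)
        linarith
    | succ k ih =>
      have h1 := h (t₀ + k)
      have h2 := hδ (t₀ + k) (by omega)
      have h3 := mul_le_mul_of_nonneg_left ih hr
      have h4 : r * (r ^ k * y t₀ + δ / (1 - r)) + δ = r ^ (k + 1) * y t₀ + δ / (1 - r) := by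
        field_simp; ring
      rw [← add_assoc]; linarith
  rw [Metric.tendsto_atTop]
  intro e he
  have h1r : 0 < 1 - r := by linarith
  obtain ⟨t₀, ht₀⟩ := eventually_atTop.1 (hε.eventually_le_const (show 0 < e / 2 * (1 - r) by positivity))
  have hp : Tendsto (fun k : ℕ => r ^ k * y t₀) atTop (𝓝 0) := by
    simpa using (tendsto_pow_atTop_nhds_zero_of_lt_one hr hr1).mul_const (y t₀)
  obtain ⟨k₀, hk₀⟩ := eventually_atTop.1 (hp.eventually_lt_const (show 0 < e / 2 by positivity))
  refine ⟨t₀ + k₀, fun t ht => ?_⟩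
  have h1 := hunroll _ t₀ ht₀ (t - t₀)
  have h2 := hk₀ (t - t₀) (by omega)
  rw [show t₀ + (t - t₀) = t by omega] at h1
  rw [mul_div_assoc, div_self h1r.ne', mul_one] at h1
  rw [Real.dist_eq, sub_zero, abs_of_nonneg (hy t)]
  linarith

/-- Convexity of the square with weights `r` and `1 - r`, applied to `a` and `b / (1 - r)`. -/
lemma sq_add_le_of_lt_one {a b r : ℝ} (hr : 0 < r) (hr1 : r < 1) :
    (r * a + b) ^ 2 ≤ r * a ^ 2 + b ^ 2 / (1 - r) := by
  have h1r : 0 < 1 - r := by linarith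
  have key : r * a ^ 2 + b ^ 2 / (1 - r) - (r * a + b) ^ 2 = r * ((1 - r) * a - b) ^ 2 / (1 - r) := by
    field_simp; ring
  have : 0 ≤ r * ((1 - r) * a - b) ^ 2 / (1 - r) := by positivity
  linarith

section Filtering

variable {n : ℕ} {M : Matrix (Fin n) (Fin n) ℝ}

/-- The response of a Schur filter to a vanishing input vanishes. -/
lemma IsSchur.tendsto_zero (hM : IsSchur M) {x ν : ℕ → Fin n → ℝ}
    (hx : ∀ t, x (t + 1) = M *ᵥ x t + ν t) (hν : Tendsto ν atTop (𝓝 0)) :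
    Tendsto x atTop (𝓝 0) := by
  obtain ⟨N, C, r, hC, hr, hr1, h1, h2, h3, h4⟩ := hM.exists_contraction
  have h0 : ∀ x, 0 ≤ N x := fun x => (norm_nonneg x).trans (h1 x)
  have hν' : Tendsto (fun t => C * ‖ν t‖) atTop (𝓝 0) := by
    simpa using (hν.norm).const_mul C
  have := tendsto_zero_of_le_mul_add (y := fun t => N (x t)) hr.le hr1 (fun t => h0 _)
    (fun t => by
      simp only [hx]
      linarith [h3 (M *ᵥ x t) (ν t), h4 (x t), h2 (ν t)]) hν'
  exact squeeze_zero_norm (fun t => h1 (x t)) this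

lemma IsSchur.exists_sq_contraction (hM : IsSchur M) :
    ∃ (q : (Fin n → ℝ) → ℝ) (C r : ℝ), 0 < C ∧ 0 < r ∧ r < 1 ∧ (∀ x, ‖x‖ ^ 2 ≤ q x) ∧
      (∀ x, q x ≤ C * ‖x‖ ^ 2) ∧ ∀ x y, q (M *ᵥ x + y) ≤ r * q x + C * ‖y‖ ^ 2 := by
  obtain ⟨N, C, r, hC, hr, hr1, h1, h2, h3, h4⟩ := hM.exists_contraction
  have h0 : ∀ x, 0 ≤ N x := fun x => (norm_nonneg x).trans (h1 x)
  have h1r : 0 < 1 - r := by linarith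
  have hsq : ∀ x, N x ^ 2 ≤ C ^ 2 * ‖x‖ ^ 2 := fun x => by
    rw [← mul_pow]; exact pow_le_pow_left₀ (h0 x) (h2 x) 2
  refine ⟨fun x => N x ^ 2, C ^ 2 / (1 - r), r, by positivity, hr, hr1,
    fun x => pow_le_pow_left₀ (norm_nonneg _) (h1 x) 2, fun x => ?_, fun x y => ?_⟩
  · refine (hsq x).trans ?_
    gcongr
    rw [le_div_iff₀ h1r]
    nlinarith [sq_nonneg C]
  · calc N (M *ᵥ x + y) ^ 2 ≤ (r * N x + N y) ^ 2 :=
          pow_le_pow_left₀ (h0 _) (by linarith [h3 (M *ᵥ x) y, h4 x]) 2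
      _ ≤ r * N x ^ 2 + N y ^ 2 / (1 - r) := sq_add_le_of_lt_one hr hr1
      _ ≤ _ := by
        rw [div_mul_eq_mul_div]
        gcongr
        exact hsq y

/-- The response of a Schur filter to an `o(√t)` input is `o(√t)`. -/
lemma IsSchur.tendsto_norm_sq_div (hM : IsSchur M) {x ν : ℕ → Fin n → ℝ}
    (hx : ∀ t, x (t + 1) = M *ᵥ x t + ν t)
    (hν : Tendsto (fun t : ℕ => ‖ν t‖ ^ 2 / (t : ℝ)) atTop (𝓝 0)) :
    Tendsto (fun t : ℕ => ‖x t‖ ^ 2 / (t : ℝ)) atTop (𝓝 0) := by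
  obtain ⟨q, C, r, hC, hr, hr1, h1, h2, h3⟩ := hM.exists_sq_contraction
  have h0 : ∀ x, 0 ≤ q x := fun x => (by positivity : 0 ≤ ‖x‖ ^ 2).trans (h1 x)
  have hν' : Tendsto (fun t : ℕ => C * (‖ν t‖ ^ 2 / (t + 2 : ℝ))) atTop (𝓝 0) := by
    rw [← mul_zero C]
    refine Tendsto.const_mul C (squeeze_zero' (Eventually.of_forall fun t => by positivity) ?_ hν)
    filter_upwards [eventually_gt_atTop 0] with t ht
    gcongr
    linarith
  -- Dividing by `t + 1` avoids the zero denominator at `t = 0`, and the growth of the denominator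
  -- only helps the contraction.
  have key := tendsto_zero_of_le_mul_add (y := fun t : ℕ => q (x t) / (t + 1 : ℝ)) hr.le hr1
    (fun t => div_nonneg (h0 _) (by positivity))
    (fun t => by
      have := h3 (x t) (ν t)
      rw [← hx] at this
      calc q (x (t + 1)) / ((t + 1 : ℕ) + 1 : ℝ) ≤ (r * q (x t) + C * ‖ν t‖ ^ 2) / ((t + 1 : ℕ) + 1 : ℝ) := by
            gcongr
        _ = r * (q (x t) / (t + 2)) + C * (‖ν t‖ ^ 2 / (t + 2 : ℝ)) := by
            push_cast; field_simp; ring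
        _ ≤ _ := by
            gcongr
            · exact h0 _
            · norm_num) hν'
  have key2 : Tendsto (fun t : ℕ => 2 * (q (x t) / (t + 1 : ℝ))) atTop (𝓝 0) := by
    simpa using key.const_mul 2
  refine squeeze_zero' (Eventually.of_forall fun t => by positivity) ?_ key2
  filter_upwards [eventually_gt_atTop 0] with t ht
  have ht' : (1 : ℝ) ≤ t := by exact_mod_cast ht
  have := h0 (x t)
  rw [← mul_div_assoc, div_le_div_iff₀ (by positivity) (by positivity)]
  nlinarith [h1 (x t)]

/-- The response of a Schur filter, bounded by the past inputs. -/
lemma IsSchur.exists_norm_sq_le (hM : IsSchur M) :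
    ∃ C r : ℝ, 0 < C ∧ 0 < r ∧ r < 1 ∧ ∀ x ν : ℕ → Fin n → ℝ, (∀ t, x (t + 1) = M *ᵥ x t + ν t) →
      ∀ t, ‖x t‖ ^ 2 ≤ C * ‖x 0‖ ^ 2 + C * ∑ s ∈ Finset.range t, r ^ (t - 1 - s) * ‖ν s‖ ^ 2 := by
  obtain ⟨q, C, r, hC, hr, hr1, h1, h2, h3⟩ := hM.exists_sq_contraction
  refine ⟨C, r, hC, hr, hr1, fun x ν hx t => (h1 _).trans ?_⟩
  induction t with
  | zero => simpa using h2 (x 0)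
  | succ t ih =>
    have h4 := h3 (x t) (ν t)
    rw [← hx] at h4
    rw [Finset.sum_range_succ]
    have h5 : ∑ s ∈ Finset.range t, r ^ (t + 1 - 1 - s) * ‖ν s‖ ^ 2 =
        r * ∑ s ∈ Finset.range t, r ^ (t - 1 - s) * ‖ν s‖ ^ 2 := by
      rw [Finset.mul_sum]
      refine Finset.sum_congr rfl fun s hs => ?_
      have : t + 1 - 1 - s = (t - 1 - s) + 1 := by have := Finset.mem_range.1 hs; omega
      rw [this, pow_succ]; ring
    rw [h5]
    have h6 : 0 ≤ C * ‖x 0‖ ^ 2 := by positivity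
    simp only [add_tsub_cancel_right, tsub_self, pow_zero, one_mul]
    nlinarith [mul_le_mul_of_nonneg_left ih hr.le]

end Filtering

/-! ### Discrete Lyapunov equations and positive semidefinite matrices -/

section Lyapunov

variable {n : ℕ}

/-- Iteration gives `X = L ^ k * X * M ^ k`, which tends to zero. Two different Schur factors are
allowed because uniqueness of the Riccati solution compares two closed loops. -/
lemma eq_zero_of_eq_mul_mul {L M X : Matrix (Fin n) (Fin n) ℝ} (hL : IsSchur L) (hM : IsSchur M)
    (h : X = L * X * M) : X = 0 := by
  have hk : ∀ k : ℕ, X = L ^ k * X * M ^ k := by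
    intro k
    induction k with
    | zero => simp
    | succ k ih =>
      calc X = L ^ k * X * M ^ k := ih
        _ = L ^ k * (L * X * M) * M ^ k := by rw [← h]
        _ = L ^ (k + 1) * X * M ^ (k + 1) := by
          rw [pow_succ L, pow_succ' M]; simp only [Matrix.mul_assoc]
  have ht : Tendsto (fun k : ℕ => L ^ k * X * M ^ k) atTop (𝓝 (0 * X * 0)) :=
    (hL.tendsto_pow.mul tendsto_const_nhds).mul hM.tendsto_pow
  simp only [← hk, mul_zero] at ht
  exact tendsto_nhds_unique tendsto_const_nhds ht

/-- The discrete Lyapunov equation of a Schur matrix is uniquely solvable. -/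
lemma IsSchur.existsUnique_lyapunov {M : Matrix (Fin n) (Fin n) ℝ} (hM : IsSchur M)
    (N : Matrix (Fin n) (Fin n) ℝ) : ∃! X, Mᵀ * X * M - X + N = 0 := by
  let f : Matrix (Fin n) (Fin n) ℝ →ₗ[ℝ] Matrix (Fin n) (Fin n) ℝ :=
    { toFun := fun X => X - Mᵀ * X * M
      map_add' := fun X Y => by simp only [mul_add, add_mul]; abel
      map_smul' := fun c X => by simp [smul_sub] }
  have hf : ∀ X, f X = X - Mᵀ * X * M := fun X => rfl
  have hinj : Function.Injective f := by
    rw [injective_iff_map_eq_zero]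
    intro X hX
    rw [hf, sub_eq_zero] at hX
    exact eq_zero_of_eq_mul_mul hM.transpose hM hX
  have heq : ∀ X, Mᵀ * X * M - X + N = 0 ↔ f X = N := fun X => by
    rw [hf, ← sub_eq_zero (b := N), ← neg_eq_zero (a := X - Mᵀ * X * M - N)]
    constructor <;> intro h <;> rw [← h] <;> abel
  -- In finite dimension the injectivity just shown yields existence.
  obtain ⟨X, hX⟩ := (LinearMap.injective_iff_surjective.1 hinj) N
  exact ⟨X, (heq X).2 hX, fun Y hY => hinj (((heq Y).1 hY).trans hX.symm)⟩

lemma lyapunov_eq_sum_add {M X N : Matrix (Fin n) (Fin n) ℝ} (h : Mᵀ * X * M - X + N = 0) (k : ℕ) :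
    X = ∑ j ∈ Finset.range k, Mᵀ ^ j * N * M ^ j + Mᵀ ^ k * X * M ^ k := by
  have h' : X = Mᵀ * X * M + N := by
    rw [← sub_eq_zero, ← neg_eq_zero, ← h]; abel
  induction k with
  | zero => simp
  | succ k ih =>
    rw [Finset.sum_range_succ]
    calc X = ∑ j ∈ Finset.range k, Mᵀ ^ j * N * M ^ j + Mᵀ ^ k * X * M ^ k := ih
      _ = ∑ j ∈ Finset.range k, Mᵀ ^ j * N * M ^ j + Mᵀ ^ k * (Mᵀ * X * M + N) * M ^ k := by
        rw [← h']
      _ = _ := by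
        rw [pow_succ Mᵀ, pow_succ' M]
        simp only [Matrix.mul_assoc, Matrix.mul_add, Matrix.add_mul]; abel

lemma IsSchur.tendsto_lyapunov_sum {M X N : Matrix (Fin n) (Fin n) ℝ} (hM : IsSchur M)
    (h : Mᵀ * X * M - X + N = 0) :
    Tendsto (fun k => ∑ j ∈ Finset.range k, Mᵀ ^ j * N * M ^ j) atTop (𝓝 X) := by
  have h1 : Tendsto (fun k : ℕ => X - Mᵀ ^ k * X * M ^ k) atTop (𝓝 (X - 0 * X * 0)) :=
    tendsto_const_nhds.sub ((hM.transpose.tendsto_pow.mul tendsto_const_nhds).mul hM.tendsto_pow)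
  simp only [mul_zero, sub_zero] at h1
  refine h1.congr fun k => ?_
  rw [sub_eq_iff_eq_add]
  exact lyapunov_eq_sum_add h k

lemma PosSemidef.transpose_mul_mul_same {m : ℕ} {P : Matrix (Fin n) (Fin n) ℝ} (hP : P.PosSemidef)
    (B : Matrix (Fin n) (Fin m) ℝ) : (Bᵀ * P * B).PosSemidef := by
  simpa [Matrix.conjTranspose_eq_transpose_of_trivial] using hP.conjTranspose_mul_mul_same B

lemma PosSemidef.transpose_eq {P : Matrix (Fin n) (Fin n) ℝ} (hP : P.PosSemidef) : Pᵀ = P := by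
  simpa [Matrix.conjTranspose_eq_transpose_of_trivial] using hP.isHermitian.eq

lemma PosSemidef.dotProduct_nonneg {P : Matrix (Fin n) (Fin n) ℝ} (hP : P.PosSemidef)
    (x : Fin n → ℝ) : 0 ≤ x ⬝ᵥ (P *ᵥ x) := by
  simpa using hP.dotProduct_mulVec_nonneg x

lemma posSemidef_of_transpose_eq {P : Matrix (Fin n) (Fin n) ℝ} (hP : Pᵀ = P)
    (h : ∀ x : Fin n → ℝ, 0 ≤ x ⬝ᵥ (P *ᵥ x)) : P.PosSemidef := by
  refine Matrix.PosSemidef.of_dotProduct_mulVec_nonneg ?_ (by simpa using h)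
  rw [Matrix.IsHermitian, Matrix.conjTranspose_eq_transpose_of_trivial, hP]

lemma posSemidef_of_tendsto {P : Matrix (Fin n) (Fin n) ℝ} {p : ℕ → Matrix (Fin n) (Fin n) ℝ}
    (h : Tendsto p atTop (𝓝 P)) (hp : ∀ k, (p k).PosSemidef) : P.PosSemidef := by
  refine posSemidef_of_transpose_eq ?_ fun x => ?_
  · have h1 : Tendsto (fun k => (p k)ᵀ) atTop (𝓝 Pᵀ) :=
      ((by fun_prop : Continuous fun N : Matrix (Fin n) (Fin n) ℝ => Nᵀ).tendsto P).comp h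
    simp only [fun k => PosSemidef.transpose_eq (hp k)] at h1
    exact tendsto_nhds_unique h1 h
  · have h1 : Tendsto (fun k => x ⬝ᵥ (p k *ᵥ x)) atTop (𝓝 (x ⬝ᵥ (P *ᵥ x))) :=
      ((by fun_prop : Continuous fun N : Matrix (Fin n) (Fin n) ℝ => x ⬝ᵥ (N *ᵥ x)).tendsto P).comp h
    exact ge_of_tendsto' h1 fun k => PosSemidef.dotProduct_nonneg (hp k) x

lemma IsSchur.lyapunov_posSemidef {M X N : Matrix (Fin n) (Fin n) ℝ} (hM : IsSchur M)
    (h : Mᵀ * X * M - X + N = 0) (hN : N.PosSemidef) : X.PosSemidef := by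
  refine posSemidef_of_tendsto (hM.tendsto_lyapunov_sum h) fun k => ?_
  refine Matrix.posSemidef_sum _ fun j _ => ?_
  rw [← Matrix.transpose_pow]
  exact PosSemidef.transpose_mul_mul_same hN _

/-- A bounded increasing sequence of symmetric matrices converges. -/
lemma exists_tendsto_of_posSemidef_sub {p : ℕ → Matrix (Fin n) (Fin n) ℝ}
    {U : Matrix (Fin n) (Fin n) ℝ} (hsymm : ∀ k, (p k)ᵀ = p k)
    (hmono : ∀ k, (p (k + 1) - p k).PosSemidef) (hbdd : ∀ k, (U - p k).PosSemidef) :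
    ∃ P, Tendsto p atTop (𝓝 P) := by
  have hq : ∀ x : Fin n → ℝ, ∃ l, Tendsto (fun k => x ⬝ᵥ (p k *ᵥ x)) atTop (𝓝 l) := by
    intro x
    refine ⟨_, tendsto_atTop_ciSup (monotone_nat_of_le_succ fun k => ?_) ⟨x ⬝ᵥ (U *ᵥ x), ?_⟩⟩
    · have := PosSemidef.dotProduct_nonneg (hmono k) x
      rw [Matrix.sub_mulVec, dotProduct_sub] at this
      linarith
    · rintro _ ⟨k, rfl⟩
      have := PosSemidef.dotProduct_nonneg (hbdd k) x
      rw [Matrix.sub_mulVec, dotProduct_sub] at this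
      simp only; linarith
  choose l hl using hq
  -- Polarization: by symmetry the entries are determined by the quadratic form, which converges
  -- monotonically at each vector.
  refine ⟨fun i j => (l (Pi.single i 1 + Pi.single j 1) - l (Pi.single i 1) - l (Pi.single j 1)) / 2,
    tendsto_pi_nhds.2 fun i => tendsto_pi_nhds.2 fun j => ?_⟩
  refine ((((hl _).sub (hl _)).sub (hl _)).div_const 2).congr fun k => ?_
  have hji : p k j i = p k i j := by
    conv_rhs => rw [← hsymm k]
    rfl
  simp only [Matrix.mulVec_add, dotProduct_add, add_dotProduct, single_one_dotProduct,
    Matrix.mulVec_single_one, Matrix.col_apply]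
  rw [hji]; ring

end Lyapunov

/-! ### The Riccati equation: value iteration, stability of the closed loop, uniqueness -/

namespace Plant

variable {nx nu nw : ℕ} (S : Plant nx nu nw) (P : Matrix (Fin nx) (Fin nx) ℝ)

/-- One step of the cost recursion under the state feedback `u = F x`. -/
def policyCost (F : Matrix (Fin nu) (Fin nx) ℝ) : Matrix (Fin nx) (Fin nx) ℝ :=
  S.Q + Fᵀ * S.R * F + (S.A + S.Bu * F)ᵀ * P * (S.A + S.Bu * F)

/-- The Riccati operator. -/
noncomputable def riccati : Matrix (Fin nx) (Fin nx) ℝ := S.policyCost P (-S.Kx P)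

variable {S P}

lemma H_mul_Kx (hH : IsUnit (S.H P).det) : S.H P * S.Kx P = S.Buᵀ * P * S.A := by
  rw [Kx, Matrix.mul_assoc, Matrix.mul_assoc, Matrix.mul_nonsing_inv_cancel_left _ _ hH,
    Matrix.mul_assoc]

lemma H_mul_Kv (hH : IsUnit (S.H P).det) : S.H P * S.Kv P = S.Buᵀ := by
  rw [Kv, Matrix.mul_nonsing_inv_cancel_left _ _ hH]

lemma H_transpose (hR : S.Rᵀ = S.R) (hP : Pᵀ = P) : (S.H P)ᵀ = S.H P := by
  simp only [H, Matrix.transpose_add, Matrix.transpose_mul, Matrix.transpose_transpose, hR, hP,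
    Matrix.mul_assoc]

lemma Kx_transpose_mul_H (hR : S.Rᵀ = S.R) (hP : Pᵀ = P) (hH : IsUnit (S.H P).det) :
    (S.Kx P)ᵀ * S.H P = S.Aᵀ * P * S.Bu := by
  have := congrArg Matrix.transpose (H_mul_Kx hH)
  simpa only [Matrix.transpose_mul, H_transpose hR hP, Matrix.transpose_transpose, hP,
    Matrix.mul_assoc] using this

lemma policyCost_eq_aux (hR : S.Rᵀ = S.R) (hP : Pᵀ = P) (hH : IsUnit (S.H P).det)
    (F : Matrix (Fin nu) (Fin nx) ℝ) :
    S.policyCost P F = S.Q + S.Aᵀ * P * S.A + Fᵀ * S.H P * F + Fᵀ * (S.H P * S.Kx P)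
      + (S.Kx P)ᵀ * S.H P * F := by
  rw [H_mul_Kx hH, Kx_transpose_mul_H hR hP hH]
  simp only [policyCost, H, Matrix.transpose_add, Matrix.transpose_mul, Matrix.mul_add,
    Matrix.add_mul, Matrix.mul_assoc]
  abel

/-- Completion of the square in the gain: when `H` is positive definite, `-Kx` is the best gain and
the Riccati operator is the minimum of the one-step cost over all gains. -/
lemma policyCost_eq (hR : S.Rᵀ = S.R) (hP : Pᵀ = P) (hH : IsUnit (S.H P).det)
    (F : Matrix (Fin nu) (Fin nx) ℝ) :
    S.policyCost P F = S.riccati P + (F + S.Kx P)ᵀ * S.H P * (F + S.Kx P) := by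
  rw [riccati, policyCost_eq_aux hR hP hH, policyCost_eq_aux hR hP hH]
  simp only [Matrix.transpose_add, Matrix.transpose_neg, Matrix.mul_add, Matrix.add_mul,
    Matrix.mul_neg, Matrix.neg_mul, Matrix.mul_assoc]
  abel

lemma riccati_eq (hR : S.Rᵀ = S.R) (hP : Pᵀ = P) (hH : IsUnit (S.H P).det) :
    S.riccati P = S.Q + S.Aᵀ * P * S.A - S.Aᵀ * P * S.Bu * (S.H P)⁻¹ * S.Buᵀ * P * S.A := by
  rw [riccati, policyCost_eq_aux hR hP hH, H_mul_Kx hH, Kx_transpose_mul_H hR hP hH]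
  have h1 : (S.Kx P)ᵀ * S.H P * S.Kx P = (S.Kx P)ᵀ * (S.Buᵀ * P * S.A) := by
    rw [Matrix.mul_assoc, H_mul_Kx hH]
  simp only [Matrix.transpose_neg, Matrix.mul_neg, Matrix.neg_mul, neg_neg, h1]
  rw [Kx]
  simp only [Matrix.mul_assoc]
  abel

lemma dare_iff (hR : S.Rᵀ = S.R) (hP : Pᵀ = P) (hH : IsUnit (S.H P).det) :
    0 = P - S.Aᵀ * P * S.A - S.Q + S.Aᵀ * P * S.Bu * (S.H P)⁻¹ * S.Buᵀ * P * S.A ↔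
      S.riccati P = P := by
  rw [riccati_eq hR hP hH, eq_comm, ← sub_eq_zero (b := P), ← neg_eq_zero]
  constructor <;> intro h <;> rw [← h] <;> abel

lemma H_posDef (hR : S.R.PosDef) (hP : P.PosSemidef) : (S.H P).PosDef :=
  hR.add_posSemidef (PosSemidef.transpose_mul_mul_same hP _)

lemma isUnit_det_H (hH : (S.H P).PosDef) : IsUnit (S.H P).det :=
  (Matrix.isUnit_iff_isUnit_det _).1 hH.isUnit

lemma policyCost_posSemidef (hQ : S.Q.PosSemidef) (hR : S.R.PosSemidef) (hP : P.PosSemidef)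
    (F : Matrix (Fin nu) (Fin nx) ℝ) : (S.policyCost P F).PosSemidef :=
  (hQ.add (PosSemidef.transpose_mul_mul_same hR F)).add (PosSemidef.transpose_mul_mul_same hP _)

lemma policyCost_sub_posSemidef {P' : Matrix (Fin nx) (Fin nx) ℝ} (h : (P' - P).PosSemidef)
    (F : Matrix (Fin nu) (Fin nx) ℝ) : (S.policyCost P' F - S.policyCost P F).PosSemidef := by
  have : S.policyCost P' F - S.policyCost P F =
      (S.A + S.Bu * F)ᵀ * (P' - P) * (S.A + S.Bu * F) := by
    simp only [policyCost, Matrix.mul_sub, Matrix.sub_mul]; abel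
  rw [this]
  exact PosSemidef.transpose_mul_mul_same h _

lemma policyCost_sub_riccati_posSemidef (hR : S.R.PosDef) (hP : P.PosSemidef)
    (F : Matrix (Fin nu) (Fin nx) ℝ) : (S.policyCost P F - S.riccati P).PosSemidef := by
  have hH := H_posDef hR hP
  rw [policyCost_eq (PosSemidef.transpose_eq hR.posSemidef) (PosSemidef.transpose_eq hP)
    (isUnit_det_H hH), add_sub_cancel_left]
  exact PosSemidef.transpose_mul_mul_same hH.posSemidef _

/-- A minimum over gains of operators monotone in `P` is monotone: the gain of `P'` is a suboptimal
competitor for `P`. -/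
lemma riccati_mono (hR : S.R.PosDef) (hP : P.PosSemidef) {P' : Matrix (Fin nx) (Fin nx) ℝ}
    (h : (P' - P).PosSemidef) : (S.riccati P' - S.riccati P).PosSemidef := by
  have := (policyCost_sub_posSemidef (S := S) h (-S.Kx P')).add
    (policyCost_sub_riccati_posSemidef hR hP (-S.Kx P'))
  rwa [sub_add_sub_cancel] at this

lemma tendsto_riccati {p : ℕ → Matrix (Fin nx) (Fin nx) ℝ} (hH : IsUnit (S.H P).det)
    (h : Tendsto p atTop (𝓝 P)) :
    Tendsto (fun k => S.riccati (p k)) atTop (𝓝 (S.riccati P)) := by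
  have hcH : Continuous fun p => S.H p := by unfold H; fun_prop
  have hinv : ContinuousAt (fun p => (S.H p)⁻¹) P := by
    simp only [Matrix.inv_def, Ring.inverse_eq_inv']
    exact (hcH.matrix_det.continuousAt.inv₀ hH.ne_zero).smul hcH.matrix_adjugate.continuousAt
  have hinv' : Tendsto (fun k => (S.H (p k))⁻¹) atTop (𝓝 (S.H P)⁻¹) := hinv.tendsto.comp h
  have hK : Tendsto (fun k => S.Kx (p k)) atTop (𝓝 (S.Kx P)) := by
    have h1 : ∀ q, S.Kx q = (S.H q)⁻¹ * (S.Buᵀ * q * S.A) := fun q => by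
      rw [Kx]; simp only [Matrix.mul_assoc]
    have hc1 : Continuous fun q : Matrix (Fin nx) (Fin nx) ℝ => S.Buᵀ * q * S.A := by fun_prop
    have hc2 : Continuous fun q : Matrix (Fin nu) (Fin nu) ℝ × Matrix (Fin nu) (Fin nx) ℝ =>
      q.1 * q.2 := by fun_prop
    simp only [h1]
    exact Tendsto.comp (f := fun k => ((S.H (p k))⁻¹, S.Buᵀ * p k * S.A))
      (hc2.tendsto ((S.H P)⁻¹, S.Buᵀ * P * S.A)) (hinv'.prodMk_nhds ((hc1.tendsto P).comp h))
  have h2 : Continuous fun q : Matrix (Fin nu) (Fin nx) ℝ × Matrix (Fin nx) (Fin nx) ℝ =>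
      S.policyCost q.2 (-q.1) := by unfold policyCost; fun_prop
  simp only [riccati]
  exact Tendsto.comp (f := fun k => (S.Kx (p k), p k)) (h2.tendsto (S.Kx P, P)) (hK.prodMk_nhds h)

/-- Value iteration converges to a solution of the Riccati equation. -/
lemma exists_riccati_fixedPoint (hQ : S.Q.PosSemidef) (hR : S.R.PosDef)
    (hst : IsStabilizable S.A S.Bu) :
    ∃ P : Matrix (Fin nx) (Fin nx) ℝ, P.PosSemidef ∧ S.riccati P = P := by
  obtain ⟨F, hF⟩ := hst
  -- `U` is the finite cost matrix of the stabilizing gain `F`; it bounds every value iterate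
  -- started from zero.
  obtain ⟨U, hU, -⟩ := hF.existsUnique_lyapunov (S.Q + Fᵀ * S.R * F)
  have hUpos : U.PosSemidef := hF.lyapunov_posSemidef hU
    (hQ.add (PosSemidef.transpose_mul_mul_same hR.posSemidef F))
  have hUcost : S.policyCost U F = U := by
    rw [← sub_eq_zero, ← hU, policyCost]; abel
  let p : ℕ → Matrix (Fin nx) (Fin nx) ℝ := fun k => S.riccati^[k] 0
  have hp : ∀ k, p (k + 1) = S.riccati (p k) := fun k => Function.iterate_succ_apply' _ _ _
  have hpos : ∀ k, (p k).PosSemidef := by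
    intro k
    induction k with
    | zero => exact Matrix.PosSemidef.zero
    | succ k ih => rw [hp]; exact policyCost_posSemidef hQ hR.posSemidef ih _
  have hmono : ∀ k, (p (k + 1) - p k).PosSemidef := by
    intro k
    induction k with
    | zero => simpa [p] using hpos 1
    | succ k ih => rw [hp (k + 1)]; nth_rw 2 [hp k]; exact riccati_mono hR (hpos k) ih
  have hbdd : ∀ k, (U - p k).PosSemidef := by
    intro k
    induction k with
    | zero => simpa [p] using hUpos
    | succ k ih =>
      have := (policyCost_sub_posSemidef (S := S) ih F).add
        (policyCost_sub_riccati_posSemidef hR (hpos k) F)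
      rwa [sub_add_sub_cancel, ← hp, hUcost] at this
  obtain ⟨P, hP⟩ := exists_tendsto_of_posSemidef_sub
    (fun k => PosSemidef.transpose_eq (hpos k)) hmono hbdd
  have hPpos := posSemidef_of_tendsto hP hpos
  refine ⟨P, hPpos, tendsto_nhds_unique
    (tendsto_riccati (isUnit_det_H (H_posDef hR hPpos)) hP) ?_⟩
  simpa only [← hp, Function.comp_def] using hP.comp (tendsto_add_atTop_nat 1)

end Plant

open scoped MatrixOrder in
/-- A vanishing positive semidefinite form forces the image under the matrix to vanish. -/
lemma tendsto_mulVec_of_tendsto_form {n : ℕ} {Q : Matrix (Fin n) (Fin n) ℝ} (hQ : Q.PosSemidef)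
    {x : ℕ → Fin n → ℝ} (h : Tendsto (fun t => x t ⬝ᵥ (Q *ᵥ x t)) atTop (𝓝 0)) :
    Tendsto (fun t => Q *ᵥ x t) atTop (𝓝 0) := by
  -- With `Q = Gᵀ G` the form is the squared Euclidean norm of `G x`.
  obtain ⟨G, rfl⟩ := CStarAlgebra.nonneg_iff_eq_star_mul_self.mp hQ.nonneg
  rw [Matrix.star_eq_conjTranspose, Matrix.conjTranspose_eq_transpose_of_trivial] at h ⊢
  have h1 : Tendsto (fun t => G *ᵥ x t) atTop (𝓝 0) := by
    refine tendsto_pi_nhds.2 fun i => ?_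
    have h2 : Tendsto (fun t => √(x t ⬝ᵥ ((Gᵀ * G) *ᵥ x t))) atTop (𝓝 0) := by
      simpa [Function.comp_def] using (Real.continuous_sqrt.tendsto 0).comp h
    refine squeeze_zero_norm (fun t => ?_) h2
    rw [Real.norm_eq_abs]
    refine Real.abs_le_sqrt ?_
    rw [← Matrix.mulVec_mulVec, Matrix.dotProduct_mulVec, Matrix.vecMul_transpose, sq]
    exact Finset.single_le_sum (f := fun i => (G *ᵥ x t) i * (G *ᵥ x t) i)
      (fun i _ => mul_self_nonneg _) (Finset.mem_univ i)
  have h3 : Continuous fun y : Fin n → ℝ => Gᵀ *ᵥ y := by fun_prop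
  have h4 := (h3.tendsto 0).comp h1
  simpa only [Matrix.mulVec_zero, Function.comp_def, Matrix.mulVec_mulVec] using h4

namespace Plant

variable {nx nu nw : ℕ} {S : Plant nx nu nw} {P : Matrix (Fin nx) (Fin nx) ℝ}

/-- Along the closed loop `xᵀPx` decreases by exactly the stage cost, so the stage cost tends to
zero and with it `Q x` and `R Kx x`. Writing `Â = (A + L Q) - L Q - Bu Kx` with a detectability gain
`L` exhibits the state as the response of the Schur filter `A + L Q` to a vanishing input. -/
lemma Ahat_schur_of_riccati (hQ : S.Q.PosSemidef) (hR : S.R.PosDef) (hd : IsDetectable S.A S.Q)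
    (hP : P.PosSemidef) (hric : S.riccati P = P) : IsSchur (S.Ahat P) := by
  obtain ⟨L, hL⟩ := hd
  refine isSchur_of_tendsto_pow_mulVec fun x₀ => ?_
  set x : ℕ → Fin nx → ℝ := fun k => S.Ahat P ^ k *ᵥ x₀ with hx
  have hstep : ∀ k, x (k + 1) = S.Ahat P *ᵥ x k := fun k => by
    simp only [hx, pow_succ', Matrix.mulVec_mulVec]
  have hAhat : S.A + S.Bu * -S.Kx P = S.Ahat P := by
    rw [Ahat, Matrix.mul_neg, sub_eq_add_neg]
  have hdecr : ∀ k, x k ⬝ᵥ (P *ᵥ x k) = x k ⬝ᵥ (S.Q *ᵥ x k) +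
      (S.Kx P *ᵥ x k) ⬝ᵥ (S.R *ᵥ (S.Kx P *ᵥ x k)) + x (k + 1) ⬝ᵥ (P *ᵥ x (k + 1)) := by
    intro k
    conv_lhs => rw [← hric, riccati, policyCost, hAhat]
    simp only [hstep, Matrix.transpose_neg, Matrix.mul_neg, Matrix.neg_mul, neg_neg,
      Matrix.add_mulVec, dotProduct_add, ← Matrix.mulVec_mulVec, Matrix.dotProduct_mulVec,
      Matrix.vecMul_transpose]
  have hQ0 := fun k => PosSemidef.dotProduct_nonneg hQ (x k)
  have hR0 := fun k => PosSemidef.dotProduct_nonneg hR.posSemidef (S.Kx P *ᵥ x k)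
  have hconv := tendsto_atTop_ciInf (f := fun k => x k ⬝ᵥ (P *ᵥ x k))
    (antitone_nat_of_succ_le fun k => by linarith [hdecr k, hQ0 k, hR0 k])
    ⟨0, by rintro _ ⟨k, rfl⟩; exact PosSemidef.dotProduct_nonneg hP _⟩
  have hdiff : Tendsto (fun k => x k ⬝ᵥ (P *ᵥ x k) - x (k + 1) ⬝ᵥ (P *ᵥ x (k + 1))) atTop (𝓝 0) := by
    simpa using hconv.sub (hconv.comp (tendsto_add_atTop_nat 1))
  have hQx : Tendsto (fun k => S.Q *ᵥ x k) atTop (𝓝 0) :=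
    tendsto_mulVec_of_tendsto_form hQ (squeeze_zero hQ0
      (fun k => by linarith [hdecr k, hR0 k]) hdiff)
  have hRx : Tendsto (fun k => S.R *ᵥ (S.Kx P *ᵥ x k)) atTop (𝓝 0) :=
    tendsto_mulVec_of_tendsto_form hR.posSemidef (squeeze_zero hR0
      (fun k => by linarith [hdecr k, hQ0 k]) hdiff)
  have hRdet : IsUnit S.R.det := (Matrix.isUnit_iff_isUnit_det _).1 hR.isUnit
  have hc : Continuous fun q : (Fin nx → ℝ) × (Fin nu → ℝ) =>
    -(L *ᵥ q.1 + (S.Bu * S.R⁻¹) *ᵥ q.2) := by fun_prop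
  have hν := (hc.tendsto (0, 0)).comp (hQx.prodMk_nhds hRx)
  have h1 : ∀ k, (S.Bu * S.R⁻¹) *ᵥ (S.R *ᵥ (S.Kx P *ᵥ x k)) = S.Bu *ᵥ (S.Kx P *ᵥ x k) := fun k => by
    rw [Matrix.mulVec_mulVec, Matrix.mul_assoc, Matrix.nonsing_inv_mul _ hRdet, Matrix.mul_one]
  simp only [Function.comp_def, h1, Matrix.mulVec_zero, add_zero, neg_zero] at hν
  refine hL.tendsto_zero (x := x) (fun k => ?_) hν
  simp only [hstep, Ahat, Matrix.add_mulVec, Matrix.sub_mulVec, ← Matrix.mulVec_mulVec]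
  abel

lemma IsStabilizingDARESolution.isUnit_det_H (hP : S.IsStabilizingDARESolution P) :
    IsUnit (S.H P).det := Plant.isUnit_det_H hP.posDef

lemma IsStabilizingDARESolution.transpose_eq (hP : S.IsStabilizingDARESolution P) : Pᵀ = P :=
  PosSemidef.transpose_eq hP.posSemidef

/-- `Buᵀ P Â = R Kx`. -/
lemma Bu_transpose_mul_mul_Ahat (hH : IsUnit (S.H P).det) :
    S.Buᵀ * P * S.Ahat P = S.R * S.Kx P := by
  rw [Ahat, Matrix.mul_sub, ← H_mul_Kx hH, H]
  simp only [Matrix.add_mul, Matrix.mul_assoc]; abel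

/-- The one-sided form of the Riccati equation, with a single closed-loop factor, so that the other
factor can be expanded with a different gain. -/
lemma dare_mul_Ahat (hS : S.Rᵀ = S.R) (hP : S.IsStabilizingDARESolution P) :
    P = S.Q + S.Aᵀ * P * S.Ahat P := by
  have h1 := (dare_iff hS hP.transpose_eq hP.isUnit_det_H).1 hP.dare
  rw [riccati_eq hS hP.transpose_eq hP.isUnit_det_H] at h1
  conv_lhs => rw [← h1]
  rw [Ahat, Kx]
  simp only [Matrix.mul_sub, Matrix.mul_assoc]; abel

/-- Both solutions satisfy `Z = Q + Â(P)ᵀ Z Â(P') + Kx(P)ᵀ R Kx(P')` with the same mixed data, so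
their difference is fixed by `Z ↦ Â(P)ᵀ Z Â(P')` and vanishes. -/
lemma IsStabilizingDARESolution.unique (hS : S.Rᵀ = S.R) (hQ : S.Qᵀ = S.Q)
    {P' : Matrix (Fin nx) (Fin nx) ℝ}
    (hP : S.IsStabilizingDARESolution P) (hP' : S.IsStabilizingDARESolution P') : P = P' := by
  rw [← sub_eq_zero]
  refine eq_zero_of_eq_mul_mul hP.schur.transpose hP'.schur ?_
  have h1 : P = S.Q + (S.Ahat P)ᵀ * P * S.A := by
    have := congrArg Matrix.transpose (dare_mul_Ahat hS hP)
    simpa only [Matrix.transpose_add, Matrix.transpose_mul, Matrix.transpose_transpose,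
      hP.transpose_eq, hQ, Matrix.mul_assoc] using this
  have h2 := dare_mul_Ahat hS hP'
  have hA : S.A = S.Ahat P' + S.Bu * S.Kx P' := by rw [Ahat]; abel
  have hA' : S.A = S.Ahat P + S.Bu * S.Kx P := by rw [Ahat]; abel
  have h3 := Bu_transpose_mul_mul_Ahat hP'.isUnit_det_H
  have h4 : (S.Ahat P)ᵀ * P * S.Bu = (S.Kx P)ᵀ * S.R := by
    have := congrArg Matrix.transpose (Bu_transpose_mul_mul_Ahat hP.isUnit_det_H)
    simpa only [Matrix.transpose_mul, Matrix.transpose_transpose,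
      hP.transpose_eq, hS, Matrix.mul_assoc] using this
  have h5 : P = S.Q + (S.Ahat P)ᵀ * P * S.Ahat P' + (S.Kx P)ᵀ * S.R * S.Kx P' := by
    rw [← h4]
    have h7 := congrArg (fun Z => S.Q + (S.Ahat P)ᵀ * P * Z) hA
    refine (h1.trans h7).trans ?_
    simp only [Matrix.mul_add, Matrix.mul_assoc]; abel
  have h6 : P' = S.Q + (S.Ahat P)ᵀ * P' * S.Ahat P' + (S.Kx P)ᵀ * S.R * S.Kx P' := by
    rw [Matrix.mul_assoc _ S.R, ← h3]
    have h7 := congrArg (fun Z => S.Q + Zᵀ * P' * S.Ahat P') hA'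
    refine (h2.trans h7).trans ?_
    simp only [Matrix.transpose_add, Matrix.transpose_mul, Matrix.add_mul, Matrix.mul_assoc]; abel
  refine (congrArg₂ (· - ·) h5 h6).trans ?_
  simp only [Matrix.mul_sub, Matrix.sub_mul]; abel

/-- The Riccati equation has a unique stabilizing solution. -/
theorem Standing.existsUnique_stabilizing (hS : S.Standing) :
    ∃! P : Matrix (Fin nx) (Fin nx) ℝ, S.IsStabilizingDARESolution P := by
  have hR := PosSemidef.transpose_eq hS.cost_input.posSemidef
  obtain ⟨P, hP, hric⟩ := exists_riccati_fixedPoint hS.cost_state hS.cost_input hS.stabilizable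
  have hH := H_posDef hS.cost_input hP
  refine ⟨P, ⟨hP, hH, (dare_iff hR (PosSemidef.transpose_eq hP) (Plant.isUnit_det_H hH)).2 hric,
    Ahat_schur_of_riccati hS.cost_state hS.cost_input hS.detectable hP hric⟩, fun P' hP' =>
    hP'.unique hR (PosSemidef.transpose_eq hS.cost_state) ⟨hP, hH, ?_, ?_⟩⟩
  · exact (dare_iff hR (PosSemidef.transpose_eq hP) (Plant.isUnit_det_H hH)).2 hric
  · exact Ahat_schur_of_riccati hS.cost_state hS.cost_input hS.detectable hP hric

end Plant

/-! ### Cesàro averages and bilinear forms -/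

/-- The Cesàro means of `f` tend to `l`. -/
def HasAverage (f : ℕ → ℝ) (l : ℝ) : Prop :=
  Tendsto (fun T : ℕ => (1 / (T : ℝ)) * ∑ t ∈ Finset.range T, f t) atTop (𝓝 l)

namespace HasAverage

lemma add {f g : ℕ → ℝ} {a b : ℝ} (hf : HasAverage f a) (hg : HasAverage g b) :
    HasAverage (fun t => f t + g t) (a + b) := by
  refine (Tendsto.add hf hg).congr fun T => ?_
  rw [Finset.sum_add_distrib, mul_add]

lemma const_mul {f : ℕ → ℝ} {a : ℝ} (c : ℝ) (hf : HasAverage f a) :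
    HasAverage (fun t => c * f t) (c * a) := by
  refine (Tendsto.const_mul c hf).congr fun T => ?_
  rw [← Finset.mul_sum]; ring

lemma zero : HasAverage (fun _ => 0) 0 := by simp [HasAverage]

lemma sum {ι : Type*} (s : Finset ι) {f : ι → ℕ → ℝ} {a : ι → ℝ}
    (h : ∀ i ∈ s, HasAverage (f i) (a i)) :
    HasAverage (fun t => ∑ i ∈ s, f i t) (∑ i ∈ s, a i) := by
  classical
  induction s using Finset.induction_on with
  | empty => simpa using zero
  | insert i s hi ih =>
    simp only [Finset.sum_insert hi]
    exact (h i (Finset.mem_insert_self i s)).add (ih fun j hj => h j (Finset.mem_insert_of_mem hj))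

lemma bilin {m n : ℕ} {y : ℕ → Fin m → ℝ} {z : ℕ → Fin n → ℝ} {L : Fin m → Fin n → ℝ}
    (h : ∀ a b, HasAverage (fun t => y t a * z t b) (L a b)) (M : Matrix (Fin m) (Fin n) ℝ) :
    HasAverage (fun t => y t ⬝ᵥ (M *ᵥ z t)) (∑ a, ∑ b, M a b * L a b) := by
  have h1 := HasAverage.sum Finset.univ fun a _ =>
    HasAverage.sum Finset.univ fun b _ => (h a b).const_mul (M a b)
  convert h1 using 2 with t
  simp only [dotProduct, Matrix.mulVec, Finset.mul_sum]
  exact Finset.sum_congr rfl fun a _ => Finset.sum_congr rfl fun b _ => by ring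

lemma bilin_zero {m n : ℕ} {y : ℕ → Fin m → ℝ} {z : ℕ → Fin n → ℝ}
    (h : ∀ a b, HasAverage (fun t => y t a * z t b) 0) (M : Matrix (Fin m) (Fin n) ℝ) :
    HasAverage (fun t => y t ⬝ᵥ (M *ᵥ z t)) 0 := by
  simpa using HasAverage.bilin h M

lemma quadratic {n : ℕ} {w : ℕ → Fin n → ℝ}
    (h : ∀ a b, HasAverage (fun t => w t a * w t b) (if a = b then 1 else 0))
    (M : Matrix (Fin n) (Fin n) ℝ) :
    HasAverage (fun t => w t ⬝ᵥ (M *ᵥ w t)) M.trace := by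
  have := HasAverage.bilin h M
  simpa [Matrix.trace] using this

/-- `f T / T` is the difference of two consecutive Cesàro means, the later one rescaled by `(T + 1)
/ T`. -/
lemma tendsto_div {f : ℕ → ℝ} {l : ℝ} (h : HasAverage f l) :
    Tendsto (fun t : ℕ => f t / (t : ℝ)) atTop (𝓝 0) := by
  have h1 : Tendsto (fun T : ℕ => (((T + 1 : ℕ) : ℝ) / T) *
      ((1 / ((T + 1 : ℕ) : ℝ)) * ∑ t ∈ Finset.range (T + 1), f t)) atTop (𝓝 (1 * l)) := by
    refine Tendsto.mul ?_ (Tendsto.comp h (tendsto_add_atTop_nat 1))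
    have : Tendsto (fun T : ℕ => 1 + (1 : ℝ) / T) atTop (𝓝 (1 + 0)) :=
      tendsto_const_nhds.add tendsto_one_div_atTop_nhds_zero_nat
    rw [add_zero] at this
    refine this.congr' ?_
    filter_upwards [eventually_gt_atTop 0] with T hT
    have : (T : ℝ) ≠ 0 := by exact_mod_cast hT.ne'
    push_cast; field_simp
  have h2 := h1.sub h
  rw [one_mul, sub_self] at h2
  refine h2.congr' ?_
  filter_upwards [eventually_gt_atTop 0] with T hT
  have : (T : ℝ) ≠ 0 := by exact_mod_cast hT.ne'
  rw [Finset.sum_range_succ]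
  push_cast; field_simp; ring

lemma shift {f : ℕ → ℝ} {l : ℝ} (h : HasAverage f l) (p : ℕ) :
    HasAverage (fun t => f (t + p)) l := by
  induction p with
  | zero => simpa using h
  | succ p ih =>
    have h1 := ih.tendsto_div
    have h2 : Tendsto (fun T : ℕ => (1 / (T : ℝ)) * f p) atTop (𝓝 0) := by
      simpa using tendsto_one_div_atTop_nhds_zero_nat.mul_const (f p)
    have h3 := (Tendsto.add ih h1).sub h2
    simp only [add_zero, sub_zero] at h3
    refine Tendsto.congr (fun T => ?_) h3
    have h4 := Finset.sum_range_succ (fun t => f (t + p)) T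
    rw [Finset.sum_range_succ'] at h4
    have h5 : ∑ t ∈ Finset.range T, f (t + (p + 1)) =
        ∑ t ∈ Finset.range T, f (t + p) + f (T + p) - f p := by
      rw [← h4]; simp [add_assoc, add_comm 1]
    rw [h5]; ring

end HasAverage

lemma dotProduct_mulVec_comm {n : ℕ} {M : Matrix (Fin n) (Fin n) ℝ} (hM : Mᵀ = M)
    (y z : Fin n → ℝ) : y ⬝ᵥ (M *ᵥ z) = z ⬝ᵥ (M *ᵥ y) := by
  conv_lhs => rw [← hM]
  exact Matrix.dotProduct_transpose_mulVec M y z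

lemma mulVec_dotProduct_eq {m n : ℕ} (M : Matrix (Fin m) (Fin n) ℝ) (y : Fin n → ℝ)
    (z : Fin m → ℝ) : (M *ᵥ y) ⬝ᵥ z = y ⬝ᵥ (Mᵀ *ᵥ z) := by
  rw [Matrix.dotProduct_transpose_mulVec, dotProduct_comm]

lemma form_add {n : ℕ} {M : Matrix (Fin n) (Fin n) ℝ} (hM : Mᵀ = M) (y z : Fin n → ℝ) :
    (y + z) ⬝ᵥ (M *ᵥ (y + z)) = y ⬝ᵥ (M *ᵥ y) + 2 * (y ⬝ᵥ (M *ᵥ z)) + z ⬝ᵥ (M *ᵥ z) := by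
  rw [Matrix.mulVec_add, add_dotProduct, dotProduct_add, dotProduct_add,
    dotProduct_mulVec_comm hM z y]
  ring

lemma exists_abs_bilin_le {m n : ℕ} (M : Matrix (Fin m) (Fin n) ℝ) :
    ∃ C : ℝ, 0 ≤ C ∧ ∀ y z, |y ⬝ᵥ (M *ᵥ z)| ≤ C * (‖y‖ ^ 2 + ‖z‖ ^ 2) := by
  refine ⟨∑ a, ∑ b, |M a b|, by positivity, fun y z => ?_⟩
  simp only [dotProduct, Matrix.mulVec, Finset.mul_sum, Finset.sum_mul]
  refine (Finset.abs_sum_le_sum_abs _ _).trans (Finset.sum_le_sum fun a _ => ?_)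
  refine (Finset.abs_sum_le_sum_abs _ _).trans (Finset.sum_le_sum fun b _ => ?_)
  have h1 := norm_le_pi_norm y a
  have h2 := norm_le_pi_norm z b
  rw [Real.norm_eq_abs] at h1 h2
  calc |y a * (M a b * z b)| = |M a b| * (|y a| * |z b|) := by rw [abs_mul, abs_mul]; ring
    _ ≤ |M a b| * (‖y‖ * ‖z‖) := by gcongr
    _ ≤ _ := by
      gcongr
      nlinarith [sq_nonneg (‖y‖ - ‖z‖), sq_nonneg ‖y‖, sq_nonneg ‖z‖]

/-! ### The pathwise cost identity and the trace formulas -/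

namespace Plant

variable {nx nu nw : ℕ} {S : Plant nx nu nw} {P : Matrix (Fin nx) (Fin nx) ℝ}

/-- Completion of the square in one step of the plant without noise. -/
lemma cost_complete_square (hR : S.Rᵀ = S.R) (hP : S.IsStabilizingDARESolution P)
    (x : Fin nx → ℝ) (u : Fin nu → ℝ) :
    x ⬝ᵥ (S.Q *ᵥ x) + u ⬝ᵥ (S.R *ᵥ u) +
        (S.A *ᵥ x + S.Bu *ᵥ u) ⬝ᵥ (P *ᵥ (S.A *ᵥ x + S.Bu *ᵥ u)) =
      x ⬝ᵥ (P *ᵥ x) + (u + S.Kx P *ᵥ x) ⬝ᵥ (S.H P *ᵥ (u + S.Kx P *ᵥ x)) := by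
  have hH := H_transpose hR hP.transpose_eq
  have hHK := H_mul_Kx hP.isUnit_det_H
  have hric := (dare_iff hR hP.transpose_eq hP.isUnit_det_H).1 hP.dare
  rw [riccati, policyCost_eq_aux hR hP.transpose_eq hP.isUnit_det_H] at hric
  have hric' : P + (S.Kx P)ᵀ * S.H P * S.Kx P = S.Q + S.Aᵀ * P * S.A := by
    nth_rw 1 [← hric]
    simp only [Matrix.transpose_neg, Matrix.mul_neg, Matrix.neg_mul, neg_neg, Matrix.mul_assoc]
    abel
  have h1 : x ⬝ᵥ (P *ᵥ x) + (S.Kx P *ᵥ x) ⬝ᵥ (S.H P *ᵥ (S.Kx P *ᵥ x)) =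
      x ⬝ᵥ (S.Q *ᵥ x) + (S.A *ᵥ x) ⬝ᵥ (P *ᵥ (S.A *ᵥ x)) := by
    have := congrArg (fun Z => x ⬝ᵥ (Z *ᵥ x)) hric'
    simp only [Matrix.add_mulVec, dotProduct_add, ← Matrix.mulVec_mulVec] at this
    rwa [mulVec_dotProduct_eq, mulVec_dotProduct_eq]
  have h2 : u ⬝ᵥ (S.H P *ᵥ (S.Kx P *ᵥ x)) = (S.A *ᵥ x) ⬝ᵥ (P *ᵥ (S.Bu *ᵥ u)) := by
    rw [Matrix.mulVec_mulVec, hHK, dotProduct_mulVec_comm hP.transpose_eq, mulVec_dotProduct_eq]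
    simp only [← Matrix.mulVec_mulVec]
  have h3 : u ⬝ᵥ (S.H P *ᵥ u) = u ⬝ᵥ (S.R *ᵥ u) + (S.Bu *ᵥ u) ⬝ᵥ (P *ᵥ (S.Bu *ᵥ u)) := by
    rw [H, Matrix.add_mulVec, dotProduct_add, mulVec_dotProduct_eq]
    simp only [← Matrix.mulVec_mulVec]
  rw [form_add hH, form_add hP.transpose_eq, h2]
  linarith

variable (S P) in
/-- The anticipated costate `P Bw w + v`. -/
def costate (w : Fin nw → ℝ) (v : Fin nx → ℝ) : Fin nx → ℝ := (P * S.Bw) *ᵥ w + v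

variable (S P) in
/-- The deviation of the input from the feedback law driven by the preview signal `v`. -/
noncomputable def deviation (x : Fin nx → ℝ) (u : Fin nu → ℝ) (w : Fin nw → ℝ) (v : Fin nx → ℝ) :
    Fin nu → ℝ := u + S.Kx P *ᵥ x + S.Kv P *ᵥ S.costate P w v

/-- The storage function. -/
def storage (P Y : Matrix (Fin nx) (Fin nx) ℝ) (x v : Fin nx → ℝ) : ℝ :=
  x ⬝ᵥ (P *ᵥ x) + 2 * (x ⬝ᵥ v) + v ⬝ᵥ (Y *ᵥ v)

/-- The central identity. The Riccati equation handles the part quadratic in the state and the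
input, and the backward recursion of `v` absorbs the terms linear in the state. The equation of `Y`
converts the remaining form in `Kv g`, where `g = P Bw w + v'`, into a decrement of `vᵀYv`. The
defect `e` measures how far `v` is from an exact solution of the recursion; it is zero for the
noncausal signal. -/
lemma cost_step (hR : S.Rᵀ = S.R) (hP : S.IsStabilizingDARESolution P)
    {Y : Matrix (Fin nx) (Fin nx) ℝ} (hYt : Yᵀ = Y)
    (hY : S.Ahat P * Y * (S.Ahat P)ᵀ - Y + (S.Kv P)ᵀ * S.H P * S.Kv P = 0)
    {x x' v v' e : Fin nx → ℝ} {u : Fin nu → ℝ} {w : Fin nw → ℝ}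
    (hx : x' = S.A *ᵥ x + S.Bu *ᵥ u + S.Bw *ᵥ w)
    (hv : v + e = (S.Ahat P)ᵀ *ᵥ S.costate P w v') :
    x ⬝ᵥ (S.Q *ᵥ x) + u ⬝ᵥ (S.R *ᵥ u) = storage P Y x v - storage P Y x' v' +
      S.deviation P x u w v' ⬝ᵥ (S.H P *ᵥ S.deviation P x u w v') +
      w ⬝ᵥ ((S.Bwᵀ * P * S.Bw - S.Bwᵀ * P * Y * P * S.Bw) *ᵥ w) +
      2 * (w ⬝ᵥ ((S.Bwᵀ - S.Bwᵀ * P * Y) *ᵥ v')) + 2 * (x ⬝ᵥ e) + 2 * (v ⬝ᵥ (Y *ᵥ e)) +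
      e ⬝ᵥ (Y *ᵥ e) := by
  have hPt := hP.transpose_eq
  have hH := H_transpose hR hPt
  set g := S.costate P w v' with hg
  set a₀ := u + S.Kx P *ᵥ x with ha₀
  set z := S.A *ᵥ x + S.Bu *ᵥ u with hz
  set b := S.Bw *ᵥ w with hb
  have hg' : g = P *ᵥ b + v' := by rw [hg, costate, hb, Matrix.mulVec_mulVec]
  have h1 := cost_complete_square hR hP x u
  rw [← hz, ← ha₀] at h1
  have h2 : S.deviation P x u w v' ⬝ᵥ (S.H P *ᵥ S.deviation P x u w v') =
      a₀ ⬝ᵥ (S.H P *ᵥ a₀) + 2 * ((S.Bu *ᵥ a₀) ⬝ᵥ g) +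
        (S.Kv P *ᵥ g) ⬝ᵥ (S.H P *ᵥ (S.Kv P *ᵥ g)) := by
    rw [deviation, form_add hH, Matrix.mulVec_mulVec, H_mul_Kv hP.isUnit_det_H,
      ← mulVec_dotProduct_eq]
  have h3 : x' ⬝ᵥ (P *ᵥ x') = z ⬝ᵥ (P *ᵥ z) + 2 * (z ⬝ᵥ (P *ᵥ b)) + b ⬝ᵥ (P *ᵥ b) := by
    rw [hx, form_add hPt]
  have h4 : x' ⬝ᵥ v' = z ⬝ᵥ v' + b ⬝ᵥ v' := by rw [hx, add_dotProduct]
  have h5 : z ⬝ᵥ g = z ⬝ᵥ (P *ᵥ b) + z ⬝ᵥ v' := by rw [hg', dotProduct_add]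
  have h6 : x ⬝ᵥ v + x ⬝ᵥ e = (S.Ahat P *ᵥ x) ⬝ᵥ g := by
    rw [← dotProduct_add, hv, mulVec_dotProduct_eq]
  -- The noise-free successor state splits into the closed-loop motion and the effect of the input
  -- deviation `a₀`; the first part pairs with `g` into the previous costate by `h6`.
  have h7 : z ⬝ᵥ g = (S.Ahat P *ᵥ x) ⬝ᵥ g + (S.Bu *ᵥ a₀) ⬝ᵥ g := by
    rw [← add_dotProduct]
    congr 1
    rw [hz, ha₀, Ahat, Matrix.sub_mulVec, Matrix.mulVec_add, Matrix.mulVec_mulVec]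
    abel
  have h8 : (S.Kv P *ᵥ g) ⬝ᵥ (S.H P *ᵥ (S.Kv P *ᵥ g)) =
      g ⬝ᵥ (Y *ᵥ g) - (v + e) ⬝ᵥ (Y *ᵥ (v + e)) := by
    have := congrArg (fun Z => g ⬝ᵥ (Z *ᵥ g)) hY
    simp only [Matrix.add_mulVec, Matrix.sub_mulVec, dotProduct_add, dotProduct_sub,
      ← Matrix.mulVec_mulVec, Matrix.zero_mulVec, dotProduct_zero] at this
    rw [hv, mulVec_dotProduct_eq, mulVec_dotProduct_eq, Matrix.transpose_transpose]
    linarith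
  have h9 : g ⬝ᵥ (Y *ᵥ g) = (P *ᵥ b) ⬝ᵥ (Y *ᵥ (P *ᵥ b)) + 2 * ((P *ᵥ b) ⬝ᵥ (Y *ᵥ v')) +
      v' ⬝ᵥ (Y *ᵥ v') := by rw [hg', form_add hYt]
  have h10 := form_add hYt v e
  have h11 : w ⬝ᵥ ((S.Bwᵀ * P * S.Bw - S.Bwᵀ * P * Y * P * S.Bw) *ᵥ w) =
      b ⬝ᵥ (P *ᵥ b) - (P *ᵥ b) ⬝ᵥ (Y *ᵥ (P *ᵥ b)) := by
    simp only [hb, Matrix.sub_mulVec, dotProduct_sub, mulVec_dotProduct_eq, hPt,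
      ← Matrix.mulVec_mulVec]
  have h12 : w ⬝ᵥ ((S.Bwᵀ - S.Bwᵀ * P * Y) *ᵥ v') = b ⬝ᵥ v' - (P *ᵥ b) ⬝ᵥ (Y *ᵥ v') := by
    simp only [hb, Matrix.sub_mulVec, dotProduct_sub, mulVec_dotProduct_eq, hPt,
      ← Matrix.mulVec_mulVec]
  simp only [storage]
  linarith

lemma exists_abs_storage_le (P Y : Matrix (Fin nx) (Fin nx) ℝ) :
    ∃ C : ℝ, 0 ≤ C ∧ ∀ x v, |storage P Y x v| ≤ C * (‖x‖ ^ 2 + ‖v‖ ^ 2) := by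
  obtain ⟨C₁, hC₁, h₁⟩ := exists_abs_bilin_le P
  obtain ⟨C₂, hC₂, h₂⟩ := exists_abs_bilin_le (1 : Matrix (Fin nx) (Fin nx) ℝ)
  obtain ⟨C₃, hC₃, h₃⟩ := exists_abs_bilin_le Y
  refine ⟨2 * C₁ + 2 * C₂ + 2 * C₃, by positivity, fun x v => ?_⟩
  have k1 := abs_le.1 (h₁ x x)
  have k2 := abs_le.1 (h₂ x v)
  have k3 := abs_le.1 (h₃ v v)
  rw [Matrix.one_mulVec] at k2
  have hx : 0 ≤ C₁ * ‖v‖ ^ 2 := by positivity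
  have hv : 0 ≤ C₃ * ‖x‖ ^ 2 := by positivity
  rw [storage, abs_le]
  constructor <;> nlinarith

lemma tendsto_storage_div {P Y : Matrix (Fin nx) (Fin nx) ℝ} {x v : ℕ → Fin nx → ℝ} {l : Filter ℕ}
    (hx : Tendsto (fun t : ℕ => ‖x t‖ ^ 2 / (t : ℝ)) l (𝓝 0))
    (hv : Tendsto (fun t : ℕ => ‖v t‖ ^ 2 / (t : ℝ)) l (𝓝 0)) :
    Tendsto (fun t : ℕ => storage P Y (x t) (v t) / (t : ℝ)) l (𝓝 0) := by
  obtain ⟨C, -, h⟩ := exists_abs_storage_le P Y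
  have h1 := (hx.add hv).const_mul C
  rw [add_zero, mul_zero] at h1
  refine squeeze_zero_norm (fun t => ?_) h1
  rw [norm_div, Real.norm_eq_abs, Real.norm_eq_abs, Nat.abs_cast, ← add_div, ← mul_div_assoc]
  gcongr
  exact h _ _

/-- Asymptotics of the average cost along a trajectory, up to the deviation from the feedback law
and the storage function. -/
lemma tendsto_average_cost (hR : S.Rᵀ = S.R) (hP : S.IsStabilizingDARESolution P)
    {Y : Matrix (Fin nx) (Fin nx) ℝ} (hYt : Yᵀ = Y)
    (hY : S.Ahat P * Y * (S.Ahat P)ᵀ - Y + (S.Kv P)ᵀ * S.H P * S.Kv P = 0)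
    {x v : ℕ → Fin nx → ℝ} {u : ℕ → Fin nu → ℝ} {w : ℕ → Fin nw → ℝ}
    (E : Matrix (Fin nx) (Fin nw) ℝ) (p : ℕ)
    (hx : ∀ t, x (t + 1) = S.A *ᵥ x t + S.Bu *ᵥ u t + S.Bw *ᵥ w t)
    (hv : ∀ t, v t + E *ᵥ w (t + p) = (S.Ahat P)ᵀ *ᵥ S.costate P (w t) (v (t + 1)))
    (hww : ∀ a b, HasAverage (fun t => w t a * w t b) (if a = b then 1 else 0))
    (hwv : ∀ a b, HasAverage (fun t => w t a * v (t + 1) b) 0)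
    (hxe : HasAverage (fun t => x t ⬝ᵥ (E *ᵥ w (t + p))) 0)
    (hve : HasAverage (fun t => v t ⬝ᵥ ((Y * E) *ᵥ w (t + p))) 0) :
    Tendsto (fun T : ℕ =>
      (1 / (T : ℝ)) * ∑ t ∈ Finset.range T, (x t ⬝ᵥ (S.Q *ᵥ x t) + u t ⬝ᵥ (S.R *ᵥ u t)) -
      (1 / (T : ℝ)) * ∑ t ∈ Finset.range T, S.deviation P (x t) (u t) (w t) (v (t + 1)) ⬝ᵥ
        (S.H P *ᵥ S.deviation P (x t) (u t) (w t) (v (t + 1))) +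
      storage P Y (x T) (v T) / (T : ℝ)) atTop
      (𝓝 ((S.Bwᵀ * P * S.Bw - S.Bwᵀ * P * Y * P * S.Bw).trace + (Eᵀ * Y * E).trace)) := by
  have h1 := HasAverage.quadratic hww (S.Bwᵀ * P * S.Bw - S.Bwᵀ * P * Y * P * S.Bw)
  have h2 := (HasAverage.bilin_zero hwv (S.Bwᵀ - S.Bwᵀ * P * Y)).const_mul 2
  have h3 := HasAverage.quadratic (fun a b => (hww a b).shift p) (Eᵀ * Y * E)
  have h4 := ((((h1.add h2).add (hxe.const_mul 2)).add (hve.const_mul 2)).add h3)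
  -- Only the forms in `w t` and in `w (t + p)` survive the averaging; all cross terms drop out.
  simp only [mul_zero, add_zero] at h4
  have h5 : Tendsto (fun T : ℕ => (1 / (T : ℝ)) * storage P Y (x 0) (v 0)) atTop (𝓝 0) := by
    simpa using tendsto_one_div_atTop_nhds_zero_nat.mul_const (storage P Y (x 0) (v 0))
  have h6 := h5.add h4
  rw [zero_add] at h6
  refine h6.congr fun T => ?_
  have h7 : ∑ t ∈ Finset.range T, (storage P Y (x t) (v t) - storage P Y (x (t + 1)) (v (t + 1))) =
      storage P Y (x 0) (v 0) - storage P Y (x T) (v T) := Finset.sum_range_sub' _ _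
  rw [Finset.sum_congr rfl fun t _ => cost_step hR hP hYt hY (hx t) (hv t)]
  simp only [Finset.sum_add_distrib, h7]
  have h8 : ∀ t, (E *ᵥ w (t + p)) ⬝ᵥ (Y *ᵥ (E *ᵥ w (t + p))) =
      w (t + p) ⬝ᵥ ((Eᵀ * Y * E) *ᵥ w (t + p)) := fun t => by
    rw [mulVec_dotProduct_eq]; simp only [← Matrix.mulVec_mulVec]
  simp only [h8, ← Matrix.mulVec_mulVec]
  ring

lemma trace_Bw_eq (P Y : Matrix (Fin nx) (Fin nx) ℝ) :
    (S.Bwᵀ * P * S.Bw - S.Bwᵀ * P * Y * P * S.Bw).trace =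
      (P * S.Bw * S.Bwᵀ).trace - (Y * (P * S.Bw * S.Bwᵀ * P)).trace := by
  rw [Matrix.trace_sub]
  congr 1
  · rw [Matrix.mul_assoc, Matrix.trace_mul_comm]
  · rw [show S.Bwᵀ * P * Y * P * S.Bw = (S.Bwᵀ * P) * (Y * (P * S.Bw)) by
      simp only [Matrix.mul_assoc], Matrix.trace_mul_comm]
    simp only [Matrix.mul_assoc]

/-- The dual Lyapunov equation tested against `Z`. The right-hand side is a difference of one
functional at `Z` and at `Âᵀ Z Â`, so it telescopes along the orbit of `Z`. -/
lemma trace_Kv_eq {Y : Matrix (Fin nx) (Fin nx) ℝ}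
    (hY : S.Ahat P * Y * (S.Ahat P)ᵀ - Y + (S.Kv P)ᵀ * S.H P * S.Kv P = 0)
    (Z : Matrix (Fin nx) (Fin nx) ℝ) :
    (S.H P * S.Kv P * Z * (S.Kv P)ᵀ).trace =
      (Y * Z).trace - (Y * ((S.Ahat P)ᵀ * Z * S.Ahat P)).trace := by
  have hY' : (S.Kv P)ᵀ * S.H P * S.Kv P = Y - S.Ahat P * Y * (S.Ahat P)ᵀ := by
    rw [← sub_eq_zero, ← hY]; abel
  rw [Matrix.trace_mul_comm, show (S.Kv P)ᵀ * (S.H P * S.Kv P * Z) =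
    ((S.Kv P)ᵀ * S.H P * S.Kv P) * Z by simp only [Matrix.mul_assoc], hY', Matrix.sub_mul,
    Matrix.trace_sub]
  congr 1
  rw [show S.Ahat P * Y * (S.Ahat P)ᵀ * Z = S.Ahat P * (Y * (S.Ahat P)ᵀ * Z) by
    simp only [Matrix.mul_assoc], Matrix.trace_mul_comm]
  simp only [Matrix.mul_assoc]

/-- The sum over `j ≤ p` telescopes; its end term at `p + 1` is the contribution of the newest noise
sample, which the truncated signal misses. -/
lemma previewCost_eq {Y : Matrix (Fin nx) (Fin nx) ℝ} (hPt : Pᵀ = P)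
    (hY : S.Ahat P * Y * (S.Ahat P)ᵀ - Y + (S.Kv P)ᵀ * S.H P * S.Kv P = 0) (p : ℕ) :
    (S.Bwᵀ * P * S.Bw - S.Bwᵀ * P * Y * P * S.Bw).trace +
      (((S.Ahat P)ᵀ ^ (p + 1) * P * S.Bw)ᵀ * Y * ((S.Ahat P)ᵀ ^ (p + 1) * P * S.Bw)).trace =
      S.previewCostFormula P p := by
  have h1 : ∀ j, (S.H P * S.Kv P * (S.Ahat P)ᵀ ^ j * P * S.Bw * S.Bwᵀ * P * S.Ahat P ^ j *
      (S.Kv P)ᵀ).trace = (Y * ((S.Ahat P)ᵀ ^ j * (P * S.Bw * S.Bwᵀ * P) * S.Ahat P ^ j)).trace -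
      (Y * ((S.Ahat P)ᵀ ^ (j + 1) * (P * S.Bw * S.Bwᵀ * P) * S.Ahat P ^ (j + 1))).trace := by
    intro j
    have := trace_Kv_eq hY ((S.Ahat P)ᵀ ^ j * (P * S.Bw * S.Bwᵀ * P) * S.Ahat P ^ j)
    rw [pow_succ' (S.Ahat P)ᵀ, pow_succ (S.Ahat P)]
    simpa only [Matrix.mul_assoc] using this
  rw [previewCostFormula, Matrix.trace_sum, Finset.sum_congr rfl fun j _ => h1 j,
    Finset.sum_range_sub', trace_Bw_eq]
  have h2 : (((S.Ahat P)ᵀ ^ (p + 1) * P * S.Bw)ᵀ * Y * ((S.Ahat P)ᵀ ^ (p + 1) * P * S.Bw)).trace =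
      (Y * ((S.Ahat P)ᵀ ^ (p + 1) * (P * S.Bw * S.Bwᵀ * P) * S.Ahat P ^ (p + 1))).trace := by
    rw [Matrix.mul_assoc, Matrix.trace_mul_comm]
    simp only [Matrix.transpose_mul, Matrix.transpose_pow, Matrix.transpose_transpose, hPt,
      Matrix.mul_assoc]
  rw [h2]
  simp only [pow_zero, Matrix.one_mul, Matrix.mul_one]
  ring

/-- Duality of the two Lyapunov equations: pairing the source of one with the solution of the other
gives the same trace either way. -/
lemma noncausalCost_eq {X Y : Matrix (Fin nx) (Fin nx) ℝ}
    (hY : S.Ahat P * Y * (S.Ahat P)ᵀ - Y + (S.Kv P)ᵀ * S.H P * S.Kv P = 0)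
    (hX : S.IsLyapunovSolution P X) :
    (S.Bwᵀ * P * S.Bw - S.Bwᵀ * P * Y * P * S.Bw).trace =
      (P * S.Bw * S.Bwᵀ).trace - (S.H P * S.Kv P * X * (S.Kv P)ᵀ).trace := by
  have h1 : P * S.Bw * S.Bwᵀ * P = X - (S.Ahat P)ᵀ * X * S.Ahat P := by
    unfold IsLyapunovSolution at hX
    rw [← sub_eq_zero, ← hX]; abel
  rw [trace_Bw_eq, trace_Kv_eq hY, h1, Matrix.mul_sub, Matrix.trace_sub]

lemma tendsto_previewCostFormula {X : Matrix (Fin nx) (Fin nx) ℝ}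
    (hP : IsSchur (S.Ahat P)) (hX : S.IsLyapunovSolution P X) :
    Tendsto (fun p => S.previewCostFormula P p) atTop
      (𝓝 ((P * S.Bw * S.Bwᵀ).trace - (S.H P * S.Kv P * X * (S.Kv P)ᵀ).trace)) := by
  have h1 := (hP.tendsto_lyapunov_sum hX).comp (tendsto_add_atTop_nat 1)
  have hc : Continuous fun Z : Matrix (Fin nx) (Fin nx) ℝ =>
    (P * S.Bw * S.Bwᵀ).trace - (S.H P * S.Kv P * Z * (S.Kv P)ᵀ).trace := by
    refine continuous_const.sub (Continuous.matrix_trace ?_)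
    fun_prop
  refine ((hc.tendsto X).comp h1).congr fun p => ?_
  simp only [Function.comp_apply, previewCostFormula, Matrix.mul_sum, Matrix.sum_mul,
    Matrix.mul_assoc]

end Plant

/-! ### Almost sure convergence, a law of large numbers, independence of generated σ-algebras -/

section Probability

variable {Ω : Type*} {m0 : MeasurableSpace Ω} {μ : Measure Ω}

/-- By Tonelli the sum of all `f n` is almost surely finite, so its terms tend to zero. -/
lemma ae_tendsto_zero_of_integral_le_summable {f : ℕ → Ω → ℝ} {b : ℕ → ℝ}
    (hf : ∀ n, Integrable (f n) μ) (hf0 : ∀ n ω, 0 ≤ f n ω) (hb : ∀ n, ∫ ω, f n ω ∂μ ≤ b n)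
    (hs : Summable b) : ∀ᵐ ω ∂μ, Tendsto (fun n => f n ω) atTop (𝓝 0) := by
  have hlint : ∫⁻ ω, ∑' n, ENNReal.ofReal (f n ω) ∂μ ≠ ∞ := by
    rw [lintegral_tsum fun n => (hf n).aestronglyMeasurable.aemeasurable.ennreal_ofReal]
    have h1 : ∀ n, ∫⁻ ω, ENNReal.ofReal (f n ω) ∂μ ≤ ENNReal.ofReal (b n) := fun n => by
      rw [← ofReal_integral_eq_lintegral_ofReal (hf n) (Eventually.of_forall (hf0 n))]
      exact ENNReal.ofReal_le_ofReal (hb n)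
    exact ((ENNReal.tsum_le_tsum h1).trans_lt hs.tsum_ofReal_lt_top).ne
  have hae := ae_lt_top' (AEMeasurable.tsum fun n =>
    (hf n).aestronglyMeasurable.aemeasurable.ennreal_ofReal) hlint
  filter_upwards [hae] with ω hω
  have h1 := ENNReal.tendsto_atTop_zero_of_tsum_ne_top hω.ne
  have h2 := (ENNReal.tendsto_toReal ENNReal.zero_ne_top).comp h1
  refine h2.congr fun n => ?_
  simp [ENNReal.toReal_ofReal (hf0 n ω)]

lemma integral_sum_sq_eq {d : ℕ → Ω → ℝ} (hd : ∀ t, MemLp (d t) 2 μ)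
    (horth : ∀ s t, s < t → ∫ ω, d s ω * d t ω ∂μ = 0) (n : ℕ) :
    ∫ ω, (∑ t ∈ Finset.range n, d t ω) ^ 2 ∂μ = ∑ t ∈ Finset.range n, ∫ ω, d t ω ^ 2 ∂μ := by
  induction n with
  | zero => simp
  | succ n ih =>
    have hS : MemLp (fun ω => ∑ t ∈ Finset.range n, d t ω) 2 μ :=
      memLp_finsetSum _ fun t _ => hd t
    have h1 : ∀ ω, (∑ t ∈ Finset.range (n + 1), d t ω) ^ 2 =
        (∑ t ∈ Finset.range n, d t ω) ^ 2 + 2 * (∑ t ∈ Finset.range n, d t ω * d n ω) +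
          d n ω ^ 2 := fun ω => by
      rw [Finset.sum_range_succ, ← Finset.sum_mul]; ring
    have hint : ∀ t ∈ Finset.range n, Integrable (fun ω => d t ω * d n ω) μ := fun t _ =>
      (hd t).integrable_mul (hd n)
    have h2 : Integrable (fun ω => 2 * ∑ t ∈ Finset.range n, d t ω * d n ω) μ :=
      (integrable_finsetSum _ hint).const_mul 2
    simp only [h1]
    have h3 : Integrable (fun ω => (∑ t ∈ Finset.range n, d t ω) ^ 2 +
        2 * ∑ t ∈ Finset.range n, d t ω * d n ω) μ := hS.integrable_sq.add h2
    rw [integral_add h3 (hd n).integrable_sq, integral_add hS.integrable_sq h2, ih, Finset.sum_range_succ, integral_const_mul,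
      integral_finsetSum _ hint, Finset.sum_eq_zero fun t ht => horth t n (Finset.mem_range.1 ht)]
    ring

/-- The deterministic half of the law of large numbers: the mean up to `T` is compared with the mean
up to the last square `n² ≤ T`, and Cauchy–Schwarz bounds the at most `2n + 1` remaining terms. For
orthogonal terms with bounded second moments, both radicands have summable expectations in `n`. -/
lemma abs_sum_range_div_le {d : ℕ → ℝ} {T : ℕ} (hT : 0 < T) :
    |(1 / (T : ℝ)) * ∑ t ∈ Finset.range T, d t| ≤
      √((1 / ((T.sqrt ^ 2 : ℕ) : ℝ) * ∑ t ∈ Finset.range (T.sqrt ^ 2), d t) ^ 2) +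
      √((2 * (T.sqrt : ℝ) + 1) / (T.sqrt : ℝ) ^ 4 *
        ∑ t ∈ Finset.Ico (T.sqrt ^ 2) ((T.sqrt + 1) ^ 2), d t ^ 2) := by
  set n := T.sqrt with hn
  have hn1 : n ^ 2 ≤ T := Nat.sqrt_le' T
  have hn2 : T < (n + 1) ^ 2 := Nat.lt_succ_sqrt' T
  have hn0 : 0 < n := Nat.sqrt_pos.2 hT
  have hsplit : ∑ t ∈ Finset.range T, d t =
      ∑ t ∈ Finset.range (n ^ 2), d t + ∑ t ∈ Finset.Ico (n ^ 2) T, d t :=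
    (Finset.sum_range_add_sum_Ico _ hn1).symm
  have hblock : |∑ t ∈ Finset.Ico (n ^ 2) T, d t| ≤
      √((2 * n + 1) * ∑ t ∈ Finset.Ico (n ^ 2) ((n + 1) ^ 2), d t ^ 2) := by
    refine Real.abs_le_sqrt ?_
    have h1 := sq_sum_le_card_mul_sum_sq (s := Finset.Ico (n ^ 2) T) (f := d)
    refine h1.trans ?_
    gcongr
    · rw [Nat.card_Ico]
      have : T - n ^ 2 ≤ 2 * n + 1 := by
        have : (n + 1) ^ 2 = n ^ 2 + 2 * n + 1 := by ring
        omega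
      exact_mod_cast this
  have hnr : (0 : ℝ) < (n : ℝ) ^ 2 := by positivity
  have hTn : (1 : ℝ) / T ≤ 1 / (n : ℝ) ^ 2 := by
    gcongr; exact_mod_cast hn1
  have h4 : √((2 * (n : ℝ) + 1) / (n : ℝ) ^ 4 *
        ∑ t ∈ Finset.Ico (n ^ 2) ((n + 1) ^ 2), d t ^ 2) =
      1 / (n : ℝ) ^ 2 * √((2 * n + 1) * ∑ t ∈ Finset.Ico (n ^ 2) ((n + 1) ^ 2), d t ^ 2) := by
    rw [show (2 * (n : ℝ) + 1) / (n : ℝ) ^ 4 * ∑ t ∈ Finset.Ico (n ^ 2) ((n + 1) ^ 2), d t ^ 2 =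
      (1 / (n : ℝ) ^ 2) ^ 2 * ((2 * n + 1) * ∑ t ∈ Finset.Ico (n ^ 2) ((n + 1) ^ 2), d t ^ 2) by
        field_simp, Real.sqrt_mul (sq_nonneg _), Real.sqrt_sq (by positivity)]
  rw [Real.sqrt_sq_eq_abs, h4, hsplit, mul_add]
  refine (abs_add_le _ _).trans (add_le_add ?_ ?_)
  · rw [abs_mul, abs_mul, abs_of_nonneg (show (0 : ℝ) ≤ 1 / (T : ℝ) by positivity),
      abs_of_nonneg (show (0 : ℝ) ≤ 1 / ((n ^ 2 : ℕ) : ℝ) by positivity)]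
    push_cast
    gcongr
  · rw [abs_mul, abs_of_nonneg (show (0 : ℝ) ≤ 1 / (T : ℝ) by positivity)]
    exact mul_le_mul hTn hblock (abs_nonneg _) (by positivity)

lemma summable_const_div_sq (C : ℝ) : Summable fun n : ℕ => C / (n : ℝ) ^ 2 := by
  simpa [div_eq_mul_inv] using (Real.summable_nat_pow_inv.2 one_lt_two).mul_left C

/-- Law of large numbers for uncorrelated random variables with bounded second moments. -/
lemma ae_hasAverage_zero_of_orthogonal {d : ℕ → Ω → ℝ} {C : ℝ} (hd : ∀ t, MemLp (d t) 2 μ)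
    (hC : ∀ t, ∫ ω, d t ω ^ 2 ∂μ ≤ C) (horth : ∀ s t, s < t → ∫ ω, d s ω * d t ω ∂μ = 0) :
    ∀ᵐ ω ∂μ, HasAverage (fun t => d t ω) 0 := by
  have hC0 : 0 ≤ C := (integral_nonneg fun ω => sq_nonneg (d 0 ω)).trans (hC 0)
  have hsq : ∀ t, Integrable (fun ω => d t ω ^ 2) μ := fun t => (hd t).integrable_sq
  have h1 : ∀ᵐ ω ∂μ, Tendsto (fun n : ℕ =>
      (1 / ((n ^ 2 : ℕ) : ℝ) * ∑ t ∈ Finset.range (n ^ 2), d t ω) ^ 2) atTop (𝓝 0) := by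
    refine ae_tendsto_zero_of_integral_le_summable (b := fun n => C / (n : ℝ) ^ 2)
      (fun n => ?_) (fun n ω => sq_nonneg _) (fun n => ?_) (summable_const_div_sq C)
    · have hS : MemLp (fun ω => ∑ t ∈ Finset.range (n ^ 2), d t ω) 2 μ :=
        memLp_finsetSum _ fun t _ => hd t
      exact (hS.const_mul _).integrable_sq
    · simp only [mul_pow]
      rw [integral_const_mul, integral_sum_sq_eq hd horth]
      rcases Nat.eq_zero_or_pos n with rfl | hn
      · simp
      have hsum : ∑ t ∈ Finset.range (n ^ 2), ∫ ω, d t ω ^ 2 ∂μ ≤ (n : ℝ) ^ 2 * C := by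
        refine (Finset.sum_le_sum fun t _ => hC t).trans ?_
        simp
      calc (1 / ((n ^ 2 : ℕ) : ℝ)) ^ 2 * ∑ t ∈ Finset.range (n ^ 2), ∫ ω, d t ω ^ 2 ∂μ
          ≤ (1 / ((n ^ 2 : ℕ) : ℝ)) ^ 2 * ((n : ℝ) ^ 2 * C) := by gcongr
        _ = C / (n : ℝ) ^ 2 := by push_cast; field_simp
  -- The expectation is at most `(2n + 1)² C / n⁴`, and `2n + 1 ≤ 3n` gives the constant `9`.
  have h2 : ∀ᵐ ω ∂μ, Tendsto (fun n : ℕ => (2 * (n : ℝ) + 1) / (n : ℝ) ^ 4 *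
        ∑ t ∈ Finset.Ico (n ^ 2) ((n + 1) ^ 2), d t ω ^ 2) atTop (𝓝 0) := by
    refine ae_tendsto_zero_of_integral_le_summable (b := fun n => (9 * C) / (n : ℝ) ^ 2)
      (fun n => ?_) (fun n ω => by positivity) (fun n => ?_) (summable_const_div_sq _)
    · exact (integrable_finsetSum _ fun t _ => hsq t).const_mul _
    · rw [integral_const_mul, integral_finsetSum _ fun t _ => hsq t]
      rcases Nat.eq_zero_or_pos n with rfl | hn
      · simp
      have hn' : (1 : ℝ) ≤ n := by exact_mod_cast hn
      have hsum : ∑ t ∈ Finset.Ico (n ^ 2) ((n + 1) ^ 2), ∫ ω, d t ω ^ 2 ∂μ ≤ (2 * n + 1) * C := by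
        refine (Finset.sum_le_sum fun t _ => hC t).trans ?_
        have : (n + 1) ^ 2 - n ^ 2 = 2 * n + 1 := by
          have : (n + 1) ^ 2 = n ^ 2 + (2 * n + 1) := by ring
          omega
        rw [Finset.sum_const, Nat.card_Ico, this, nsmul_eq_mul]
        push_cast; exact le_rfl
      calc (2 * (n : ℝ) + 1) / (n : ℝ) ^ 4 *
            ∑ t ∈ Finset.Ico (n ^ 2) ((n + 1) ^ 2), ∫ ω, d t ω ^ 2 ∂μ
          ≤ (2 * (n : ℝ) + 1) / (n : ℝ) ^ 4 * ((2 * n + 1) * C) := by gcongr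
        _ = (2 * (n : ℝ) + 1) ^ 2 * (C / (n : ℝ) ^ 4) := by ring
        _ ≤ (3 * (n : ℝ)) ^ 2 * (C / (n : ℝ) ^ 4) := by gcongr; linarith
        _ = 9 * C / (n : ℝ) ^ 2 := by field_simp; ring
  filter_upwards [h1, h2] with ω hω1 hω2
  have hsqrt : Tendsto Nat.sqrt atTop atTop :=
    tendsto_atTop.2 fun b => eventually_atTop.2 ⟨b ^ 2, fun a ha => Nat.le_sqrt'.2 ha⟩
  have h3 : Tendsto (fun x : ℝ => √x) (𝓝 0) (𝓝 0) := by
    simpa using Real.continuous_sqrt.tendsto 0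
  have h4 := ((h3.comp hω1).add (h3.comp hω2)).comp hsqrt
  rw [add_zero] at h4
  refine squeeze_zero_norm' ?_ h4
  filter_upwards [eventually_gt_atTop 0] with T hT
  exact abs_sum_range_div_le hT

lemma integral_mul_eq_zero_of_indep {m : MeasurableSpace Ω} (hm : m ≤ m0) {f z : Ω → ℝ}
    (hf : Measurable[m] f) (hz : Measurable[m0] z)
    (hind : Indep m (MeasurableSpace.comap z inferInstance) μ) (hz0 : ∫ ω, z ω ∂μ = 0) :
    ∫ ω, f ω * z ω ∂μ = 0 := by
  have h : IndepFun f z μ := indep_of_indep_of_le_left hind hf.comap_le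
  rw [h.integral_fun_mul_eq_mul_integral (hf.mono hm le_rfl).aestronglyMeasurable
    hz.aestronglyMeasurable, hz0, mul_zero]

/-- Products of square-integrable variables are in general only integrable; independence of the
squares restores a finite second moment, so no fourth moments of the noise are needed. -/
lemma memLp_mul_of_indepFun {f z : Ω → ℝ} (h : IndepFun f z μ) (hf : MemLp f 2 μ)
    (hz : MemLp z 2 μ) :
    MemLp (fun ω => f ω * z ω) 2 μ ∧
      ∫ ω, (f ω * z ω) ^ 2 ∂μ = (∫ ω, f ω ^ 2 ∂μ) * ∫ ω, z ω ^ 2 ∂μ := by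
  have h2 : IndepFun (fun ω => f ω ^ 2) (fun ω => z ω ^ 2) μ :=
    h.comp (φ := fun r : ℝ => r ^ 2) (ψ := fun r : ℝ => r ^ 2) (by fun_prop) (by fun_prop)
  simp only [mul_pow]
  refine ⟨?_, h2.integral_fun_mul_eq_mul_integral hf.integrable_sq.aestronglyMeasurable
    hz.integrable_sq.aestronglyMeasurable⟩
  rw [memLp_two_iff_integrable_sq (f := fun ω => f ω * z ω)
    (hf.aestronglyMeasurable.mul hz.aestronglyMeasurable)]
  simp only [mul_pow]
  exact h2.integrable_mul hf.integrable_sq hz.integrable_sq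

/-- Averages of products of a bounded-variance process with noise that is independent of the
σ-algebra `ℱ t` vanish. -/
lemma ae_hasAverage_mul_zero {ℱ : ℕ → MeasurableSpace Ω} (hle : ∀ t, ℱ t ≤ m0) {y z : ℕ → Ω → ℝ}
    {C D : ℝ} (hy : ∀ t, Measurable[ℱ t] (y t)) (hz : ∀ t, Measurable[m0] (z t))
    (hind : ∀ t, Indep (ℱ t) (MeasurableSpace.comap (z t) inferInstance) μ)
    (hz0 : ∀ t, ∫ ω, z t ω ∂μ = 0) (hyL : ∀ t, MemLp (y t) 2 μ) (hzL : ∀ t, MemLp (z t) 2 μ)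
    (hyC : ∀ t, ∫ ω, y t ω ^ 2 ∂μ ≤ C) (hzD : ∀ t, ∫ ω, z t ω ^ 2 ∂μ ≤ D)
    (hadapt : ∀ s t, s < t →
      (Measurable[ℱ t] (y s) ∧ Measurable[ℱ t] (z s)) ∨
      (Measurable[ℱ s] (y t) ∧ Measurable[ℱ s] (z t))) :
    ∀ᵐ ω ∂μ, HasAverage (fun t => y t ω * z t ω) 0 := by
  have hI : ∀ t, IndepFun (y t) (z t) μ := fun t =>
    indep_of_indep_of_le_left (hind t) (hy t).comap_le
  have hC0 : 0 ≤ C := (integral_nonneg fun ω => sq_nonneg (y 0 ω)).trans (hyC 0)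
  refine ae_hasAverage_zero_of_orthogonal (C := C * D)
    (fun t => (memLp_mul_of_indepFun (hI t) (hyL t) (hzL t)).1) (fun t => ?_) fun s t hst => ?_
  · rw [(memLp_mul_of_indepFun (hI t) (hyL t) (hzL t)).2]
    exact mul_le_mul (hyC t) (hzD t) (integral_nonneg fun ω => sq_nonneg _) hC0
  -- In the product of the terms at `s` and `t`, the centered factor is `z t` if the σ-algebras
  -- collect the past, and `z s` if they collect the future; the other three factors are measurable
  -- for its σ-algebra.
  · rcases hadapt s t hst with ⟨h1, h2⟩ | ⟨h1, h2⟩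
    · have := integral_mul_eq_zero_of_indep (hle t) ((h1.mul h2).mul (hy t)) (hz t) (hind t) (hz0 t)
      rw [← this]
      exact integral_congr_ae (Eventually.of_forall fun ω => by simp only [Pi.mul_apply]; ring)
    · have := integral_mul_eq_zero_of_indep (hle s) ((h1.mul h2).mul (hy s)) (hz s) (hind s) (hz0 s)
      rw [← this]
      exact integral_congr_ae (Eventually.of_forall fun ω => by simp only [Pi.mul_apply]; ring)

lemma isPiSystem_inter (A B : MeasurableSpace Ω) :
    IsPiSystem {s | ∃ a b, MeasurableSet[A] a ∧ MeasurableSet[B] b ∧ a ∩ b = s} := by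
  rintro _ ⟨a, b, ha, hb, rfl⟩ _ ⟨a', b', ha', hb', rfl⟩ -
  exact ⟨a ∩ a', b ∩ b', ha.inter ha', hb.inter hb', by ac_rfl⟩

lemma sup_eq_generateFrom_inter (A B : MeasurableSpace Ω) :
    A ⊔ B = MeasurableSpace.generateFrom
      {s | ∃ a b, MeasurableSet[A] a ∧ MeasurableSet[B] b ∧ a ∩ b = s} := by
  apply le_antisymm
  · refine sup_le (fun s hs => ?_) fun s hs => ?_
    · exact MeasurableSpace.measurableSet_generateFrom
        ⟨s, Set.univ, hs, MeasurableSet.univ, Set.inter_univ s⟩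
    · exact MeasurableSpace.measurableSet_generateFrom
        ⟨Set.univ, s, MeasurableSet.univ, hs, Set.univ_inter s⟩
  · refine MeasurableSpace.generateFrom_le ?_
    rintro _ ⟨a, b, ha, hb, rfl⟩
    exact MeasurableSet.inter ((le_sup_left : A ≤ A ⊔ B) a ha) ((le_sup_right : B ≤ A ⊔ B) b hb)

/-- The intersections `a ∩ b` form a π-system that generates `A ⊔ B`, so the product formula on them
suffices. -/
lemma indep_sup_left_of_inter [IsProbabilityMeasure μ] {A B C : MeasurableSpace Ω} (hA : A ≤ m0)
    (hB : B ≤ m0) (hC : C ≤ m0)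
    (h : ∀ a b c, MeasurableSet[A] a → MeasurableSet[B] b → MeasurableSet[C] c →
      μ (a ∩ b ∩ c) = μ (a ∩ b) * μ c) : Indep (A ⊔ B) C μ := by
  refine IndepSets.indep (sup_le hA hB) hC (isPiSystem_inter A B)
    (@MeasurableSpace.isPiSystem_measurableSet Ω C) (sup_eq_generateFrom_inter A B)
    (MeasurableSpace.generateFrom_measurableSet (α := Ω)).symm ?_
  rw [IndepSets_iff]
  rintro _ c ⟨a, b, ha, hb, rfl⟩ hc
  exact h a b c ha hb hc

lemma Indep.sup_left_of_indep [IsProbabilityMeasure μ] {A B C : MeasurableSpace Ω} (hA : A ≤ m0)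
    (hB : B ≤ m0) (hC : C ≤ m0) (h1 : Indep A (B ⊔ C) μ) (h2 : Indep B C μ) :
    Indep (A ⊔ B) C μ := by
  refine indep_sup_left_of_inter hA hB hC fun a b c ha hb hc => ?_
  have hb' : MeasurableSet[B ⊔ C] b := (le_sup_left : B ≤ B ⊔ C) b hb
  have hc' : MeasurableSet[B ⊔ C] c := (le_sup_right : C ≤ B ⊔ C) c hc
  rw [Set.inter_assoc, (Indep_iff _ _ μ).1 h1 a (b ∩ c) ha (hb'.inter hc'),
    (Indep_iff _ _ μ).1 h2 b c hb hc, (Indep_iff _ _ μ).1 h1 a b ha hb', mul_assoc]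

/-- A random variable whose law given `F` only depends on `G ≤ F` preserves the independence of `G`
from another sub-σ-algebra of `F`. -/
lemma Indep.sup_comap_of_condExp [IsProbabilityMeasure μ] {F G T : MeasurableSpace Ω} {β : Type*}
    [MeasurableSpace β] {u : Ω → β} (hF : F ≤ m0) (hG : G ≤ F) (hT : T ≤ F) (hu : Measurable[m0] u)
    (hind : Indep G T μ)
    (hlaw : ∀ E, MeasurableSet E → ∃ k : Ω → ℝ, Measurable[G] k ∧ μ⟦u ⁻¹' E | F⟧ =ᵐ[μ] k) :
    Indep (G ⊔ MeasurableSpace.comap u inferInstance) T μ := by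
  refine indep_sup_left_of_inter (hG.trans hF) hu.comap_le (hT.trans hF) ?_
  rintro a _ c ha ⟨E, hE, rfl⟩ hc
  obtain ⟨k, hk, hcond⟩ := hlaw E hE
  have huE : MeasurableSet[m0] (u ⁻¹' E) := hu hE
  have hint : Integrable ((u ⁻¹' E).indicator fun _ => (1 : ℝ)) μ :=
    (integrable_const _).indicator huE
  have haF : MeasurableSet[F] a := hG a ha
  have hcF : MeasurableSet[F] c := hT c hc
  -- The defining property of the conditional expectation replaces the event on `u` by the
  -- `G`-measurable density `k`, to which the independence of `G` and `T` applies.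
  have hset : ∀ s, MeasurableSet[F] s → μ.real (s ∩ u ⁻¹' E) = ∫ ω in s, k ω ∂μ := fun s hs => by
    rw [← setIntegral_congr_ae (hF s hs) (hcond.mono fun ω h _ => h),
      setIntegral_condExp hF hint hs, setIntegral_indicator huE]
    simp
  have hprod : ∫ ω in a ∩ c, k ω ∂μ = (∫ ω in a, k ω ∂μ) * μ.real c := by
    have hac : ∀ ω, (a ∩ c).indicator k ω = a.indicator k ω * c.indicator (fun _ => (1 : ℝ)) ω := by
      intro ω
      by_cases h1 : ω ∈ a <;> by_cases h2 : ω ∈ c <;> simp [h1, h2]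
    have hmc : Measurable[T] (c.indicator fun _ => (1 : ℝ)) :=
      Measurable.indicator measurable_const hc
    have hma : Measurable[G] (a.indicator k) := hk.indicator ha
    have hif : IndepFun (a.indicator k) (c.indicator fun _ => (1 : ℝ)) μ :=
      indep_of_indep_of_le hind hma.comap_le hmc.comap_le
    rw [← integral_indicator (hF _ (haF.inter hcF)), integral_congr_ae (Eventually.of_forall hac),
      hif.integral_fun_mul_eq_mul_integral (hma.mono (hG.trans hF) le_rfl).aestronglyMeasurable
        (hmc.mono (hT.trans hF) le_rfl).aestronglyMeasurable,
      integral_indicator (hF a haF), integral_indicator (hF c hcF)]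
    simp
  have hreal : μ.real (a ∩ u ⁻¹' E ∩ c) = μ.real (a ∩ u ⁻¹' E) * μ.real c := by
    rw [Set.inter_right_comm, hset _ (haF.inter hcF), hprod, hset _ haF]
  simp only [Measure.real] at hreal
  rw [← ENNReal.toReal_mul] at hreal
  exact (ENNReal.toReal_eq_toReal_iff' (measure_ne_top _ _)
    (ENNReal.mul_ne_top (measure_ne_top _ _) (measure_ne_top _ _))).1 hreal

end Probability

/-! ### Geometrically weighted sums of slowly growing sequences -/

section Geometric

lemma exists_le_mul_succ {q : ℕ → ℝ} (hq : ∀ t, 0 ≤ q t)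
    (h : Tendsto (fun t : ℕ => q t / (t : ℝ)) atTop (𝓝 0)) :
    ∃ D : ℝ, 0 ≤ D ∧ ∀ t : ℕ, q t ≤ D * (t + 1) := by
  obtain ⟨t₀, ht₀⟩ := eventually_atTop.1 (h.eventually_le_const zero_lt_one)
  have hs : 0 ≤ ∑ s ∈ Finset.range (t₀ + 1), q s := Finset.sum_nonneg fun i _ => hq i
  refine ⟨1 + ∑ s ∈ Finset.range (t₀ + 1), q s, by positivity, fun t => ?_⟩
  have ht : (0 : ℝ) ≤ t := by positivity
  rcases le_or_gt t t₀ with h1 | h1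
  · have := Finset.single_le_sum (f := q) (fun i _ => hq i)
      (Finset.mem_range.2 (Nat.lt_succ_of_le h1))
    nlinarith
  · have h2 := ht₀ t h1.le
    have : (0 : ℝ) < t := by exact_mod_cast (Nat.zero_le _).trans_lt h1
    rw [div_le_one this] at h2
    nlinarith

/-- A sequence that is `o(t)` grows at most linearly, which the geometric weights absorb; after
division by `t` dominated convergence applies to the series. -/
lemma summable_geometric_mul {q : ℕ → ℝ} (hq : ∀ t, 0 ≤ q t) {r : ℝ} (hr : 0 < r) (hr1 : r < 1)
    (h : Tendsto (fun t : ℕ => q t / (t : ℝ)) atTop (𝓝 0)) :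
    (∀ t, Summable fun l => r ^ l * q (t + l)) ∧
      Tendsto (fun t : ℕ => (∑' l, r ^ l * q (t + l)) / (t : ℝ)) atTop (𝓝 0) := by
  obtain ⟨D, hD, hqD⟩ := exists_le_mul_succ hq h
  have hr' : ‖r‖ < 1 := by rwa [Real.norm_of_nonneg hr.le]
  have hgeo : ∀ c : ℝ, Summable fun l : ℕ => D * (r ^ l * (l + c)) := fun c => by
    refine Summable.mul_left D ?_
    have h1 := summable_pow_mul_geometric_of_norm_lt_one 1 hr'
    have h0 := (summable_geometric_of_lt_one hr.le hr1).mul_right c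
    refine (h1.add h0).congr fun l => ?_
    simp; ring
  refine ⟨fun t => ?_, ?_⟩
  · refine Summable.of_nonneg_of_le (fun l => mul_nonneg (by positivity) (hq _)) (fun l => ?_)
      (hgeo (t + 1))
    calc r ^ l * q (t + l) ≤ r ^ l * (D * ((t + l : ℕ) + 1)) := by gcongr; exact hqD _
      _ = _ := by push_cast; ring
  · have key : Tendsto (fun t : ℕ => ∑' l, r ^ l * q (t + l) / (t : ℝ)) atTop
        (𝓝 (∑' _ : ℕ, (0 : ℝ))) := by
      -- For `t ≥ 1` one has `q (t + l) / t ≤ D (t + l + 1) / t ≤ D (l + 2)`.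
      refine tendsto_tsum_of_dominated_convergence (hgeo 2) (fun l => ?_) ?_
      · have h1 : Tendsto (fun t : ℕ => r ^ l * ((1 + l) * (q (t + l) / ((t + l : ℕ) : ℝ)))) atTop
            (𝓝 (r ^ l * ((1 + l) * 0))) :=
          ((h.comp (tendsto_add_atTop_nat l)).const_mul _).const_mul _
        simp only [mul_zero] at h1
        refine squeeze_zero' (Eventually.of_forall fun t =>
          div_nonneg (mul_nonneg (by positivity) (hq _)) (by positivity)) ?_ h1
        filter_upwards [eventually_gt_atTop 0] with t ht
        have ht' : (1 : ℝ) ≤ t := by exact_mod_cast ht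
        have hl : (0 : ℝ) ≤ l := by positivity
        rw [mul_div_assoc, ← mul_div_assoc (1 + (l : ℝ))]
        gcongr r ^ l * ?_
        rw [div_le_div_iff₀ (by positivity) (by push_cast; positivity)]
        push_cast
        nlinarith [hq (t + l), mul_nonneg hl (sub_nonneg.2 ht'), mul_nonneg (hq (t + l))
          (mul_nonneg hl (sub_nonneg.2 ht'))]
      · filter_upwards [eventually_gt_atTop 0] with t ht l
        have ht' : (1 : ℝ) ≤ t := by exact_mod_cast ht
        have hl : (0 : ℝ) ≤ l := by positivity
        rw [Real.norm_of_nonneg (div_nonneg (mul_nonneg (by positivity) (hq _)) (by positivity)),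
          mul_div_assoc, mul_left_comm]
        gcongr r ^ l * ?_
        rw [div_le_iff₀ (by positivity)]
        refine (hqD _).trans ?_
        push_cast
        rw [mul_assoc]
        gcongr
        nlinarith
    rw [tsum_zero] at key
    refine key.congr fun t => ?_
    rw [tsum_div_const]

end Geometric

/-! ### The preview and noncausal signals -/

namespace Plant

variable {nx nu nw : ℕ} (S : Plant nx nu nw) (P : Matrix (Fin nx) (Fin nx) ℝ)

/-- The gain of the anticipated noise, `(Âᵀ)^(l+1) P Bw`. -/
noncomputable def anticipationGain (l : ℕ) : Matrix (Fin nx) (Fin nw) ℝ :=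
  (S.Ahat P)ᵀ ^ (l + 1) * P * S.Bw

/-- The preview signal `v t = ∑_{l<p} (Âᵀ)^(l+1) P Bw w (t+l)`. -/
noncomputable def previewSignal (p : ℕ) (w : ℕ → Fin nw → ℝ) (t : ℕ) : Fin nx → ℝ :=
  ∑ l ∈ Finset.range p, S.anticipationGain P l *ᵥ w (t + l)

/-- The noncausal signal `v t = ∑_l (Âᵀ)^(l+1) P Bw w (t+l)`. -/
noncomputable def noncausalSignal (w : ℕ → Fin nw → ℝ) (t : ℕ) : Fin nx → ℝ :=
  ∑' l : ℕ, S.anticipationGain P l *ᵥ w (t + l)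

variable {S P}

lemma vPreview_eq (p : ℕ) (w : ℕ → Fin nw → ℝ) (t : ℕ) :
    S.vPreview P p w t = S.previewSignal P p w (t + 1) := by
  have h : Finset.Icc (t + 1) (t + p) = Finset.Ico (t + 1) (t + p + 1) := by
    ext j; simp only [Finset.mem_Icc, Finset.mem_Ico]; omega
  rw [vPreview, h, Finset.sum_Ico_eq_sum_range, previewSignal]
  refine Finset.sum_congr (by congr 1; omega) fun l _ => ?_
  rw [anticipationGain, show t + 1 + l - t = l + 1 by omega]

lemma Ahat_mul_anticipationGain (l : ℕ) :
    (S.Ahat P)ᵀ * S.anticipationGain P l = S.anticipationGain P (l + 1) := by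
  simp only [anticipationGain, pow_succ' _ (l + 1), Matrix.mul_assoc]

lemma anticipationGain_zero : S.anticipationGain P 0 = (S.Ahat P)ᵀ * (P * S.Bw) := by
  simp only [anticipationGain, zero_add, pow_one, Matrix.mul_assoc]

/-- The window of `p` samples moves by one: applying `Âᵀ` to the costate reproduces the signal at
`t` plus one more sample, `w (t + p)`, which becomes the defect in the cost identity. -/
lemma previewSignal_add (p : ℕ) (w : ℕ → Fin nw → ℝ) (t : ℕ) :
    S.previewSignal P p w t + S.anticipationGain P p *ᵥ w (t + p) =
      (S.Ahat P)ᵀ *ᵥ S.costate P (w t) (S.previewSignal P p w (t + 1)) := by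
  have h1 : S.previewSignal P p w t + S.anticipationGain P p *ᵥ w (t + p) =
      ∑ l ∈ Finset.range (p + 1), S.anticipationGain P l *ᵥ w (t + l) :=
    (Finset.sum_range_succ _ _).symm
  rw [h1, Finset.sum_range_succ', costate, Matrix.mulVec_add, Matrix.mulVec_mulVec,
    ← anticipationGain_zero, add_zero, add_comm]
  congr 1
  rw [previewSignal, Matrix.mulVec_sum]
  refine Finset.sum_congr rfl fun l _ => ?_
  rw [Matrix.mulVec_mulVec, Ahat_mul_anticipationGain, add_assoc, add_comm 1]

lemma noncausalSignal_eq {w : ℕ → Fin nw → ℝ}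
    (h : ∀ t, Summable fun l => S.anticipationGain P l *ᵥ w (t + l)) (t : ℕ) :
    S.noncausalSignal P w t =
      (S.Ahat P)ᵀ *ᵥ S.costate P (w t) (S.noncausalSignal P w (t + 1)) := by
  rw [noncausalSignal, (h t).tsum_eq_zero_add, costate, Matrix.mulVec_add, Matrix.mulVec_mulVec,
    ← anticipationGain_zero, add_zero]
  congr 1
  have h2 := (h (t + 1)).hasSum.map (Matrix.mulVecLin (S.Ahat P)ᵀ)
    (by simp only [Matrix.coe_mulVecLin]; fun_prop)
  simp only [Matrix.coe_mulVecLin] at h2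
  rw [noncausalSignal, ← h2.tsum_eq]
  refine tsum_congr fun l => ?_
  rw [Function.comp_apply, Matrix.mulVec_mulVec, Ahat_mul_anticipationGain, add_assoc, add_comm 1]

lemma exists_anticipationGain_le (h : IsSchur (S.Ahat P)) :
    ∃ C r : ℝ, 0 < C ∧ 0 < r ∧ r < 1 ∧
      ∀ l y, ‖S.anticipationGain P l *ᵥ y‖ ≤ C * r ^ l * ‖y‖ := by
  obtain ⟨C, r, hC, hr, hr1, hpow⟩ := h.transpose.exists_norm_pow_mulVec_le
  obtain ⟨D, hD, hDn⟩ := norm_mulVec_le (P * S.Bw)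
  refine ⟨C * (D + 1), r, by positivity, hr, hr1, fun l y => ?_⟩
  rw [anticipationGain, Matrix.mul_assoc, ← Matrix.mulVec_mulVec]
  calc _ ≤ C * r ^ (l + 1) * ‖(P * S.Bw) *ᵥ y‖ := hpow _ _
    _ ≤ C * r ^ l * ((D + 1) * ‖y‖) := by
      gcongr C * ?_ * ?_
      · exact pow_le_pow_of_le_one hr.le hr1.le (Nat.le_succ l)
      · exact (hDn y).trans (by gcongr; linarith)
    _ = _ := by ring

/-- A bound of the preview signals that is uniform in the preview length. -/
lemma exists_norm_previewSignal_sq_le (h : IsSchur (S.Ahat P)) :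
    ∃ C r : ℝ, 0 < C ∧ 0 < r ∧ r < 1 ∧ ∀ p w t, ‖S.previewSignal P p w t‖ ^ 2 ≤
      C * ∑ l ∈ Finset.range p, r ^ l * ‖w (t + l)‖ ^ 2 := by
  obtain ⟨C, r, hC, hr, hr1, hg⟩ := exists_anticipationGain_le h
  have h1r : 0 < 1 - r := by linarith
  refine ⟨C ^ 2 / (1 - r), r, by positivity, hr, hr1, fun p w t => ?_⟩
  have hgeo : ∑ l ∈ Finset.range p, r ^ l ≤ 1 / (1 - r) := by
    have := (summable_geometric_of_lt_one hr.le hr1).sum_le_tsum (Finset.range p)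
      fun i _ => by positivity
    rwa [tsum_geometric_of_lt_one hr.le hr1, ← one_div] at this
  have h1 : ‖S.previewSignal P p w t‖ ≤ C * ∑ l ∈ Finset.range p, r ^ l * ‖w (t + l)‖ := by
    rw [Finset.mul_sum]
    refine (norm_sum_le _ _).trans (Finset.sum_le_sum fun l _ => ?_)
    rw [← mul_assoc]
    exact hg _ _
  -- Cauchy–Schwarz with the weights `r ^ l`, whose total mass is bounded independently of `p`.
  have h2 : (∑ l ∈ Finset.range p, r ^ l * ‖w (t + l)‖) ^ 2 ≤
      (∑ l ∈ Finset.range p, r ^ l) * ∑ l ∈ Finset.range p, r ^ l * ‖w (t + l)‖ ^ 2 :=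
    Finset.sum_sq_le_sum_mul_sum_of_sq_le_mul _ (fun i _ => by positivity)
      (fun i _ => by positivity) fun i _ => by ring_nf; exact le_rfl
  calc ‖S.previewSignal P p w t‖ ^ 2
      ≤ (C * ∑ l ∈ Finset.range p, r ^ l * ‖w (t + l)‖) ^ 2 := by gcongr
    _ = C ^ 2 * (∑ l ∈ Finset.range p, r ^ l * ‖w (t + l)‖) ^ 2 := by ring
    _ ≤ C ^ 2 * (1 / (1 - r) * ∑ l ∈ Finset.range p, r ^ l * ‖w (t + l)‖ ^ 2) := by
      gcongr
      refine h2.trans ?_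
      gcongr
    _ = _ := by ring

lemma summable_anticipation (h : IsSchur (S.Ahat P)) {w : ℕ → Fin nw → ℝ}
    (hw : Tendsto (fun t : ℕ => ‖w t‖ ^ 2 / (t : ℝ)) atTop (𝓝 0)) (t : ℕ) :
    Summable fun l => S.anticipationGain P l *ᵥ w (t + l) := by
  obtain ⟨C, r, hC, hr, hr1, hg⟩ := exists_anticipationGain_le h
  have hs := (summable_geometric_mul (fun t => sq_nonneg ‖w t‖) hr hr1 hw).1 t
  refine Summable.of_norm_bounded
    (((summable_geometric_of_lt_one hr.le hr1).add hs).mul_left C) fun l => (hg l _).trans ?_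
  rw [mul_assoc]
  gcongr
  have : ‖w (t + l)‖ ≤ 1 + ‖w (t + l)‖ ^ 2 := by nlinarith [sq_nonneg (‖w (t + l)‖ - 1)]
  calc r ^ l * ‖w (t + l)‖ ≤ r ^ l * (1 + ‖w (t + l)‖ ^ 2) := by gcongr
    _ = _ := by ring

lemma tendsto_previewSignal {w : ℕ → Fin nw → ℝ} {t : ℕ}
    (h : Summable fun l => S.anticipationGain P l *ᵥ w (t + l)) :
    Tendsto (fun p => S.previewSignal P p w t) atTop (𝓝 (S.noncausalSignal P w t)) :=
  h.hasSum.tendsto_sum_nat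

/-- The preview signals and the noncausal signal are `o(√t)` if the noise is. -/
lemma tendsto_norm_signal_sq_div (h : IsSchur (S.Ahat P)) {w : ℕ → Fin nw → ℝ}
    (hw : Tendsto (fun t : ℕ => ‖w t‖ ^ 2 / (t : ℝ)) atTop (𝓝 0)) :
    (∀ p, Tendsto (fun t : ℕ => ‖S.previewSignal P p w t‖ ^ 2 / (t : ℝ)) atTop (𝓝 0)) ∧
      Tendsto (fun t : ℕ => ‖S.noncausalSignal P w t‖ ^ 2 / (t : ℝ)) atTop (𝓝 0) := by
  obtain ⟨C, r, hC, hr, hr1, hb⟩ := exists_norm_previewSignal_sq_le h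
  obtain ⟨hs, ht⟩ := summable_geometric_mul (fun t => sq_nonneg ‖w t‖) hr hr1 hw
  have h1 : ∀ p t, ‖S.previewSignal P p w t‖ ^ 2 ≤ C * ∑' l, r ^ l * ‖w (t + l)‖ ^ 2 :=
    fun p t => (hb p w t).trans (by
      gcongr; exact (hs t).sum_le_tsum _ fun i _ => by positivity)
  have h2 : ∀ t, ‖S.noncausalSignal P w t‖ ^ 2 ≤ C * ∑' l, r ^ l * ‖w (t + l)‖ ^ 2 := fun t =>
    le_of_tendsto' ((tendsto_previewSignal (summable_anticipation h hw t)).norm.pow 2)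
      fun p => h1 p t
  have h3 := ht.const_mul C
  rw [mul_zero] at h3
  refine ⟨fun p => squeeze_zero (fun t => by positivity) (fun t => ?_) h3,
    squeeze_zero (fun t => by positivity) (fun t => ?_) h3⟩
  · rw [← mul_div_assoc]; gcongr; exact h1 p t
  · rw [← mul_div_assoc]; gcongr; exact h2 t

/-- Since `Kv P Bw = Kw`, the deviation in the completed square vanishes exactly when the input
follows the controller. -/
lemma deviation_eq (x : Fin nx → ℝ) (u : Fin nu → ℝ) (w : Fin nw → ℝ) (v : Fin nx → ℝ) :
    S.deviation P x u w v = u - (-(S.Kx P *ᵥ x) - S.Kw P *ᵥ w - S.Kv P *ᵥ v) := by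
  have : S.Kv P * (P * S.Bw) = S.Kw P := by simp only [Kv, Kw, Matrix.mul_assoc]
  rw [deviation, costate, Matrix.mulVec_add, Matrix.mulVec_mulVec, this]
  abel

/-- The closed loop under the feedback law driven by a signal `v`. -/
lemma closedLoop_step (x : Fin nx → ℝ) (w : Fin nw → ℝ) (v : Fin nx → ℝ) :
    S.A *ᵥ x + S.Bu *ᵥ (-(S.Kx P *ᵥ x) - S.Kw P *ᵥ w - S.Kv P *ᵥ v) + S.Bw *ᵥ w =
      S.Ahat P *ᵥ x + ((S.Bw - S.Bu * S.Kw P) *ᵥ w - (S.Bu * S.Kv P) *ᵥ v) := by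
  simp only [Ahat, Matrix.mulVec_sub, Matrix.mulVec_neg, Matrix.sub_mulVec, Matrix.mulVec_mulVec]
  abel

lemma exists_closedLoop_input_sq_le (S : Plant nx nu nw) (P : Matrix (Fin nx) (Fin nx) ℝ) :
    ∃ C : ℝ, 0 ≤ C ∧ ∀ w v, ‖(S.Bw - S.Bu * S.Kw P) *ᵥ w - (S.Bu * S.Kv P) *ᵥ v‖ ^ 2 ≤
      C * (‖w‖ ^ 2 + ‖v‖ ^ 2) := by
  obtain ⟨C, hC, h1⟩ := norm_mulVec_le (S.Bw - S.Bu * S.Kw P)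
  obtain ⟨D, hD, h2⟩ := norm_mulVec_le (S.Bu * S.Kv P)
  refine ⟨2 * C ^ 2 + 2 * D ^ 2, by positivity, fun w v => ?_⟩
  calc _ ≤ (C * ‖w‖ + D * ‖v‖) ^ 2 := by
        gcongr; exact (norm_sub_le _ _).trans (add_le_add (h1 w) (h2 v))
    _ ≤ _ := by nlinarith [sq_nonneg (C * ‖w‖ - D * ‖v‖), sq_nonneg (C * ‖v‖),
        sq_nonneg (D * ‖w‖)]

end Plant

lemma norm_sq_le_sum_sq {n : ℕ} (x : Fin n → ℝ) : ‖x‖ ^ 2 ≤ ∑ a, x a ^ 2 := by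
  have h : ‖x‖ ≤ √(∑ a, x a ^ 2) := by
    refine (pi_norm_le_iff_of_nonneg (Real.sqrt_nonneg _)).2 fun a => ?_
    exact Real.abs_le_sqrt (Finset.single_le_sum (f := fun a => x a ^ 2)
      (fun i _ => sq_nonneg _) (Finset.mem_univ a))
  calc ‖x‖ ^ 2 ≤ √(∑ a, x a ^ 2) ^ 2 := by gcongr
    _ = _ := Real.sq_sqrt (by positivity)

lemma apply_sq_le_norm_sq {n : ℕ} (x : Fin n → ℝ) (a : Fin n) : x a ^ 2 ≤ ‖x‖ ^ 2 := by
  rw [← sq_abs]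
  exact pow_le_pow_left₀ (abs_nonneg _) (norm_le_pi_norm x a) 2

variable {nx nu nw : ℕ} {Ω : Type*} {m0 : MeasurableSpace Ω} {μ : Measure Ω}
  {w : ℕ → Ω → Fin nw → ℝ} {x₀ : Ω → Fin nx → ℝ}

/-! ### White noise: moments, sample covariance and growth -/

namespace IsWhiteNoise

lemma memLp_apply (hw : IsWhiteNoise μ w) (t : ℕ) (a : Fin nw) :
    MemLp (fun ω => w t ω a) 2 μ := (hw.memLp t).eval a

lemma measurable_apply (hw : IsWhiteNoise μ w) (t : ℕ) (a : Fin nw) :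
    Measurable fun ω => w t ω a := (measurable_pi_apply a).comp (hw.meas t)

lemma integral_apply_sq (hw : IsWhiteNoise μ w) (t : ℕ) (a : Fin nw) :
    ∫ ω, w t ω a ^ 2 ∂μ = 1 := by
  simpa [sq] using hw.cov t t a a

lemma integrable_norm_sq (hw : IsWhiteNoise μ w) (t : ℕ) :
    Integrable (fun ω => ‖w t ω‖ ^ 2) μ := (hw.memLp t).norm.integrable_sq

lemma integral_norm_sq_le (hw : IsWhiteNoise μ w) (t : ℕ) :
    ∫ ω, ‖w t ω‖ ^ 2 ∂μ ≤ nw := by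
  have h1 : ∀ a ∈ Finset.univ, Integrable (fun ω => w t ω a ^ 2) μ := fun a _ =>
    (hw.memLp_apply t a).integrable_sq
  calc ∫ ω, ‖w t ω‖ ^ 2 ∂μ ≤ ∫ ω, ∑ a, w t ω a ^ 2 ∂μ :=
        integral_mono (hw.integrable_norm_sq t) (integrable_finsetSum _ h1)
          fun ω => norm_sq_le_sum_sq _
    _ = nw := by
      rw [integral_finsetSum _ h1]
      simp [hw.integral_apply_sq]

/-- Law of large numbers for the sample covariance of white noise. -/
lemma ae_hasAverage_mul (hw : IsWhiteNoise μ w) :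
    ∀ᵐ ω ∂μ, ∀ a b, HasAverage (fun t => w t ω a * w t ω b) (if a = b then 1 else 0) := by
  refine ae_all_iff.2 fun a => ae_all_iff.2 fun b => ?_
  have hφ : Measurable fun y : Fin nw → ℝ => y a * y b := by fun_prop
  have h := strong_law_ae_real (fun t ω => w t ω a * w t ω b)
    ((hw.memLp_apply 0 a).integrable_mul (hw.memLp_apply 0 b))
    (fun i j hij => (hw.indep.indepFun hij).comp hφ hφ)
    (fun i => (hw.ident i).comp hφ)
  filter_upwards [h] with ω hω
  have h0 := hw.cov 0 0 a b
  simp only [true_and] at h0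
  rw [h0] at hω
  exact hω.congr fun n => by rw [one_div, div_eq_inv_mul]

/-- The squares of the components have Cesàro limits, hence are `o(t)`; this pathwise growth bound
makes the noncausal series converge. -/
lemma ae_tendsto_norm_sq_div (hw : IsWhiteNoise μ w) :
    ∀ᵐ ω ∂μ, Tendsto (fun t : ℕ => ‖w t ω‖ ^ 2 / (t : ℝ)) atTop (𝓝 0) := by
  filter_upwards [hw.ae_hasAverage_mul] with ω hω
  have h1 : Tendsto (fun t : ℕ => ∑ a, w t ω a * w t ω a / (t : ℝ)) atTop
      (𝓝 (∑ _ : Fin nw, (0 : ℝ))) := tendsto_finsetSum _ fun a _ => (hω a a).tendsto_div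
  rw [Finset.sum_const_zero] at h1
  refine squeeze_zero (fun t => by positivity) (fun t => ?_) h1
  rw [← Finset.sum_div]
  gcongr
  refine (norm_sq_le_sum_sq _).trans_eq (Finset.sum_congr rfl fun a _ => sq _)

end IsWhiteNoise

/-- The σ-algebra of the noise from time `t` on. -/
@[reducible] def noiseFrom (w : ℕ → Ω → Fin nw → ℝ) (t : ℕ) : MeasurableSpace Ω :=
  ⨆ s ∈ {s | t ≤ s}, MeasurableSpace.comap (w s) inferInstance

/-- The σ-algebra of the noise before time `t`. -/
@[reducible] def noiseBefore (w : ℕ → Ω → Fin nw → ℝ) (t : ℕ) : MeasurableSpace Ω :=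
  ⨆ s ∈ {s | s < t}, MeasurableSpace.comap (w s) inferInstance

/-- The σ-algebra of the initial state, of the noise before time `t + p` and of the inputs before
time `t`. -/
@[reducible] def sigmaPast (p : ℕ) (w : ℕ → Ω → Fin nw → ℝ) (x₀ : Ω → Fin nx → ℝ)
    (u : ℕ → Ω → Fin nu → ℝ) (t : ℕ) : MeasurableSpace Ω :=
  (MeasurableSpace.comap x₀ inferInstance ⊔ noiseBefore w (t + p)) ⊔
    ⨆ s ∈ {s | s < t}, MeasurableSpace.comap (u s) inferInstance

/-! ### Measurability with respect to past and future σ-algebras -/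

section Sigma

variable {u : ℕ → Ω → Fin nu → ℝ}

lemma measurable_noiseFrom {s t : ℕ} (h : t ≤ s) : Measurable[noiseFrom w t] (w s) :=
  measurable_iff_comap_le.2 (le_iSup₂_of_le (f := fun s (_ : s ∈ {s | t ≤ s}) =>
    MeasurableSpace.comap (w s) inferInstance) s h le_rfl)

lemma measurable_noiseBefore {s t : ℕ} (h : s < t) : Measurable[noiseBefore w t] (w s) :=
  measurable_iff_comap_le.2 (le_iSup₂_of_le (f := fun s (_ : s ∈ {s | s < t}) =>
    MeasurableSpace.comap (w s) inferInstance) s h le_rfl)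

lemma noiseFrom_le {m : MeasurableSpace Ω} {t : ℕ} (h : ∀ s, t ≤ s → Measurable[m] (w s)) :
    noiseFrom w t ≤ m := iSup₂_le fun s hs => (h s hs).comap_le

lemma noiseBefore_le {m : MeasurableSpace Ω} {t : ℕ} (h : ∀ s, s < t → Measurable[m] (w s)) :
    noiseBefore w t ≤ m := iSup₂_le fun s hs => (h s hs).comap_le

lemma measurable_sigmaPast_init {p t : ℕ} : Measurable[sigmaPast p w x₀ u t] x₀ :=
  measurable_iff_comap_le.2 (le_sup_left.trans le_sup_left)

lemma measurable_sigmaPast_noise {p s t : ℕ} (h : s < t + p) :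
    Measurable[sigmaPast p w x₀ u t] (w s) :=
  (measurable_noiseBefore h).mono (le_sup_right.trans le_sup_left) le_rfl

lemma measurable_sigmaPast_input {p s t : ℕ} (h : s < t) :
    Measurable[sigmaPast p w x₀ u t] (u s) :=
  measurable_iff_comap_le.2 (le_sup_of_le_right (le_iSup₂_of_le (f := fun s (_ : s ∈ {s | s < t}) =>
    MeasurableSpace.comap (u s) inferInstance) s h le_rfl))

lemma sigmaPast_le {m : MeasurableSpace Ω} {p t : ℕ} (h0 : Measurable[m] x₀)
    (hw : ∀ s, s < t + p → Measurable[m] (w s)) (hu : ∀ s, s < t → Measurable[m] (u s)) :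
    sigmaPast p w x₀ u t ≤ m :=
  sup_le (sup_le h0.comap_le (noiseBefore_le hw)) (iSup₂_le fun s hs => (hu s hs).comap_le)

lemma measurable_sigmaBefore_init {t : ℕ} : Measurable[sigmaBefore w x₀ u t] x₀ :=
  measurable_iff_comap_le.2 (le_sup_left.trans le_sup_left)

lemma measurable_sigmaBefore_noise {s t : ℕ} : Measurable[sigmaBefore w x₀ u t] (w s) :=
  measurable_iff_comap_le.2 (le_sup_of_le_left (le_sup_of_le_right (le_iSup_of_le
    (f := fun s => MeasurableSpace.comap (w s) inferInstance) s le_rfl)))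

lemma measurable_sigmaBefore_input {s t : ℕ} (h : s < t) :
    Measurable[sigmaBefore w x₀ u t] (u s) :=
  measurable_iff_comap_le.2 (le_sup_of_le_right (le_iSup₂_of_le (f := fun s (_ : s < t) =>
    MeasurableSpace.comap (u s) inferInstance) s h le_rfl))

lemma sigmaBefore_le {m : MeasurableSpace Ω} {t : ℕ} (h0 : Measurable[m] x₀)
    (hw : ∀ s, Measurable[m] (w s)) (hu : ∀ s, s < t → Measurable[m] (u s)) :
    sigmaBefore w x₀ u t ≤ m :=
  sup_le (sup_le h0.comap_le (iSup_le fun s => (hw s).comap_le))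
    (iSup₂_le fun s hs => (hu s hs).comap_le)

lemma sigmaInitial_le {m : MeasurableSpace Ω} {p : ℕ} (h0 : Measurable[m] x₀)
    (hw : ∀ s, Measurable[m] (w s)) : sigmaInitial p w x₀ ≤ m :=
  sup_le h0.comap_le (iSup₂_le fun s _ => (hw s).comap_le)

lemma measurable_mulVec_comp {m : MeasurableSpace Ω} {k l : ℕ} (M : Matrix (Fin k) (Fin l) ℝ)
    {f : Ω → Fin l → ℝ} (hf : Measurable[m] f) : Measurable[m] fun ω => M *ᵥ f ω :=
  (by fun_prop : Continuous fun y : Fin l → ℝ => M *ᵥ y).measurable.comp hf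

lemma IsTrajectory.measurable_state {S : Plant nx nu nw} {m : MeasurableSpace Ω}
    {x : ℕ → Ω → Fin nx → ℝ} {t : ℕ}
    (hx : IsTrajectory S w x₀ x u) (h0 : Measurable[m] x₀) (hw : ∀ s, s < t → Measurable[m] (w s))
    (hu : ∀ s, s < t → Measurable[m] (u s)) : Measurable[m] (x t) := by
  induction t with
  | zero =>
    have : x 0 = x₀ := funext hx.init
    rwa [this]
  | succ t ih =>
    have h1 := ih (fun s hs => hw s (by omega)) (fun s hs => hu s (by omega))
    have : x (t + 1) = fun ω => S.A *ᵥ x t ω + S.Bu *ᵥ u t ω + S.Bw *ᵥ w t ω :=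
      funext fun ω => hx.step t ω
    rw [this]
    exact ((measurable_mulVec_comp _ h1).add (measurable_mulVec_comp _ (hu t (by omega)))).add
      (measurable_mulVec_comp _ (hw t (by omega)))

lemma IsTrajectory.measurable_state_sigmaPast {S : Plant nx nu nw} {x : ℕ → Ω → Fin nx → ℝ}
    {p s t : ℕ} (hx : IsTrajectory S w x₀ x u) (hst : s ≤ t) :
    Measurable[sigmaPast p w x₀ u t] (x s) :=
  hx.measurable_state measurable_sigmaPast_init
    (fun _ h => measurable_sigmaPast_noise (by omega))
    (fun _ h => measurable_sigmaPast_input (by omega))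

end Sigma

/-! ### Independence of the closed-loop past from unrevealed noise -/

section Independence

variable {u : ℕ → Ω → Fin nu → ℝ}

lemma IsWhiteNoise.indep_noiseFrom (hw : IsWhiteNoise μ w) (t : ℕ) :
    Indep (MeasurableSpace.comap (w t) inferInstance) (noiseFrom w (t + 1)) μ := by
  have h := indep_iSup_of_disjoint (fun i => (hw.meas i).comap_le) hw.indep.iIndep
    (S := {t}) (T := {s | t + 1 ≤ s}) (by simp)
  simpa only [iSup_singleton] using h

lemma IsWhiteNoise.indep_noiseBefore (hw : IsWhiteNoise μ w) (t : ℕ) :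
    Indep (noiseBefore w t) (noiseFrom w t) μ :=
  indep_iSup_of_disjoint (fun i => (hw.meas i).comap_le) hw.indep.iIndep
    (Set.disjoint_left.2 fun s hs hs' => by
      simp only [Set.mem_ofPred_eq] at hs hs'; omega)

lemma noiseFrom_eq_sup (t : ℕ) : noiseFrom w t =
    MeasurableSpace.comap (w t) inferInstance ⊔ noiseFrom w (t + 1) := by
  refine le_antisymm (noiseFrom_le fun s hs => ?_) (sup_le (measurable_noiseFrom le_rfl).comap_le
    (noiseFrom_le fun s hs => measurable_noiseFrom (by omega)))
  rcases eq_or_lt_of_le hs with rfl | h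
  · exact measurable_iff_comap_le.2 le_sup_left
  · exact (measurable_noiseFrom (w := w) h).mono le_sup_right le_rfl

/-- Averages of products of the noise with signals that only depend on the later noise vanish. -/
lemma IsWhiteNoise.ae_hasAverage_mul_future (hw : IsWhiteNoise μ w)
    {y : ℕ → Ω → Fin nx → ℝ} {C : ℝ}
    (hy : ∀ t, Measurable[noiseFrom w (t + 1)] (y t)) (hyL : ∀ t, MemLp (y t) 2 μ)
    (hyC : ∀ t a, ∫ ω, y t ω a ^ 2 ∂μ ≤ C) :
    ∀ᵐ ω ∂μ, ∀ a b, HasAverage (fun t => w t ω a * y t ω b) 0 := by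
  refine ae_all_iff.2 fun a => ae_all_iff.2 fun b => ?_
  simp only [mul_comm (w _ _ a)]
  refine ae_hasAverage_mul_zero (ℱ := fun t => noiseFrom w (t + 1)) (y := fun t ω => y t ω b)
    (z := fun t ω => w t ω a) (C := C) (D := 1)
    (fun t => noiseFrom_le fun s _ => hw.meas s)
    (fun t => (measurable_pi_apply b).comp (hy t)) (fun t => hw.measurable_apply _ a)
    (fun t => ?_) (fun t => hw.mean _ a) (fun t => (hyL t).eval b)
    (fun t => hw.memLp_apply _ a) (fun t => hyC t b) (fun t => (hw.integral_apply_sq _ a).le)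
    fun s t hst => Or.inr ⟨?_, ?_⟩
  · refine indep_of_indep_of_le_right (hw.indep_noiseFrom t).symm ?_
    exact ((measurable_pi_apply a).comp (comap_measurable (w t))).comap_le
  · refine ((measurable_pi_apply b).comp (hy t)).mono (noiseFrom_le fun r hr =>
      measurable_noiseFrom (by omega)) le_rfl
  · exact (measurable_pi_apply a).comp (measurable_noiseFrom (by omega))

variable [IsProbabilityMeasure μ]

lemma IsInitialState.indep_sup (hx₀ : IsInitialState μ w x₀) (hw : IsWhiteNoise μ w) (p : ℕ) :
    Indep (MeasurableSpace.comap x₀ inferInstance ⊔ noiseBefore w p) (noiseFrom w p) μ := by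
  refine Indep.sup_left_of_indep hx₀.meas.comap_le (noiseBefore_le fun s _ => hw.meas s)
    (noiseFrom_le fun s _ => hw.meas s) ?_ (hw.indep_noiseBefore p)
  have hs : ∀ s, Measurable[MeasurableSpace.comap (fun ω t => w t ω) inferInstance] (w s) :=
    fun s => (measurable_pi_apply s).comp (comap_measurable fun ω t => w t ω)
  exact indep_of_indep_of_le_right hx₀.indep
    (sup_le (noiseBefore_le fun s _ => hs s) (noiseFrom_le fun s _ => hs s))

/-- In closed loop, what precedes the arrival of a noise sample is independent of the noise from
that sample on. -/
lemma IsClosedLoop.indep_sigmaPast {S : Plant nx nu nw} {p : ℕ} {K : Policy nx nu nw p}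
    {x : ℕ → Ω → Fin nx → ℝ} (hcl : IsClosedLoop S μ w x₀ K x u) (hw : IsWhiteNoise μ w)
    (hx₀ : IsInitialState μ w x₀) (t : ℕ) :
    Indep (sigmaPast p w x₀ u t) (noiseFrom w (t + p)) μ := by
  have htr := hcl.toIsTrajectory
  induction t with
  | zero =>
    have h : sigmaPast p w x₀ u 0 =
        MeasurableSpace.comap x₀ inferInstance ⊔ noiseBefore w (0 + p) := by
      simp [sigmaPast]
    rw [h, zero_add]
    exact hx₀.indep_sup hw p
  | succ t ih =>
    have hpast : sigmaPast p w x₀ u t ≤ m0 := sigmaPast_le hx₀.meas (fun s _ => hw.meas s)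
      (fun s _ => hcl.meas_input s)
    have hnoise : noiseFrom w (t + p + 1) ≤ m0 := noiseFrom_le fun s _ => hw.meas s
    rw [noiseFrom_eq_sup] at ih
    -- First the newly previewed sample `w (t + p)` joins the past; the noise after it remains
    -- independent.
    have h1 := Indep.sup_left_of_indep hpast (hw.meas (t + p)).comap_le hnoise ih
      (hw.indep_noiseFrom (t + p))
    have hF : sigmaBefore w x₀ u t ≤ m0 := sigmaBefore_le hx₀.meas hw.meas
      fun s _ => hcl.meas_input s
    have hut := hcl.meas_input t
    have hlaw := hcl.law_input t
    set G := sigmaPast p w x₀ u t ⊔ MeasurableSpace.comap (w (t + p)) inferInstance with hG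
    have hpG : sigmaPast p w x₀ u t ≤ G := le_sup_left
    have hwG : ∀ s, s < t + p + 1 → Measurable[G] (w s) := fun s hs => by
      rcases Nat.lt_succ_iff_lt_or_eq.1 hs with h | rfl
      · exact (measurable_sigmaPast_noise h).mono hpG le_rfl
      · exact measurable_iff_comap_le.2 le_sup_right
    have hinfo : Measurable[G] (info p w x t) := by
      refine Measurable.prodMk ?_ ?_
      · exact measurable_pi_lambda _ fun s =>
          (htr.measurable_state_sigmaPast (Nat.le_of_lt_succ s.2)).mono hpG le_rfl
      · exact measurable_pi_lambda _ fun s => hwG s s.2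
    have hGF : G ≤ sigmaBefore w x₀ u t := sup_le
      (sigmaPast_le measurable_sigmaBefore_init (fun s _ => measurable_sigmaBefore_noise)
        fun s hs => measurable_sigmaBefore_input hs) measurable_sigmaBefore_noise.comap_le
    -- Then the input joins. Its law given everything before it, future noise included, depends only
    -- on the information in `G`, so a randomized draw cannot reveal later noise.
    have h2 := Indep.sup_comap_of_condExp hF hGF
      (noiseFrom_le fun s _ => measurable_sigmaBefore_noise) hut h1
      fun E hE => ⟨fun ω => (K.kernel t (info p w x t ω)).real E,
        ((Kernel.measurable_coe (K.kernel t) hE).comp hinfo).ennreal_toReal, hlaw E hE⟩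
    rw [show t + 1 + p = t + p + 1 by omega]
    refine indep_of_indep_of_le_left h2 (sigmaPast_le ?_ (fun s hs => ?_) fun s hs => ?_)
    · exact measurable_sigmaPast_init.mono (hpG.trans le_sup_left) le_rfl
    · exact (hwG s (by omega)).mono le_sup_left le_rfl
    · rcases Nat.lt_succ_iff_lt_or_eq.1 hs with h | rfl
      · exact (measurable_sigmaPast_input h).mono (hpG.trans le_sup_left) le_rfl
      · exact measurable_iff_comap_le.2 le_sup_right

/-- In closed loop, averages of products of nonanticipating signals with the noise vanish. -/
lemma IsClosedLoop.ae_hasAverage_mul {S : Plant nx nu nw} {p : ℕ} {K : Policy nx nu nw p}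
    {x : ℕ → Ω → Fin nx → ℝ} (hcl : IsClosedLoop S μ w x₀ K x u) (hw : IsWhiteNoise μ w)
    (hx₀ : IsInitialState μ w x₀) {y : ℕ → Ω → Fin nx → ℝ} {C : ℝ}
    (hy : ∀ t, Measurable[sigmaPast p w x₀ u t] (y t)) (hyL : ∀ t, MemLp (y t) 2 μ)
    (hyC : ∀ t a, ∫ ω, y t ω a ^ 2 ∂μ ≤ C) :
    ∀ᵐ ω ∂μ, ∀ a b, HasAverage (fun t => y t ω a * w (t + p) ω b) 0 := by
  refine ae_all_iff.2 fun a => ae_all_iff.2 fun b => ?_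
  refine ae_hasAverage_mul_zero (ℱ := sigmaPast p w x₀ u) (y := fun t ω => y t ω a)
    (z := fun t ω => w (t + p) ω b) (C := C) (D := 1)
    (fun t => sigmaPast_le hx₀.meas (fun s _ => hw.meas s) fun s _ => hcl.meas_input s)
    (fun t => (measurable_pi_apply a).comp (hy t)) (fun t => hw.measurable_apply _ b)
    (fun t => ?_) (fun t => hw.mean _ b) (fun t => (hyL t).eval a)
    (fun t => hw.memLp_apply _ b) (fun t => hyC t a) (fun t => (hw.integral_apply_sq _ b).le)
    fun s t hst => Or.inl ⟨?_, ?_⟩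
  · refine indep_of_indep_of_le_right (hcl.indep_sigmaPast hw hx₀ t) ?_
    exact ((measurable_pi_apply b).comp (measurable_noiseFrom (w := w) le_rfl)).comap_le
  · refine ((measurable_pi_apply a).comp (hy s)).mono (sigmaPast_le measurable_sigmaPast_init
      (fun r hr => measurable_sigmaPast_noise (by omega))
      fun r hr => measurable_sigmaPast_input (by omega)) le_rfl
  · exact (measurable_pi_apply b).comp (measurable_sigmaPast_noise (by omega))

end Independence

/-! ### Second moments and stabilized states -/

section Moments

variable {Ω : Type*} {m0 : MeasurableSpace Ω} {μ : Measure Ω} {n : ℕ}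

lemma memLp_two_of_norm_sq_le {f : Ω → Fin n → ℝ} (hf : Measurable f) {g : Ω → ℝ}
    (hg : Integrable g μ) (h : ∀ ω, ‖f ω‖ ^ 2 ≤ g ω) :
    MemLp f 2 μ ∧ ∫ ω, ‖f ω‖ ^ 2 ∂μ ≤ ∫ ω, g ω ∂μ := by
  have hi : Integrable (fun ω => ‖f ω‖ ^ 2) μ :=
    hg.mono' (hf.norm.pow_const 2).aestronglyMeasurable
      (Eventually.of_forall fun ω => by rw [Real.norm_of_nonneg (by positivity)]; exact h ω)
  exact ⟨(memLp_two_iff_integrable_sq_norm hf.aestronglyMeasurable).2 hi, integral_mono hi hg h⟩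

/-- Fatou's lemma for second moments. -/
lemma memLp_two_of_tendsto {f : ℕ → Ω → Fin n → ℝ} {g : Ω → Fin n → ℝ} {B : ℝ}
    (hf : ∀ k, Measurable (f k)) (hL : ∀ k, MemLp (f k) 2 μ)
    (hB : ∀ k, ∫ ω, ‖f k ω‖ ^ 2 ∂μ ≤ B) (hg : Measurable g)
    (h : ∀ᵐ ω ∂μ, Tendsto (fun k => f k ω) atTop (𝓝 (g ω))) :
    MemLp g 2 μ ∧ ∫ ω, ‖g ω‖ ^ 2 ∂μ ≤ B := by
  have hB0 : 0 ≤ B := (integral_nonneg fun ω => by positivity).trans (hB 0)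
  have hlim : ∀ᵐ ω ∂μ, ENNReal.ofReal (‖g ω‖ ^ 2) =
      liminf (fun k => ENNReal.ofReal (‖f k ω‖ ^ 2)) atTop := by
    filter_upwards [h] with ω hω
    exact ((ENNReal.continuous_ofReal.tendsto _).comp (hω.norm.pow 2)).liminf_eq.symm
  have hle : ∫⁻ ω, ENNReal.ofReal (‖g ω‖ ^ 2) ∂μ ≤ ENNReal.ofReal B := by
    rw [lintegral_congr_ae hlim]
    refine (lintegral_liminf_le fun k => ((hf k).norm.pow_const 2).ennreal_ofReal).trans ?_
    refine (liminf_le_liminf (v := fun _ => ENNReal.ofReal B) (Eventually.of_forall fun k => ?_)).trans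
      (by simp)
    rw [← ofReal_integral_eq_lintegral_ofReal (hL k).norm.integrable_sq
      (Eventually.of_forall fun ω => by positivity)]
    exact ENNReal.ofReal_le_ofReal (hB k)
  have hmeas : AEStronglyMeasurable (fun ω => ‖g ω‖ ^ 2) μ :=
    (hg.norm.pow_const 2).aestronglyMeasurable
  have h0 : 0 ≤ᵐ[μ] fun ω => ‖g ω‖ ^ 2 := Eventually.of_forall fun ω => by positivity
  have hi : Integrable (fun ω => ‖g ω‖ ^ 2) μ :=
    ⟨hmeas, (hasFiniteIntegral_iff_ofReal h0).2 (hle.trans_lt ENNReal.ofReal_lt_top)⟩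
  refine ⟨(memLp_two_iff_integrable_sq_norm hg.aestronglyMeasurable).2 hi, ?_⟩
  rw [integral_eq_lintegral_of_nonneg_ae h0 hmeas]
  exact ENNReal.toReal_le_of_le_ofReal hB0 hle

lemma integral_apply_sq_le {f : Ω → Fin n → ℝ} (hf : MemLp f 2 μ) (a : Fin n) :
    ∫ ω, f ω a ^ 2 ∂μ ≤ ∫ ω, ‖f ω‖ ^ 2 ∂μ :=
  integral_mono (hf.eval a).integrable_sq hf.norm.integrable_sq fun _ => apply_sq_le_norm_sq _ a

lemma IsStabilized.exists_integral_norm_sq_le {x : ℕ → Ω → Fin n → ℝ} (h : IsStabilized μ x) :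
    ∃ C : ℝ, ∀ t, MemLp (x t) 2 μ ∧ ∫ ω, ‖x t ω‖ ^ 2 ∂μ ≤ C := by
  obtain ⟨C, hC⟩ := h
  refine ⟨C, fun t => ⟨(hC t).1, le_trans ?_ (hC t).2.2⟩⟩
  have hi : Integrable (fun ω => ∑ a, x t ω a * x t ω a) μ := integrable_finsetSum _ fun a _ =>
    ((hC t).1.eval a).integrable_mul ((hC t).1.eval a)
  exact integral_mono (hC t).1.norm.integrable_sq hi fun ω =>
    (norm_sq_le_sum_sq _).trans_eq (Finset.sum_congr rfl fun a _ => sq _)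

lemma isStabilized_of_integral_norm_sq_le [IsProbabilityMeasure μ] {x : ℕ → Ω → Fin n → ℝ} {C : ℝ}
    (h : ∀ t, MemLp (x t) 2 μ ∧ ∫ ω, ‖x t ω‖ ^ 2 ∂μ ≤ C) : IsStabilized μ x := by
  have hC0 : 0 ≤ C := (integral_nonneg fun ω => by positivity).trans (h 0).2
  refine ⟨1 + C + n * C, fun t => ⟨(h t).1, fun a => ?_, ?_⟩⟩
  · have hi : Integrable (fun ω => 1 + ‖x t ω‖ ^ 2) μ :=
      (integrable_const _).add (h t).1.norm.integrable_sq
    have h1 : |∫ ω, x t ω a ∂μ| ≤ ∫ ω, (1 + ‖x t ω‖ ^ 2) ∂μ := by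
      refine abs_integral_le_integral_abs.trans (integral_mono_of_nonneg
        (Eventually.of_forall fun ω => abs_nonneg _) hi (Eventually.of_forall fun ω => ?_))
      have h2 := apply_sq_le_norm_sq (x t ω) a
      simp only
      nlinarith [sq_abs (x t ω a), sq_nonneg (|x t ω a| - 1), sq_nonneg (x t ω a)]
    rw [integral_add (integrable_const _) (h t).1.norm.integrable_sq] at h1
    simp only [integral_const, probReal_univ, smul_eq_mul, mul_one] at h1
    have : 0 ≤ (n : ℝ) * C := by positivity
    linarith [(h t).2]
  · have h1 : ∫ ω, x t ω ⬝ᵥ x t ω ∂μ = ∑ a, ∫ ω, x t ω a ^ 2 ∂μ := by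
      rw [← integral_finsetSum _ fun a _ => ((h t).1.eval a).integrable_sq]
      simp only [dotProduct, sq]
    have h2 : ∑ a, ∫ ω, x t ω a ^ 2 ∂μ ≤ ∑ _ : Fin n, C := Finset.sum_le_sum fun a _ =>
      (integral_apply_sq_le (h t).1 a).trans (h t).2
    rw [h1]
    simp only [Finset.sum_const, Finset.card_univ, Fintype.card_fin, nsmul_eq_mul] at h2
    linarith

end Moments

lemma tendsto_succ_div {q : ℕ → ℝ} (hq : ∀ t, 0 ≤ q t)
    (h : Tendsto (fun t : ℕ => q t / (t : ℝ)) atTop (𝓝 0)) :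
    Tendsto (fun t : ℕ => q (t + 1) / (t : ℝ)) atTop (𝓝 0) := by
  have h1 := (h.comp (tendsto_add_atTop_nat 1)).const_mul 2
  rw [mul_zero] at h1
  refine squeeze_zero' (Eventually.of_forall fun t => div_nonneg (hq _) (by positivity)) ?_ h1
  filter_upwards [eventually_gt_atTop 0] with t ht
  have ht' : (1 : ℝ) ≤ t := by exact_mod_cast ht
  simp only [Function.comp_apply, Nat.cast_add, Nat.cast_one]
  rw [← mul_div_assoc, div_le_div_iff₀ (by positivity) (by positivity)]
  nlinarith [hq (t + 1), mul_nonneg (hq (t + 1)) (sub_nonneg.2 ht')]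

namespace Plant

variable {nx nu nw : ℕ} {S : Plant nx nu nw} {P : Matrix (Fin nx) (Fin nx) ℝ}

/-- The dual Lyapunov equation that turns the trace formulas into telescoping sums. -/
lemma IsStabilizingDARESolution.exists_dual (hP : S.IsStabilizingDARESolution P) :
    ∃ Y : Matrix (Fin nx) (Fin nx) ℝ, Yᵀ = Y ∧
      S.Ahat P * Y * (S.Ahat P)ᵀ - Y + (S.Kv P)ᵀ * S.H P * S.Kv P = 0 := by
  obtain ⟨Y, hY, -⟩ := hP.schur.transpose.existsUnique_lyapunov ((S.Kv P)ᵀ * S.H P * S.Kv P)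
  have hpos := hP.schur.transpose.lyapunov_posSemidef hY
    (PosSemidef.transpose_mul_mul_same hP.posDef.posSemidef _)
  rw [Matrix.transpose_transpose] at hY
  exact ⟨Y, PosSemidef.transpose_eq hpos, hY⟩

/-- Under the feedback law driven by an `o(√t)` signal, the state is `o(√t)`. -/
lemma tendsto_state_sq_div (hP : IsSchur (S.Ahat P)) {x v : ℕ → Fin nx → ℝ} {u : ℕ → Fin nu → ℝ}
    {w : ℕ → Fin nw → ℝ}
    (hx : ∀ t, x (t + 1) = S.A *ᵥ x t + S.Bu *ᵥ u t + S.Bw *ᵥ w t)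
    (hu : ∀ t, u t = -(S.Kx P *ᵥ x t) - S.Kw P *ᵥ w t - S.Kv P *ᵥ v (t + 1))
    (hw : Tendsto (fun t : ℕ => ‖w t‖ ^ 2 / (t : ℝ)) atTop (𝓝 0))
    (hv : Tendsto (fun t : ℕ => ‖v t‖ ^ 2 / (t : ℝ)) atTop (𝓝 0)) :
    Tendsto (fun t : ℕ => ‖x t‖ ^ 2 / (t : ℝ)) atTop (𝓝 0) := by
  obtain ⟨C, hC, hb⟩ := exists_closedLoop_input_sq_le S P
  refine hP.tendsto_norm_sq_div (fun t => by rw [hx, hu, closedLoop_step]) ?_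
  have h1 := (hw.add (tendsto_succ_div (fun t => by positivity) hv)).const_mul C
  rw [add_zero, mul_zero] at h1
  refine squeeze_zero (fun t => by positivity) (fun t => ?_) h1
  rw [← add_div, ← mul_div_assoc]
  gcongr
  exact hb _ _

/-- The average cost of the feedback law driven by a signal `v`. -/
lemma tendsto_average_cost_feedback (hP : S.IsStabilizingDARESolution P)
    {Y : Matrix (Fin nx) (Fin nx) ℝ} {x v : ℕ → Fin nx → ℝ} {u : ℕ → Fin nu → ℝ} {w : ℕ → Fin nw → ℝ} {c : ℝ}
    (hx : ∀ t, x (t + 1) = S.A *ᵥ x t + S.Bu *ᵥ u t + S.Bw *ᵥ w t)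
    (hu : ∀ t, u t = -(S.Kx P *ᵥ x t) - S.Kw P *ᵥ w t - S.Kv P *ᵥ v (t + 1))
    (hw : Tendsto (fun t : ℕ => ‖w t‖ ^ 2 / (t : ℝ)) atTop (𝓝 0))
    (hv : Tendsto (fun t : ℕ => ‖v t‖ ^ 2 / (t : ℝ)) atTop (𝓝 0))
    (hlim : Tendsto (fun T : ℕ =>
      (1 / (T : ℝ)) * ∑ t ∈ Finset.range T, (x t ⬝ᵥ (S.Q *ᵥ x t) + u t ⬝ᵥ (S.R *ᵥ u t)) -
      (1 / (T : ℝ)) * ∑ t ∈ Finset.range T, S.deviation P (x t) (u t) (w t) (v (t + 1)) ⬝ᵥ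
        (S.H P *ᵥ S.deviation P (x t) (u t) (w t) (v (t + 1))) +
      storage P Y (x T) (v T) / (T : ℝ)) atTop (𝓝 c)) :
    Tendsto (fun T : ℕ =>
      (1 / (T : ℝ)) * ∑ t ∈ Finset.range T, (x t ⬝ᵥ (S.Q *ᵥ x t) + u t ⬝ᵥ (S.R *ᵥ u t)))
      atTop (𝓝 c) := by
  have h0 : ∀ t, S.deviation P (x t) (u t) (w t) (v (t + 1)) = 0 := fun t => by
    rw [deviation_eq, hu, sub_self]
  have h1 := hlim.sub
    (tendsto_storage_div (P := P) (Y := Y) (tendsto_state_sq_div hP.schur hx hu hw hv) hv)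
  rw [sub_zero] at h1
  refine h1.congr fun T => ?_
  simp [h0]

end Plant

/-! ### Moments and averages of the signals driven by white noise -/

section Signals

variable {nx nu nw : ℕ} {Ω : Type*} {m0 : MeasurableSpace Ω} {μ : Measure Ω}
  {w : ℕ → Ω → Fin nw → ℝ} {S : Plant nx nu nw} {P : Matrix (Fin nx) (Fin nx) ℝ}

lemma measurable_previewSignal {m : MeasurableSpace Ω} {p t : ℕ}
    (h : ∀ s, t ≤ s → s < t + p → Measurable[m] (w s)) :
    Measurable[m] fun ω => S.previewSignal P p (fun s => w s ω) t := by
  unfold Plant.previewSignal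
  exact Finset.measurable_fun_sum _ fun l hl => measurable_mulVec_comp _
    (h (t + l) (by omega) (by have := Finset.mem_range.1 hl; omega))

lemma measurable_noncausalSignal {t : ℕ} :
    Measurable[noiseFrom w t] fun ω => S.noncausalSignal P (fun s => w s ω) t := by
  unfold Plant.noncausalSignal
  exact @Measurable.tsum _ _ _ (noiseFrom w t) _ _ _ _ _ _ _ _ _ _ _ _ fun l =>
    measurable_mulVec_comp _ (measurable_noiseFrom (by omega))

lemma IsWhiteNoise.exists_previewSignal_moment_le (hw : IsWhiteNoise μ w)
    (hP : IsSchur (S.Ahat P)) :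
    ∃ B : ℝ, ∀ p t, MemLp (fun ω => S.previewSignal P p (fun s => w s ω) t) 2 μ ∧
      ∫ ω, ‖S.previewSignal P p (fun s => w s ω) t‖ ^ 2 ∂μ ≤ B := by
  obtain ⟨C, r, hC, hr, hr1, hb⟩ := Plant.exists_norm_previewSignal_sq_le hP
  refine ⟨C * ((1 - r)⁻¹ * nw), fun p t => ?_⟩
  have hi : ∀ l ∈ Finset.range p, Integrable (fun ω => r ^ l * ‖w (t + l) ω‖ ^ 2) μ :=
    fun l _ => (hw.integrable_norm_sq (t + l)).const_mul _
  obtain ⟨h1, h2⟩ := memLp_two_of_norm_sq_le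
    (measurable_previewSignal (S := S) (P := P) fun s _ _ => hw.meas s)
    ((integrable_finsetSum _ hi).const_mul C) fun ω => hb p (fun s => w s ω) t
  refine ⟨h1, h2.trans ?_⟩
  rw [integral_const_mul, integral_finsetSum _ hi]
  gcongr
  calc ∑ l ∈ Finset.range p, ∫ ω, r ^ l * ‖w (t + l) ω‖ ^ 2 ∂μ
      ≤ ∑ l ∈ Finset.range p, r ^ l * nw := by
        refine Finset.sum_le_sum fun l _ => ?_
        rw [integral_const_mul]
        gcongr
        exact hw.integral_norm_sq_le _
    _ = (∑ l ∈ Finset.range p, r ^ l) * nw := by rw [Finset.sum_mul]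
    _ ≤ _ := by
        gcongr
        rw [← tsum_geometric_of_lt_one hr.le hr1]
        exact (summable_geometric_of_lt_one hr.le hr1).sum_le_tsum _ fun i _ => by positivity

lemma IsWhiteNoise.exists_noncausalSignal_moment_le (hw : IsWhiteNoise μ w)
    (hP : IsSchur (S.Ahat P)) :
    ∃ B : ℝ, ∀ t, MemLp (fun ω => S.noncausalSignal P (fun s => w s ω) t) 2 μ ∧
      ∫ ω, ‖S.noncausalSignal P (fun s => w s ω) t‖ ^ 2 ∂μ ≤ B := by
  obtain ⟨B, hB⟩ := hw.exists_previewSignal_moment_le hP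
  refine ⟨B, fun t => memLp_two_of_tendsto
    (f := fun p ω => S.previewSignal P p (fun s => w s ω) t)
    (fun p => measurable_previewSignal fun s _ _ => hw.meas s)
    (fun p => (hB p t).1) (fun p => (hB p t).2)
    (measurable_noncausalSignal.mono (noiseFrom_le fun s _ => hw.meas s) le_rfl) ?_⟩
  filter_upwards [hw.ae_tendsto_norm_sq_div] with ω hω
  exact Plant.tendsto_previewSignal (Plant.summable_anticipation hP hω t)

lemma IsWhiteNoise.ae_hasAverage_mul_previewSignal (hw : IsWhiteNoise μ w)
    (hP : IsSchur (S.Ahat P)) (p : ℕ) : ∀ᵐ ω ∂μ, ∀ a b,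
      HasAverage (fun t => w t ω a * S.previewSignal P p (fun s => w s ω) (t + 1) b) 0 := by
  obtain ⟨B, hB⟩ := hw.exists_previewSignal_moment_le hP
  exact hw.ae_hasAverage_mul_future
    (fun t => measurable_previewSignal fun s hs _ => measurable_noiseFrom hs)
    (fun t => (hB p (t + 1)).1)
    fun t a => (integral_apply_sq_le (hB p (t + 1)).1 a).trans (hB p (t + 1)).2

lemma IsWhiteNoise.ae_hasAverage_mul_noncausalSignal (hw : IsWhiteNoise μ w)
    (hP : IsSchur (S.Ahat P)) : ∀ᵐ ω ∂μ, ∀ a b,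
      HasAverage (fun t => w t ω a * S.noncausalSignal P (fun s => w s ω) (t + 1) b) 0 := by
  obtain ⟨B, hB⟩ := hw.exists_noncausalSignal_moment_le hP
  exact hw.ae_hasAverage_mul_future (fun t => measurable_noncausalSignal)
    (fun t => (hB (t + 1)).1)
    fun t a => (integral_apply_sq_le (hB (t + 1)).1 a).trans (hB (t + 1)).2

end Signals

/-- The cost converges to a constant almost surely, so its conditional expectation is that constant
whatever the conditioning σ-algebra. -/
lemma hasExpectedPerStepCost_of_ae_tendsto {nx nu nw : ℕ} {Ω : Type*} {m m0 : MeasurableSpace Ω}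
    {μ : Measure Ω} [IsProbabilityMeasure μ] {S : Plant nx nu nw} {x : ℕ → Ω → Fin nx → ℝ}
    {u : ℕ → Ω → Fin nu → ℝ} (hm : m ≤ m0) {c : ℝ}
    (h : ∀ᵐ ω ∂μ, Tendsto (fun T => averageCost S x u T ω) atTop (𝓝 c)) :
    HasExpectedPerStepCost S μ m x u c :=
  ⟨fun _ => c, h, integrable_const c, by rw [condExp_const hm c]⟩

/-! ### Per-step cost: the noncausal value and the lower bound for preview policies -/

section Cost

variable {nx nu nw : ℕ} {Ω : Type*} {m0 : MeasurableSpace Ω} {μ : Measure Ω}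
  {w : ℕ → Ω → Fin nw → ℝ} {x₀ : Ω → Fin nx → ℝ} {S : Plant nx nu nw}
  {P : Matrix (Fin nx) (Fin nx) ℝ} {x : ℕ → Ω → Fin nx → ℝ} {u : ℕ → Ω → Fin nu → ℝ}

/-- The noncausal controller has the per-step cost of the trace formula, almost surely. -/
lemma ae_tendsto_averageCost_noncausal (hR : S.Rᵀ = S.R) (hP : S.IsStabilizingDARESolution P)
    {X : Matrix (Fin nx) (Fin nx) ℝ} (hX : S.IsLyapunovSolution P X) (hw : IsWhiteNoise μ w)
    (hx : IsTrajectory S w x₀ x u) (hu : IsNoncausalInput S P w x u) :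
    ∀ᵐ ω ∂μ, Tendsto (fun T => averageCost S x u T ω) atTop
      (𝓝 ((P * S.Bw * S.Bwᵀ).trace - (S.H P * S.Kv P * X * (S.Kv P)ᵀ).trace)) := by
  obtain ⟨Y, hYt, hY⟩ := hP.exists_dual
  filter_upwards [hw.ae_hasAverage_mul, hw.ae_tendsto_norm_sq_div,
    hw.ae_hasAverage_mul_noncausalSignal (S := S) hP.schur] with ω h1 h2 h3
  have hsum := Plant.summable_anticipation (w := fun t => w t ω) hP.schur h2
  have hv : ∀ t, S.noncausalSignal P (fun s => w s ω) t +
      (0 : Matrix (Fin nx) (Fin nw) ℝ) *ᵥ w (t + 0) ω = (S.Ahat P)ᵀ *ᵥ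
        S.costate P (w t ω) (S.noncausalSignal P (fun s => w s ω) (t + 1)) := fun t => by
    rw [Matrix.zero_mulVec, add_zero]
    exact Plant.noncausalSignal_eq (w := fun t => w t ω) hsum t
  -- The recursion is exact, so `E = 0`. No product of the state with the noise has to be averaged,
  -- although the state under a noncausal input may be correlated with later noise.
  have hxe : HasAverage (fun t => x t ω ⬝ᵥ ((0 : Matrix (Fin nx) (Fin nw) ℝ) *ᵥ w (t + 0) ω)) 0 := by
    simp only [Matrix.zero_mulVec, dotProduct_zero]
    exact HasAverage.zero
  have hve : HasAverage (fun t => S.noncausalSignal P (fun s => w s ω) t ⬝ᵥ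
      ((Y * (0 : Matrix (Fin nx) (Fin nw) ℝ)) *ᵥ w (t + 0) ω)) 0 := by
    simp only [Matrix.mul_zero, Matrix.zero_mulVec, dotProduct_zero]
    exact HasAverage.zero
  have h4 := Plant.tendsto_average_cost (x := fun t => x t ω)
    (v := S.noncausalSignal P fun s => w s ω) (u := fun t => u t ω) (w := fun t => w t ω)
    hR hP hYt hY 0 0 (fun t => hx.step t ω) hv h1 h3 hxe hve
  rw [Matrix.mul_zero, Matrix.trace_zero, add_zero, Plant.noncausalCost_eq hY hX] at h4
  exact Plant.tendsto_average_cost_feedback (x := fun t => x t ω)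
    (v := S.noncausalSignal P fun s => w s ω) (u := fun t => u t ω) (w := fun t => w t ω)
    hP (fun t => hx.step t ω) (fun t => hu t ω) h2
    (Plant.tendsto_norm_signal_sq_div hP.schur h2).2 h4

variable [IsProbabilityMeasure μ]

/-- Asymptotics of the average cost of a stabilizing policy with preview. -/
lemma IsClosedLoop.ae_tendsto_averageCost_sub (hR : S.Rᵀ = S.R)
    (hP : S.IsStabilizingDARESolution P) {Y : Matrix (Fin nx) (Fin nx) ℝ} (hYt : Yᵀ = Y)
    (hY : S.Ahat P * Y * (S.Ahat P)ᵀ - Y + (S.Kv P)ᵀ * S.H P * S.Kv P = 0) {p : ℕ}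
    {K : Policy nx nu nw p} (hcl : IsClosedLoop S μ w x₀ K x u) (hw : IsWhiteNoise μ w)
    (hx₀ : IsInitialState μ w x₀) (hst : IsStabilized μ x) :
    ∀ᵐ ω ∂μ, Tendsto (fun T : ℕ => averageCost S x u T ω -
      (1 / (T : ℝ)) * ∑ t ∈ Finset.range T,
        S.deviation P (x t ω) (u t ω) (w t ω) (S.previewSignal P p (fun s => w s ω) (t + 1)) ⬝ᵥ
        (S.H P *ᵥ S.deviation P (x t ω) (u t ω) (w t ω)
          (S.previewSignal P p (fun s => w s ω) (t + 1))) +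
      Plant.storage P Y (x T ω) (S.previewSignal P p (fun s => w s ω) T) / (T : ℝ)) atTop
      (𝓝 (S.previewCostFormula P p)) := by
  obtain ⟨B, hB⟩ := hw.exists_previewSignal_moment_le hP.schur
  obtain ⟨C, hC⟩ := hst.exists_integral_norm_sq_le
  -- Both `x t` and the signal at `t`, which uses noise up to `w (t + p - 1)` only, are independent
  -- of `w (t + p)`.
  have hxw := hcl.ae_hasAverage_mul hw hx₀
    (fun t => hcl.toIsTrajectory.measurable_state_sigmaPast le_rfl) (fun t => (hC t).1)
    fun t a => (integral_apply_sq_le (hC t).1 a).trans (hC t).2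
  have hvw := hcl.ae_hasAverage_mul hw hx₀
    (y := fun t ω => S.previewSignal P p (fun s => w s ω) t)
    (fun t => measurable_previewSignal fun s _ hs => measurable_sigmaPast_noise hs)
    (fun t => (hB p t).1) fun t a => (integral_apply_sq_le (hB p t).1 a).trans (hB p t).2
  filter_upwards [hw.ae_hasAverage_mul, hw.ae_hasAverage_mul_previewSignal (S := S) hP.schur p,
    hxw, hvw] with ω h1 h2 h3 h4
  rw [← Plant.previewCost_eq hP.transpose_eq hY]
  exact Plant.tendsto_average_cost (x := fun t => x t ω) (u := fun t => u t ω) hR hP hYt hY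
    (S.anticipationGain P p) p (fun t => hcl.step t ω)
    (fun t => Plant.previewSignal_add p _ t) h1 h2
    (HasAverage.bilin_zero h3 _) (HasAverage.bilin_zero h4 _)

/-- An upper limit can be bounded from below along any one sequence of times. -/
lemma ofReal_le_limsup_of_tendsto_comp {f h : ℕ → ℝ} {φ : ℕ → ℕ} {c : ℝ}
    (hφ : Tendsto φ atTop atTop) (hle : ∀ n, h n ≤ f (φ n)) (hh : Tendsto h atTop (𝓝 c)) :
    ENNReal.ofReal c ≤ limsup (fun T => ENNReal.ofReal (f T)) atTop := by
  have h1 : Tendsto (fun n => ENNReal.ofReal (h n)) atTop (𝓝 (ENNReal.ofReal c)) :=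
    (ENNReal.continuous_ofReal.tendsto _).comp hh
  calc ENNReal.ofReal c = limsup (fun n => ENNReal.ofReal (h n)) atTop := h1.limsup_eq.symm
    _ ≤ limsup (fun n => ENNReal.ofReal (f (φ n))) atTop :=
      limsup_le_limsup (Eventually.of_forall fun n => ENNReal.ofReal_le_ofReal (hle n))
    _ = limsup (fun T => ENNReal.ofReal (f T)) (map φ atTop) := rfl
    _ ≤ _ := limsup_le_limsup_of_le hφ

/-- No stabilizing policy with preview beats the trace formula. -/
lemma IsClosedLoop.ae_le_perStepCost (hR : S.Rᵀ = S.R) (hP : S.IsStabilizingDARESolution P)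
    {p : ℕ} {K : Policy nx nu nw p} (hcl : IsClosedLoop S μ w x₀ K x u) (hw : IsWhiteNoise μ w)
    (hx₀ : IsInitialState μ w x₀) (hst : IsStabilized μ x) :
    ∀ᵐ ω ∂μ, ENNReal.ofReal (S.previewCostFormula P p) ≤ perStepCost S x u ω := by
  obtain ⟨Y, hYt, hY⟩ := hP.exists_dual
  obtain ⟨C, hC⟩ := hst.exists_integral_norm_sq_le
  -- A general stabilizing policy only has bounded second moments, which need not make `‖x T‖² / T`
  -- vanish almost surely. Along `T = n²` its expectations are at most `C / n²`, hence summable.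
  have hsq : Tendsto (fun n : ℕ => n ^ 2) atTop atTop := tendsto_pow_atTop two_ne_zero
  have hxsq : ∀ᵐ ω ∂μ, Tendsto (fun n : ℕ => ‖x (n ^ 2) ω‖ ^ 2 / ((n ^ 2 : ℕ) : ℝ)) atTop
      (𝓝 0) := by
    refine ae_tendsto_zero_of_integral_le_summable (b := fun n => C / (n : ℝ) ^ 2)
      (fun n => (hC _).1.norm.integrable_sq.div_const _) (fun n ω => by positivity)
      (fun n => ?_) (summable_const_div_sq C)
    rw [integral_div]
    push_cast
    gcongr
    exact (hC _).2
  filter_upwards [hcl.ae_tendsto_averageCost_sub hR hP hYt hY hw hx₀ hst, hxsq,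
    hw.ae_tendsto_norm_sq_div] with ω h1 h2 h3
  have hv := (Plant.tendsto_norm_signal_sq_div (S := S) hP.schur h3).1 p
  have h4 := Plant.tendsto_storage_div (P := P) (Y := Y) (l := map (fun n : ℕ => n ^ 2) atTop)
    (x := fun t => x t ω) (tendsto_map'_iff.2 h2) (hv.mono_left hsq)
  have h5 := (h1.comp hsq).sub (tendsto_map'_iff.1 h4)
  rw [sub_zero] at h5
  refine ofReal_le_limsup_of_tendsto_comp (f := fun T => averageCost S x u T ω) hsq
    (fun n => ?_) h5
  simp only [Function.comp_apply, add_sub_cancel_right]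
  -- Optimality enters here: the form `dᵀ H d` of the deviation is nonnegative and can be discarded.
  refine sub_le_self _ (mul_nonneg (by positivity) (Finset.sum_nonneg fun t _ => ?_))
  exact PosSemidef.dotProduct_nonneg hP.posDef.posSemidef _

end Cost

/-! ### The preview controller: admissibility, stability, optimality -/

section PreviewController

variable {nx nu nw : ℕ} {Ω : Type*} {m0 : MeasurableSpace Ω} {μ : Measure Ω}
  {w : ℕ → Ω → Fin nw → ℝ} {x₀ : Ω → Fin nx → ℝ} {S : Plant nx nu nw}
  {P : Matrix (Fin nx) (Fin nx) ℝ} {x : ℕ → Ω → Fin nx → ℝ} {u : ℕ → Ω → Fin nu → ℝ} {p : ℕ}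

lemma IsPreviewInput.measurable {m : MeasurableSpace Ω} (hx : IsTrajectory S w x₀ x u)
    (hu : IsPreviewInput S P p w x u) (h0 : Measurable[m] x₀) (hw : ∀ s, Measurable[m] (w s))
    (t : ℕ) : Measurable[m] (u t) := by
  induction t using Nat.strong_induction_on with
  | _ t ih =>
    have hxt : Measurable[m] (x t) := hx.measurable_state h0 (fun s _ => hw s) ih
    have : u t = fun ω => -(S.Kx P *ᵥ x t ω) - S.Kw P *ᵥ w t ω -
        S.Kv P *ᵥ S.previewSignal P p (fun s => w s ω) (t + 1) := funext fun ω => by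
      rw [hu t ω, Plant.vPreview_eq]
    rw [this]
    exact ((measurable_mulVec_comp _ hxt).neg.sub (measurable_mulVec_comp _ (hw t))).sub
      (measurable_mulVec_comp _ (measurable_previewSignal fun s _ _ => hw s))

/-- The noise samples that are known at time `t`, extended by zero. -/
def knownNoise (nx : ℕ) (p t : ℕ) (i : Info nx nw p t) (j : ℕ) : Fin nw → ℝ :=
  if h : j < t + p + 1 then i.2 ⟨j, h⟩ else 0

lemma measurable_knownNoise (nx p t j : ℕ) :
    Measurable fun i : Info nx nw p t => knownNoise nx p t i j := by
  unfold knownNoise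
  split_ifs with h
  · exact (measurable_pi_apply _).comp measurable_snd
  · exact measurable_const

variable (S P p) in
/-- The feedback law with preview as a function of the information. -/
noncomputable def previewLaw (t : ℕ) (i : Info nx nw p t) : Fin nu → ℝ :=
  -(S.Kx P *ᵥ i.1 ⟨t, Nat.lt_succ_self t⟩) - S.Kw P *ᵥ knownNoise nx p t i t -
    S.Kv P *ᵥ S.previewSignal P p (knownNoise nx p t i) (t + 1)

lemma measurable_previewLaw (t : ℕ) : Measurable (previewLaw S P p t) := by
  unfold previewLaw
  exact ((measurable_mulVec_comp _ ((measurable_pi_apply _).comp measurable_fst)).neg.sub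
    (measurable_mulVec_comp _ (measurable_knownNoise nx p t t))).sub
    (measurable_mulVec_comp _ (measurable_previewSignal (w := fun s i => knownNoise nx p t i s)
      fun s _ _ => measurable_knownNoise nx p t s))

variable (S P p) in
/-- The deterministic policy of the feedback law with preview. -/
noncomputable def previewPolicy : Policy nx nu nw p where
  kernel t := Kernel.deterministic (previewLaw S P p t) (measurable_previewLaw t)
  markov _ := inferInstance

lemma IsPreviewInput.eq_previewLaw (hu : IsPreviewInput S P p w x u) (t : ℕ) (ω : Ω) :
    u t ω = previewLaw S P p t (info p w x t ω) := by
  have h1 : ∀ j, j < t + p + 1 → knownNoise nx p t (info p w x t ω) j = w j ω := fun j hj => by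
    simp [knownNoise, info, hj]
  have h2 : S.previewSignal P p (knownNoise nx p t (info p w x t ω)) (t + 1) =
      S.previewSignal P p (fun s => w s ω) (t + 1) :=
    Finset.sum_congr rfl fun l hl => by
      rw [h1 _ (by have := Finset.mem_range.1 hl; omega)]
  rw [hu t ω, Plant.vPreview_eq, previewLaw, h1 t (by omega), h2]
  rfl

variable [IsProbabilityMeasure μ]

/-- The input is a function of the initial state and the noise, so the conditional probability of `u
t ∈ E` is its own indicator; that is the Dirac kernel at the value of the feedback law. -/
lemma IsPreviewInput.isClosedLoop (hw : IsWhiteNoise μ w) (hx₀ : IsInitialState μ w x₀)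
    (hx : IsTrajectory S w x₀ x u) (hu : IsPreviewInput S P p w x u) :
    IsClosedLoop S μ w x₀ (previewPolicy S P p) x u where
  toIsTrajectory := hx
  meas_input := hu.measurable hx hx₀.meas hw.meas
  law_input t E hE := by
    have hut : Measurable[sigmaBefore w x₀ u t] (u t) :=
      hu.measurable hx measurable_sigmaBefore_init (fun s => measurable_sigmaBefore_noise) t
    have hF : sigmaBefore w x₀ u t ≤ m0 := sigmaBefore_le hx₀.meas hw.meas
      fun s _ => hu.measurable hx hx₀.meas hw.meas s
    have hind : Measurable[sigmaBefore w x₀ u t] ((u t ⁻¹' E).indicator fun _ => (1 : ℝ)) :=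
      Measurable.indicator measurable_const (hut hE)
    rw [condExp_of_stronglyMeasurable hF hind.stronglyMeasurable
      ((integrable_const (1 : ℝ)).indicator (hF _ (hut hE)))]
    refine Eventually.of_forall fun ω => ?_
    simp only [previewPolicy, Kernel.deterministic_apply]
    rw [← hu.eq_previewLaw, Measure.real, Measure.dirac_apply' _ hE]
    by_cases h : u t ω ∈ E <;> simp [h]

/-- The state is the response of the Schur filter `Â` to `w t` and the preview signal. Their second
moments are bounded uniformly in time, and the geometric weights of the past inputs are summable. -/
lemma IsPreviewInput.isStabilized (hP : IsSchur (S.Ahat P)) (hw : IsWhiteNoise μ w)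
    (hx₀ : IsInitialState μ w x₀) (hx : IsTrajectory S w x₀ x u)
    (hu : IsPreviewInput S P p w x u) : IsStabilized μ x := by
  obtain ⟨B, hB⟩ := hw.exists_previewSignal_moment_le hP
  obtain ⟨C, r, hC, hr, hr1, hb⟩ := hP.exists_norm_sq_le
  obtain ⟨D, hD, hin⟩ := Plant.exists_closedLoop_input_sq_le S P
  have h1r : 0 < 1 - r := by linarith
  have hB0 : 0 ≤ B := (integral_nonneg fun ω => by positivity).trans (hB p 0).2
  have hstep : ∀ ω t, x (t + 1) ω = S.Ahat P *ᵥ x t ω + ((S.Bw - S.Bu * S.Kw P) *ᵥ w t ω -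
      (S.Bu * S.Kv P) *ᵥ S.previewSignal P p (fun s => w s ω) (t + 1)) := fun ω t => by
    rw [hx.step, hu t ω, Plant.vPreview_eq, Plant.closedLoop_step]
  have hi : ∀ s, Integrable (fun ω => D * (‖w s ω‖ ^ 2 +
      ‖S.previewSignal P p (fun s => w s ω) (s + 1)‖ ^ 2)) μ := fun s =>
    ((hw.integrable_norm_sq s).add (hB p (s + 1)).1.norm.integrable_sq).const_mul D
  have hi' : ∀ t, ∀ s ∈ Finset.range t, Integrable (fun ω => r ^ (t - 1 - s) *
      (D * (‖w s ω‖ ^ 2 + ‖S.previewSignal P p (fun s => w s ω) (s + 1)‖ ^ 2))) μ :=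
    fun t s _ => (hi s).const_mul _
  refine isStabilized_of_integral_norm_sq_le
    (C := C * ∫ ω, ‖x₀ ω‖ ^ 2 ∂μ + C * ((1 - r)⁻¹ * (D * (nw + B)))) fun t => ?_
  have hxm : Measurable (x t) := hx.measurable_state hx₀.meas (fun s _ => hw.meas s)
    fun s _ => hu.measurable hx hx₀.meas hw.meas s
  obtain ⟨h1, h2⟩ := memLp_two_of_norm_sq_le hxm
    ((hx₀.memLp.norm.integrable_sq.const_mul C).add
      ((integrable_finsetSum _ (hi' t)).const_mul C)) fun ω => by
      refine (hb (fun t => x t ω) _ (hstep ω) t).trans ?_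
      simp only [hx.init, Pi.add_apply]
      gcongr
      exact hin _ _
  refine ⟨h1, h2.trans ?_⟩
  simp only [Pi.add_apply]
  rw [integral_add (hx₀.memLp.norm.integrable_sq.const_mul C)
    ((integrable_finsetSum _ (hi' t)).const_mul C), integral_const_mul, integral_const_mul,
    integral_finsetSum _ (hi' t)]
  gcongr
  calc _ ≤ ∑ s ∈ Finset.range t, r ^ (t - 1 - s) * (D * (nw + B)) := by
        refine Finset.sum_le_sum fun s _ => ?_
        rw [integral_const_mul, integral_const_mul, integral_add (hw.integrable_norm_sq s)
          (hB p (s + 1)).1.norm.integrable_sq]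
        gcongr
        · exact hw.integral_norm_sq_le s
        · exact (hB p (s + 1)).2
    _ = (∑ s ∈ Finset.range t, r ^ s) * (D * (nw + B)) := by
        rw [← Finset.sum_mul, Finset.sum_range_reflect fun s => r ^ s]
    _ ≤ _ := by
        gcongr
        rw [← tsum_geometric_of_lt_one hr.le hr1]
        exact (summable_geometric_of_lt_one hr.le hr1).sum_le_tsum _ fun i _ => by positivity

/-- The feedback law with preview attains the trace formula, almost surely. -/
lemma IsPreviewInput.ae_tendsto_averageCost (hR : S.Rᵀ = S.R)
    (hP : S.IsStabilizingDARESolution P) (hw : IsWhiteNoise μ w) (hx₀ : IsInitialState μ w x₀)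
    (hx : IsTrajectory S w x₀ x u) (hu : IsPreviewInput S P p w x u) :
    ∀ᵐ ω ∂μ, Tendsto (fun T => averageCost S x u T ω) atTop (𝓝 (S.previewCostFormula P p)) := by
  obtain ⟨Y, hYt, hY⟩ := hP.exists_dual
  filter_upwards [(hu.isClosedLoop hw hx₀ hx).ae_tendsto_averageCost_sub hR hP hYt hY hw hx₀
    (hu.isStabilized hP.schur hw hx₀ hx), hw.ae_tendsto_norm_sq_div] with ω h1 h2
  exact Plant.tendsto_average_cost_feedback hP (fun t => hx.step t ω)
    (fun t => by rw [hu t ω, Plant.vPreview_eq]) h2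
    ((Plant.tendsto_norm_signal_sq_div hP.schur h2).1 p) h1

variable (S P p w x₀) in
/-- The state under the feedback law with preview. -/
noncomputable def previewState : ℕ → Ω → Fin nx → ℝ
  | 0 => x₀
  | t + 1 => fun ω => S.A *ᵥ previewState t ω + S.Bu *ᵥ (-(S.Kx P *ᵥ previewState t ω) -
      S.Kw P *ᵥ w t ω - S.Kv P *ᵥ S.vPreview P p (fun s => w s ω) t) + S.Bw *ᵥ w t ω

lemma exists_isPreviewInput (S : Plant nx nu nw) (P : Matrix (Fin nx) (Fin nx) ℝ) (p : ℕ)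
    (w : ℕ → Ω → Fin nw → ℝ) (x₀ : Ω → Fin nx → ℝ) :
    ∃ (x : ℕ → Ω → Fin nx → ℝ) (u : ℕ → Ω → Fin nu → ℝ),
      IsTrajectory S w x₀ x u ∧ IsPreviewInput S P p w x u :=
  ⟨previewState w x₀ S P p, fun t ω => -(S.Kx P *ᵥ previewState w x₀ S P p t ω) -
      S.Kw P *ᵥ w t ω - S.Kv P *ᵥ S.vPreview P p (fun s => w s ω) t,
    ⟨fun _ => rfl, fun _ _ => rfl⟩, fun _ _ => rfl⟩

/-- The minimum is attained by the preview controller. The lower bound holds for the random cost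
itself, almost surely, and passes to the conditional expectation by monotonicity. -/
lemma isOptimalPreviewCost (hR : S.Rᵀ = S.R) (hP : S.IsStabilizingDARESolution P)
    (hw : IsWhiteNoise μ w) (hx₀ : IsInitialState μ w x₀) (p : ℕ) :
    IsOptimalPreviewCost S μ w x₀ p (S.previewCostFormula P p) := by
  have hm : sigmaInitial p w x₀ ≤ m0 := sigmaInitial_le hx₀.meas hw.meas
  refine ⟨?_, fun K x u hcl hst => ?_⟩
  · obtain ⟨x, u, hx, hu⟩ := exists_isPreviewInput S P p w x₀
    exact ⟨previewPolicy S P p, x, u, hu.isClosedLoop hw hx₀ hx,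
      hu.isStabilized hP.schur hw hx₀ hx,
      hasExpectedPerStepCost_of_ae_tendsto hm (hu.ae_tendsto_averageCost hR hP hw hx₀ hx)⟩
  · have h1 := condLExp_mono (mΩ := sigmaInitial p w x₀)
      (hcl.ae_le_perStepCost hR hP hw hx₀ hst)
    rwa [condLExp_const hm μ] at h1

end PreviewController

end PreviewLQR

/-! ### The main theorem -/

theorem mainTheorem5 {nx nu nw : ℕ} (S : PreviewLQR.Plant nx nu nw) (hS : S.Standing) :
    (∃! P : Matrix (Fin nx) (Fin nx) ℝ, S.IsStabilizingDARESolution P) ∧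
    ∀ P : Matrix (Fin nx) (Fin nx) ℝ, S.IsStabilizingDARESolution P →
      (∃! X : Matrix (Fin nx) (Fin nx) ℝ, S.IsLyapunovSolution P X) ∧
      ∀ X : Matrix (Fin nx) (Fin nx) ℝ, S.IsLyapunovSolution P X →
        ∃ (Jnc : ℝ) (J : ℕ → ℝ),
          Jnc = (P * S.Bw * S.Bwᵀ).trace - (S.H P * S.Kv P * X * (S.Kv P)ᵀ).trace ∧
          (∀ p, J p = S.previewCostFormula P p) ∧
          (∀ (Ω : Type*) [MeasurableSpace Ω] (μ : Measure Ω) [IsProbabilityMeasure μ]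
            (w : ℕ → Ω → Fin nw → ℝ) (x₀ : Ω → Fin nx → ℝ),
            PreviewLQR.IsWhiteNoise μ w → PreviewLQR.IsInitialState μ w x₀ →
            -- the noncausal controller is well defined and its expected per-step cost is `Jnc`
            (∀ᵐ ω ∂μ, ∀ t, Summable (S.vNoncausalTerm P (fun s => w s ω) t)) ∧
            (∀ (x : ℕ → Ω → Fin nx → ℝ) (u : ℕ → Ω → Fin nu → ℝ),
              PreviewLQR.IsTrajectory S w x₀ x u → PreviewLQR.IsNoncausalInput S P w x u →
              PreviewLQR.HasExpectedPerStepCost S μ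
                (MeasurableSpace.comap x₀ inferInstance) x u Jnc) ∧
            -- `J p` is the optimal cost with `p` steps of preview, achieved by the controller
            ∀ p, PreviewLQR.IsOptimalPreviewCost S μ w x₀ p (J p) ∧
              ∀ (x : ℕ → Ω → Fin nx → ℝ) (u : ℕ → Ω → Fin nu → ℝ),
                PreviewLQR.IsTrajectory S w x₀ x u → PreviewLQR.IsPreviewInput S P p w x u →
                (∃ K : PreviewLQR.Policy nx nu nw p,
                  PreviewLQR.IsClosedLoop S μ w x₀ K x u) ∧
                PreviewLQR.IsStabilized μ x ∧
                PreviewLQR.HasExpectedPerStepCost S μ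
                  (PreviewLQR.sigmaInitial p w x₀) x u (J p)) ∧
          Tendsto J atTop (𝓝 Jnc) := by
  have hR := PreviewLQR.PosSemidef.transpose_eq hS.cost_input.posSemidef
  refine ⟨hS.existsUnique_stabilizing, fun P hP =>
    ⟨hP.schur.existsUnique_lyapunov _, fun X hX => ⟨_, S.previewCostFormula P, rfl, fun _ => rfl,
      ?_, PreviewLQR.Plant.tendsto_previewCostFormula hP.schur hX⟩⟩⟩
  intro Ω _ μ _ w x₀ hw hx₀
  refine ⟨?_, fun x u hx hu => ?_, fun p => ⟨PreviewLQR.isOptimalPreviewCost hR hP hw hx₀ p,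
    fun x u hx hu => ⟨⟨_, hu.isClosedLoop hw hx₀ hx⟩, hu.isStabilized hP.schur hw hx₀ hx, ?_⟩⟩⟩
  · filter_upwards [hw.ae_tendsto_norm_sq_div] with ω hω t
    -- The shift to `t + 1` reflects that the signal used by the input at time `t` starts with `w (t
    -- + 1)`.
    exact PreviewLQR.Plant.summable_anticipation hP.schur hω (t + 1)
  · exact PreviewLQR.hasExpectedPerStepCost_of_ae_tendsto hx₀.meas.comap_le
      (PreviewLQR.ae_tendsto_averageCost_noncausal hR hP hX hw hx hu)
  · exact PreviewLQR.hasExpectedPerStepCost_of_ae_tendsto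
      (PreviewLQR.sigmaInitial_le hx₀.meas hw.meas) (hu.ae_tendsto_averageCost hR hP hw hx₀ hx)
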